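/- **Proposition 3.2 (invariance of the shadow coloring number of knotoids).** *Setting.* Let $\Sigma$ be an oriented smooth surface (without boundary). An *oriented knotoid diagram* $D$ in $\Sigma$ is a generic smooth immersion $\gamma:[0,1]\to\Sigma$ (finitely many double points, all of them transverse, no triple points, $\gamma(0)\ne\gamma(1)$, and neither endpoint is a double point), oriented from $0$ to $1$, together with over/under information at each double point. Two diagrams in $\Sigma$ are *equivalent* (present the same knotoid) if they are related by the equivalence relation generated by ambient isotopies of $\Sigma$, orientation preserving reparametrizations, and the three Reidemeister moves, each performed in a disk that contains neither endpoint. The *arcs* of $D$ are the pieces into which the curve is cut at its under-passages, and the *regions* of $D$ are the connected components of $\Sigma\setminus\gamma([0,1])$. The co-orientation normal of an arc points to the left of the arc. A *quandle* is a set $X$ with an operation $(x,y)\mapsto x^y$ such that $x^x=x$, each map $x\mapsto x^y$ is bijective, and $(x^y)^z=(x^z)^{(y^z)}$. An *$X$-set* is a set $Y$ with a map $Y\times X\to Y$, $(y,x)\mapsto y*x$, such that each map $y\mapsto y*x$ is bijective and $(y*a)*b=(y*b)*(a^b)$. An *$(X,Y)$-coloring* of $D$ is a map $c$ that assigns an element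 of $X$ to every arc and an element of $Y$ to every region such that 1. at each crossing with over-arc $b$, if the normal of $b$ points from the under-arc $a$ to the under-arc $a'$, then $c(a')=c(a)^{c(b)}$; 2. if near some point of an arc $a$, neither a crossing nor an endpoint of the diagram, the regions on the two sides are $r_1$ and $r_2$, and the normal of $a$ points from $r_1$ to $r_2$, then $c(r_1)*c(a)=c(r_2)$; 3. if the arc $a$ contains an endpoint of the diagram and $r$ is the region around that endpoint, then $c(r)*c(a)=c(r)$. Let $Col_{(X,Y)}(D)$ be the set of $(X,Y)$-colorings of $D$ and let $col_{(X,Y)}(D)$ be its cardinal number, the *shadow coloring number*. *Statement.* Let $X$ be a quandle and $Y$ an $X$-set. If two oriented knotoid diagrams $D$ and $D'$ in $\Sigma$ are equivalent, then there is a bijection between $Col_{(X,Y)}(D)$ and $Col_{(X,Y)}(D')$. Hence $col_{(X,Y)}(D)$ depends only on the knotoid presented by $D$: there is a cardinal-valued function on the set of oriented knotoids in $\Sigma$ whose value at the knotoid presented by $D$ is $col_{(X,Y)}(D)$, for every oriented knotoid diagram $D$ in $\Sigma$. -/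

import Mathlib

open Set Filter Topology
open scoped Manifold ContDiff Quandles

namespace Knotoids

/-! ### Quandle sets -/

/-- For a quandle `X`, an `X`-set: a set `Y` with a map `Y × X → Y`, `(y, x) ↦ y * x`, such that
every `y ↦ y * x` is a bijection and `(y * a) * b = (y * b) * (a ^ b)`.
For quandles, Mathlib writes `b ◃ a` for the element `a ^ b`. -/
class QuandleSet (X : Type*) (Y : Type*) [Quandle X] where
  act : Y → X → Y
  act_bijective : ∀ x : X, Function.Bijective fun y : Y => act y x
  act_act : ∀ (y : Y) (a b : X), act (act y a) b = act (act y b) (b ◃ a)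

/-! ### Oriented surfaces

An oriented smooth surface is a Hausdorff second countable space `S` with
`[ChartedSpace Plane S] [HasGroupoid S orientedGroupoid]`. -/

/-- The coordinate plane with its standard orientation. -/
abbrev Plane : Type := ℝ × ℝ

/-- The smooth maps with positive Jacobian determinant. -/
def orientedPregroupoid : Pregroupoid Plane where
  property f s := ContDiffOn ℝ ∞ f s ∧ ∀ x ∈ s, 0 < (fderiv ℝ f x).det
  comp := by
    rintro f g u v ⟨hf, hf'⟩ ⟨hg, hg'⟩ hu hv huv
    refine ⟨hg.comp (hf.mono inter_subset_left) fun x hx => hx.2, ?_⟩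
    rintro x ⟨hxu, hxv⟩
    have h1 : DifferentiableAt ℝ f x :=
      (hf.contDiffAt (hu.mem_nhds hxu)).differentiableAt (by simp)
    have h2 : DifferentiableAt ℝ g (f x) :=
      (hg.contDiffAt (hv.mem_nhds hxv)).differentiableAt (by simp)
    rw [fderiv_comp x h2 h1]
    have h3 : ((fderiv ℝ g (f x)).comp (fderiv ℝ f x)).det
        = (fderiv ℝ g (f x)).det * (fderiv ℝ f x).det := by
      simp [ContinuousLinearMap.det, LinearMap.det_comp]
    rw [h3]
    exact mul_pos (hg' _ hxv) (hf' _ hxu)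
  id_mem := by
    refine ⟨contDiffOn_id, fun x _ => ?_⟩
    simp [ContinuousLinearMap.det]
  locality := by
    intro f u hu h
    refine ⟨fun x hx => ?_, fun x hx => ?_⟩
    · obtain ⟨v, hv, hxv, hf, -⟩ := h x hx
      exact (hf.contDiffAt ((hu.inter hv).mem_nhds ⟨hx, hxv⟩)).contDiffWithinAt
    · obtain ⟨v, hv, hxv, -, hf⟩ := h x hx
      exact hf x ⟨hx, hxv⟩
  congr := by
    rintro f g u hu hfg ⟨hf, hf'⟩
    refine ⟨hf.congr hfg, fun x hx => ?_⟩
    have h : g =ᶠ[𝓝 x] f := Filter.eventually_of_mem (hu.mem_nhds hx) hfg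
    rw [h.fderiv_eq]
    exact hf' x hx

/-- The orientation preserving smooth diffeomorphisms between open subsets of the plane. -/
def orientedGroupoid : StructureGroupoid Plane := orientedPregroupoid.groupoid

section Diagrams

variable {S : Type*} [TopologicalSpace S] [ChartedSpace Plane S]

/-- Charts of the maximal oriented smooth atlas of `S`. -/
def IsOrientedChart (e : OpenPartialHomeomorph S Plane) : Prop :=
  e ∈ orientedGroupoid.maximalAtlas S

/-- In the coordinates `e`, near the parameter `t` the curve `γ` is the straight curve through the
origin with velocity `d`. -/
def StraightAt (γ : unitInterval → S) (e : OpenPartialHomeomorph S Plane) (t : unitInterval)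
    (d : Plane) : Prop :=
  γ t ∈ e.source ∧ ∀ᶠ v in 𝓝 t, e (γ v) = ((v : ℝ) - (t : ℝ)) • d

variable (S) in
/-- An oriented knotoid diagram in the oriented surface `S`: a generic smooth immersion of the unit
interval, oriented from `0` to `1`, with crossing information. Being a smooth immersion is expressed
by the local normal form `v ↦ (v - t, 0)` in a smooth chart, being a transverse double point by the
normal form of two curves that run along the two coordinate axes. -/
structure KnotoidDiagram where
  curve : C(unitInterval, S)
  immersion : ∀ t, ∃ e : OpenPartialHomeomorph S Plane,
    IsOrientedChart e ∧ StraightAt curve e t (1, 0)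
  /-- The two endpoints are distinct and are not double points. -/
  endpoints : ∀ t, (curve t = curve 0 → t = 0) ∧ (curve t = curve 1 → t = 1)
  transverse : ∀ s t, s ≠ t → curve s = curve t → ∃ e : OpenPartialHomeomorph S Plane,
    IsOrientedChart e ∧ StraightAt curve e s (1, 0) ∧
      (StraightAt curve e t (0, 1) ∨ StraightAt curve e t (0, -1))
  noTriple : ∀ r s t, curve r = curve s → curve s = curve t → r = s ∨ s = t ∨ r = t
  finite_double : {t | ∃ s, s ≠ t ∧ curve s = curve t}.Finite
  /-- The crossing information: the parameters at which the curve passes under itself. -/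
  under : Set unitInterval
  under_double : ∀ t ∈ under, ∃ s, s ≠ t ∧ curve s = curve t
  under_iff : ∀ s t, s ≠ t → curve s = curve t → (s ∈ under ↔ t ∉ under)

namespace KnotoidDiagram

variable (D : KnotoidDiagram S)

/-- The arcs of the diagram: the pieces into which the curve is cut at the under-passages. -/
def Arc : Type := ConnectedComponents {t : unitInterval // t ∉ D.under}

/-- The regions of the diagram: the connected components of the complement of its image. -/
def Region : Type _ := ConnectedComponents {p : S // p ∉ range D.curve}

variable {D}

/-- The parameters of the points of an arc. -/
def Arc.params (a : D.Arc) : Set unitInterval :=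
  {t | ∃ h : t ∉ D.under, ConnectedComponents.mk (⟨t, h⟩ : {t // t ∉ D.under}) = a}

/-- The points of a region. -/
def Region.points (r : D.Region) : Set S :=
  {p | ∃ h : p ∉ range D.curve,
    ConnectedComponents.mk (⟨p, h⟩ : {p // p ∉ range D.curve}) = r}

/-- There is a crossing with over-arc `b` and under-arcs `a` and `c` such that the co-orientation
normal of `b` (which points to the left of `b`) points from `a` to `c`. In the chart `e` the over-arc
runs along the first axis to the right, and the under-strand runs upwards (`ε = 1`) or downwards
(`ε = -1`) along the second axis. -/
def CrossingTriple (a b c : D.Arc) : Prop :=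
  ∃ s t : unitInterval, s ∈ b.params ∧ t ∈ D.under ∧ D.curve s = D.curve t ∧
    ∃ (e : OpenPartialHomeomorph S Plane) (ε : ℝ), IsOrientedChart e ∧ (ε = 1 ∨ ε = -1) ∧
      StraightAt D.curve e s (1, 0) ∧ StraightAt D.curve e t (0, ε) ∧
      ∀ᶠ v : unitInterval in 𝓝 t, (ε * ((v : ℝ) - (t : ℝ)) < 0 → v ∈ a.params) ∧
        (0 < ε * ((v : ℝ) - (t : ℝ)) → v ∈ c.params)

/-- At some point of the arc `a`, neither an endpoint nor a crossing of the diagram, the regions `r₁`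
and `r₂` are the ones on the two sides, and the co-orientation normal of `a` (to the left of `a`)
points from `r₁` to `r₂`. -/
def AdjacentAlong (a : D.Arc) (r₁ r₂ : D.Region) : Prop :=
  ∃ t ∈ a.params, t ≠ 0 ∧ t ≠ 1 ∧ (∀ v, D.curve v = D.curve t → v = t) ∧
    ∃ e : OpenPartialHomeomorph S Plane, IsOrientedChart e ∧ StraightAt D.curve e t (1, 0) ∧
      ∀ᶠ y in 𝓝[>] (0 : ℝ), e.symm (0, -y) ∈ r₁.points ∧ e.symm (0, y) ∈ r₂.points

/-- The arc `a` meets an endpoint of the diagram, and `r` is the region around this endpoint. -/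
def AdjacentAtEnd (a : D.Arc) (r : D.Region) : Prop :=
  ∃ t : unitInterval, (t = 0 ∨ t = 1) ∧ t ∈ a.params ∧ D.curve t ∈ closure r.points

end KnotoidDiagram

/-! ### Shadow colorings -/

/-- The set of `(X, Y)`-colorings of the diagram `D`. -/
@[ext]
structure Coloring (X Y : Type*) [Quandle X] [QuandleSet X Y] (D : KnotoidDiagram S) where
  arcColor : D.Arc → X
  regionColor : D.Region → Y
  crossing : ∀ a b c : D.Arc, KnotoidDiagram.CrossingTriple a b c →
    arcColor c = arcColor b ◃ arcColor a
  side : ∀ (a : D.Arc) (r₁ r₂ : D.Region), KnotoidDiagram.AdjacentAlong a r₁ r₂ →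
    QuandleSet.act (regionColor r₁) (arcColor a) = regionColor r₂
  endpoint : ∀ (a : D.Arc) (r : D.Region), KnotoidDiagram.AdjacentAtEnd a r →
    QuandleSet.act (regionColor r) (arcColor a) = regionColor r

/-- The shadow coloring number by `(X, Y)`. -/
noncomputable def coloringNumber (X Y : Type*) [Quandle X] [QuandleSet X Y]
    (D : KnotoidDiagram S) : Cardinal :=
  Cardinal.mk (Coloring X Y D)

/-! ### Equivalence of diagrams -/

/-- `D'` is obtained from `D` by an ambient isotopy `H` of the surface, up to an orientation
preserving change of the parameter. -/
def Isotopic (D D' : KnotoidDiagram S) : Prop :=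
  ∃ (H : ℝ → Structomorph orientedGroupoid S S) (ρ : unitInterval ≃o unitInterval),
    ContMDiff (𝓘(ℝ, ℝ).prod 𝓘(ℝ, Plane)) 𝓘(ℝ, Plane) ∞
      (fun q : ℝ × S => (H q.1).toHomeomorph q.2) ∧
    (∀ p, (H 0).toHomeomorph p = p) ∧
    ∀ t, D'.curve t = (H 1).toHomeomorph (D.curve (ρ t)) ∧ (t ∈ D'.under ↔ ρ t ∈ D.under)

/-- The square `[-1, 1] × [-1, 1]`. -/
def square : Set Plane := Icc (-1) 1 ×ˢ Icc (-1) 1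

/-- `D` and `D'` agree outside a disk, which is the preimage of the square under a chart `e` and
contains no endpoint. The part of `D` in the disk consists of the `n` strands `D.curve '' [a i, b i]`,
which in the chart run along the plane curves `c i : [-1, 1] → square` in one of the two directions,
and likewise for `D'` and the curves `c' i`. Every strand passes over the strands of smaller height,
in both diagrams. -/
def ReplacedInDisk {n : ℕ} (c c' : Fin n → ℝ → Plane) (D D' : KnotoidDiagram S) : Prop :=
  ∃ (e : OpenPartialHomeomorph S Plane) (a b : Fin n → unitInterval)
    (τ : Fin n → unitInterval → ℝ) (height : Fin n → ℕ),
    IsOrientedChart e ∧ square ⊆ e.target ∧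
    (∀ i, 0 < a i ∧ a i < b i ∧ b i < 1) ∧
    (∀ i j, i ≠ j → Disjoint (Icc (a i) (b i)) (Icc (a j) (b j))) ∧
    (∀ i, (StrictMonoOn (τ i) (Icc (a i) (b i)) ∧ τ i (a i) = -1 ∧ τ i (b i) = 1) ∨
      (StrictAntiOn (τ i) (Icc (a i) (b i)) ∧ τ i (a i) = 1 ∧ τ i (b i) = -1)) ∧
    (∀ i, ∀ t ∈ Icc (a i) (b i),
      (D.curve t ∈ e.source ∧ e (D.curve t) = c i (τ i t)) ∧
      (D'.curve t ∈ e.source ∧ e (D'.curve t) = c' i (τ i t))) ∧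
    (∀ t, (∀ i, t ∉ Icc (a i) (b i)) →
      D'.curve t = D.curve t ∧ (t ∈ D'.under ↔ t ∈ D.under) ∧
        ¬ (D.curve t ∈ e.source ∧ e (D.curve t) ∈ square)) ∧
    Function.Injective height ∧
    ∀ i j, i ≠ j → ∀ s ∈ Icc (a i) (b i), ∀ t ∈ Icc (a j) (b j),
      (D.curve s = D.curve t → (s ∈ D.under ↔ height i < height j)) ∧
      (D'.curve s = D'.curve t → (s ∈ D'.under ↔ height i < height j))

/-- The first Reidemeister move: the strand `(u, -u² / 2)` is replaced by the strand
`(u * k u, -u² / 2)`, which has one double point, for `u = ± 1 / 2`. -/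
def ReidemeisterOne (D D' : KnotoidDiagram S) : Prop :=
  ∃ k : ℝ → ℝ, (∀ u, k (-u) = k u) ∧
    (∀ u, 3 / 4 ≤ |u| → k u = 1) ∧
    (∀ u, |u| < 1 → |u * k u| < 1) ∧
    (∀ u, |u| < 1 / 2 → k u < 0) ∧
    (∀ u, 1 / 2 < |u| → 0 < k u) ∧
    ReplacedInDisk ![fun u => (u, -u ^ 2 / 2)] ![fun u => (u * k u, -u ^ 2 / 2)] D D'

/-- The second Reidemeister move: the graph of `f` lies below the horizontal strand and is replaced
by the graph of `f'`, which crosses the horizontal strand twice, at `u = ± 1 / 2`. -/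
def ReidemeisterTwo (D D' : KnotoidDiagram S) : Prop :=
  ∃ f f' : ℝ → ℝ,
    (∀ u, |u| ≤ 1 → |f u| < 1 ∧ |f' u| < 1) ∧
    (∀ u, 3 / 4 ≤ |u| → f' u = f u) ∧
    (∀ u, |u| ≤ 1 → f u < 0) ∧
    (∀ u, |u| < 1 / 2 → 0 < f' u) ∧
    (∀ u, |u| ≤ 1 → 1 / 2 < |u| → f' u < 0) ∧
    ReplacedInDisk ![fun u => (u, f u), fun u => (u, 0)]
      ![fun u => (u, f' u), fun u => (u, 0)] D D'

/-- The third Reidemeister move: the two strands `(u, u / 2)` and `(u, -u / 2)` cross at the origin;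
the graph of `f` crosses each of them once and passes below the origin, and it is replaced by the
graph of `f'`, which crosses each of them once and passes above the origin. -/
def ReidemeisterThree (D D' : KnotoidDiagram S) : Prop :=
  ∃ f f' : ℝ → ℝ,
    (∀ u, |u| ≤ 1 → |f u| < 1 ∧ |f' u| < 1) ∧
    (∀ u, 3 / 4 ≤ |u| → f' u = f u) ∧
    (∀ u, |u| ≤ 1 → (u < -(1 / 2) → u / 2 < f u) ∧ (-(1 / 2) < u → f u < u / 2) ∧
      (u < 1 / 2 → f u < -u / 2) ∧ (1 / 2 < u → -u / 2 < f u)) ∧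
    (∀ u, |u| ≤ 1 → (u < 1 / 2 → u / 2 < f' u) ∧ (1 / 2 < u → f' u < u / 2) ∧
      (u < -(1 / 2) → f' u < -u / 2) ∧ (-(1 / 2) < u → -u / 2 < f' u)) ∧
    ReplacedInDisk ![fun u => (u, f u), fun u => (u, u / 2), fun u => (u, -u / 2)]
      ![fun u => (u, f' u), fun u => (u, u / 2), fun u => (u, -u / 2)] D D'

/-- The elementary modifications of diagrams. -/
inductive Move : KnotoidDiagram S → KnotoidDiagram S → Prop
  | isotopy {D D' : KnotoidDiagram S} : Isotopic D D' → Move D D'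
  | one {D D' : KnotoidDiagram S} : ReidemeisterOne D D' → Move D D'
  | two {D D' : KnotoidDiagram S} : ReidemeisterTwo D D' → Move D D'
  | three {D D' : KnotoidDiagram S} : ReidemeisterThree D D' → Move D D'

/-- Equivalence of diagrams: the equivalence relation generated by isotopies and Reidemeister moves
away from the endpoints. -/
def Equivalent (D D' : KnotoidDiagram S) : Prop := Relation.EqvGen Move D D'

variable (S) in
/-- Oriented knotoids in `S`. -/
def Knotoid : Type _ := Quotient (Relation.EqvGen.setoid (Move (S := S)))

/-- The knotoid that a diagram presents. -/
def KnotoidDiagram.toKnotoid (D : KnotoidDiagram S) : Knotoid S :=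
  Quotient.mk (Relation.EqvGen.setoid Move) D

end Diagrams

end Knotoids

/-! A coloring is handled pointwise, as a pair of locally constant functions: `F` on the parameters
that are not under-passages and `G` on the complement of the curve. This form (`IsColoring`) lets
diagrams with different arcs and regions be compared directly. It is equivalent to the original one
because the interval and the surface are locally connected (`IsColoring.exists_coloring`,
`Coloring.exists_represents`).

Isotopies are dealt with by transport along the final diffeomorphism. The point there is that an
orientation preserving map that respects the direction of a curve also respects its left side, which
is a sign computation with the Jacobian determinant.

The three Reidemeister moves have one common proof. Inside the disk `U` of the move, number the
strands from top to bottom and give strand `k` an integer index function `W k`, which is locally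
constant off the strand and grows by one across it from right to left. Each element of `X` yields a
pair of permutations of `X` and `Y`, its operator. For base elements `x k`, the holonomy `H d p` is
the product over `k < d` of the operators of `x k` to the powers `W k p`. Crossing strand `k` from
right to left multiplies the holonomy on the left by the operator of `H k p` applied to `x k`
(`holonomy_jump`), which is exactly how a coloring changes there if strand `k` has the color `H k p`
applied to `x k`.

Hence the colorings over `U` are given by one formula: strand `i` has at each of its points `p` the
color `H i p` applied to `x i`, and the region at `p` has the color `H n p` applied to a constant
`y₀` (`DiskModel.color_eq`, `DiskModel.region_eq`). The constants are read off at the left ends of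
the strands and at one point of the boundary of the disk. Conversely, the formula with the index
functions of the new diagram defines a coloring of it. Old and new index functions agree near the
boundary of `U`, so the new values join the old ones outside (`DiskModel.exists_transfer`). Since a
coloring is determined outside `U` (`DiskModel.coloring_ext`), transfer is a bijection. The axiom
that `x` acts trivially on itself enters only at the self-crossing in the first move.

It remains to exhibit index functions: the indicator of the region above a graph for the second and
third moves, and a winding count around the kink for the first. -/

namespace Knotoids

/-! ### The operator group of a quandle and a quandle set -/

section Operators

variable {X Y : Type*} [Quandle X] [QuandleSet X Y]

/-- The permutation `y ↦ y * x` of a quandle set. -/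
noncomputable def QuandleSet.perm (Y : Type*) [QuandleSet X Y] (x : X) : Equiv.Perm Y :=
  Equiv.ofBijective (fun y : Y => QuandleSet.act y x) (QuandleSet.act_bijective x)

/-- The operators on `X` and `Y` that an element of `X` defines. -/
noncomputable def operator (Y : Type*) [QuandleSet X Y] (x : X) :
    Equiv.Perm X × Equiv.Perm Y :=
  (Rack.act' x, QuandleSet.perm Y x)

@[simp] theorem operator_fst (x z : X) : (operator Y x).1 z = x ◃ z := rfl

@[simp] theorem operator_snd (x : X) (y : Y) : (operator Y x).2 y = QuandleSet.act y x := rfl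

/-- On the first factor this is self-distributivity, on the second the axiom of an `X`-set; pairing
the two permutations lets arcs and regions be treated by the same group. -/
theorem operator_act (x z : X) :
    operator Y (x ◃ z) = operator Y x * operator Y z * (operator Y x)⁻¹ := by
  rw [eq_mul_inv_iff_mul_eq]
  ext w
  · simp only [Prod.fst_mul, Equiv.Perm.mul_apply, operator_fst]
    exact (Shelf.self_distrib).symm
  · simp only [Prod.snd_mul, Equiv.Perm.mul_apply, operator_snd]
    exact (QuandleSet.act_act w z x).symm

/-- The pairs of permutations that are compatible with `operator`. -/
def compatible (X Y : Type*) [Quandle X] [QuandleSet X Y] :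
    Subgroup (Equiv.Perm X × Equiv.Perm Y) where
  carrier := {g | ∀ x : X, operator Y (g.1 x) = g * operator Y x * g⁻¹}
  one_mem' x := by simp
  mul_mem' {g h} hg hh x := by
    simp only [mem_ofPred_eq] at hg hh
    simp [hg, hh, mul_assoc]
  inv_mem' {g} hg x := by
    have h := hg (g⁻¹.1 x)
    have h2 : g.1 (g⁻¹.1 x) = x := by simp
    rw [h2] at h
    rw [h]
    group

theorem operator_mem_compatible (x : X) : operator Y x ∈ compatible X Y :=
  fun z => operator_act x z

/-- Compare the first components of the relation that defines `compatible`, evaluated at `g.1 z`. So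
holonomies act on `X` by quandle automorphisms and may be cancelled from a crossing relation. -/
theorem compatible_act {g : Equiv.Perm X × Equiv.Perm Y}
    (hg : g ∈ compatible X Y) (x z : X) : g.1 (x ◃ z) = g.1 x ◃ g.1 z := by
  have h := congrArg (fun k : Equiv.Perm X × Equiv.Perm Y => k.1 (g.1 z)) (hg x)
  simpa using h.symm

/-- The ordered product of the powers `W k p` of the operators of the elements `x k`, `k < d`. -/
noncomputable def holonomy {P : Type*} (Y : Type*) [QuandleSet X Y] (x : ℕ → X) (W : ℕ → P → ℤ) :
    ℕ → P → Equiv.Perm X × Equiv.Perm Y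
  | 0, _ => 1
  | d + 1, p => holonomy Y x W d p * operator Y (x d) ^ W d p

variable {P P' : Type*} {x x' : ℕ → X} {W : ℕ → P → ℤ} {W' : ℕ → P' → ℤ}

theorem holonomy_mem_compatible (d : ℕ) (p : P) : holonomy Y x W d p ∈ compatible X Y := by
  induction d with
  | zero => exact one_mem _
  | succ d ih => exact mul_mem ih (zpow_mem (operator_mem_compatible _) _)

theorem holonomy_congr {d : ℕ} {p : P} {p' : P'} (hx : ∀ k < d, x k = x' k)
    (h : ∀ k < d, W k p = W' k p') : holonomy Y x W d p = holonomy Y x' W' d p' := by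
  induction d with
  | zero => rfl
  | succ d ih =>
    simp only [holonomy]
    rw [ih (fun k hk => hx k (hk.trans d.lt_succ_self)) fun k hk => h k (hk.trans d.lt_succ_self),
      h d d.lt_succ_self, hx d d.lt_succ_self]

/-- The extra factor, the operator of `x k`, arises in the middle of the product. Moving it to the
front conjugates it by the holonomy up to `k`, and compatibility turns the conjugate into the
operator of the color that strand `k` has at that point. -/
theorem holonomy_jump {d k : ℕ} (hk : k < d) {p q : P} (h : ∀ j < d, j ≠ k → W j q = W j p)
    (hj : W k q = W k p + 1) :
    holonomy Y x W d q
      = operator Y ((holonomy Y x W k p).1 (x k)) * holonomy Y x W d p := by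
  induction d with
  | zero => omega
  | succ d ih =>
    simp only [holonomy]
    rcases Nat.lt_succ_iff_lt_or_eq.1 hk with hkd | rfl
    · rw [ih hkd (fun j hj => h j (hj.trans d.lt_succ_self)), h d d.lt_succ_self hkd.ne', mul_assoc]
    · rw [hj, holonomy_mem_compatible (Y := Y) (x := x) (W := W) k p (x k),
        holonomy_congr (Y := Y) (x := x) (W := W) (fun _ _ => rfl)
          fun j hj => h j (hj.trans k.lt_succ_self) hj.ne, add_comm, zpow_add, zpow_one]
      group

theorem eventually_holonomy_eq [TopologicalSpace P] {d : ℕ} {p : P}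
    (h : ∀ k < d, ∀ᶠ q in 𝓝 p, W k q = W k p) :
    ∀ᶠ q in 𝓝 p, holonomy Y x W d q = holonomy Y x W d p := by
  have h2 : ∀ᶠ q in 𝓝 p, ∀ k ∈ Finset.range d, W k q = W k p :=
    (Finset.eventually_all _).2 fun k hk => h k (Finset.mem_range.1 hk)
  filter_upwards [h2] with q hq
  exact holonomy_congr (fun _ _ => rfl) fun k hk => hq k (Finset.mem_range.2 hk)

/-- Auxiliary to `baseColor`. -/
noncomputable def baseHolonomy (Y : Type*) [QuandleSet X Y] (W : ℕ → P → ℤ) (q : ℕ → P)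
    (z : ℕ → X) : ℕ → P → Equiv.Perm X × Equiv.Perm Y
  | 0, _ => 1
  | d + 1, p => baseHolonomy Y W q z d p *
      operator Y ((baseHolonomy Y W q z d (q d))⁻¹.1 (z d)) ^ W d p

/-- The elements `x k` for which the holonomy up to `k` at `q k` takes `x k` to `z k`. -/
noncomputable def baseColor (Y : Type*) [QuandleSet X Y] (W : ℕ → P → ℤ) (q : ℕ → P)
    (z : ℕ → X) (k : ℕ) : X :=
  (baseHolonomy Y W q z k (q k))⁻¹.1 (z k)

/-- The condition on `x k` is triangular, since the holonomy up to `k` involves only `x j` with `j <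
k`; `baseHolonomy` solves it recursively and is then seen to be the holonomy of its own solution. -/
theorem baseColor_eq (W : ℕ → P → ℤ) (q : ℕ → P) (z : ℕ → X) (k : ℕ) :
    baseColor Y W q z k = (holonomy Y (baseColor Y W q z) W k (q k))⁻¹.1 (z k) := by
  have h : ∀ d p, holonomy Y (baseColor Y W q z) W d p = baseHolonomy Y W q z d p := by
    intro d
    induction d with
    | zero => intro p; rfl
    | succ d ih => intro p; simp only [holonomy, baseHolonomy, ih]; rfl
  rw [h]
  rfl

end Operators

/-! ### Locally constant functions -/

theorem eq_of_isPreconnected {A B : Type*} [TopologicalSpace A] {s : Set A}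
    (hs : IsPreconnected s) {f : A → B} (hf : ∀ a ∈ s, ∀ᶠ b in 𝓝[s] a, f b = f a) {a b : A}
    (ha : a ∈ s) (hb : b ∈ s) : f a = f b := by
  let _ : TopologicalSpace B := ⊥
  have _ : DiscreteTopology B := ⟨rfl⟩
  refine hs.constant (f := f) (fun c hc => ?_) ha hb
  have : Tendsto f (𝓝[s] c) (pure (f c)) := tendsto_pure.2 (hf c hc)
  exact this.mono_right (pure_le_nhds _)

/-- A function that is locally constant along the dense subset `{a | p a}` of `s`, in the sense that
near each point of `s` it has only one value, is constant. -/
theorem eq_of_isPreconnected_of_dense {A B : Type*} [TopologicalSpace A] {s : Set A}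
    (hs : IsPreconnected s) {p : A → Prop} {f : A → B}
    (hp : ∀ a ∈ s, ∃ᶠ b in 𝓝[s] a, p b)
    (hf : ∀ a ∈ s, ∃ v, ∀ᶠ b in 𝓝[s] a, p b → f b = v) {a b : A}
    (ha : a ∈ s) (hb : b ∈ s) (hpa : p a) (hpb : p b) : f a = f b := by
  have : Nonempty B := ⟨f a⟩
  choose! v hv using hf
  have h1 : ∀ c ∈ s, p c → f c = v c := fun c hc hpc => (hv c hc).self_of_nhdsWithin hc hpc
  rw [h1 a ha hpa, h1 b hb hpb]
  refine eq_of_isPreconnected hs (fun c hc => ?_) ha hb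
  filter_upwards [eventually_eventually_nhdsWithin.2 (hv c hc), self_mem_nhdsWithin] with d hd hds
  -- A point `z` near `d` that satisfies `p` has both local values, `v c` and `v d`; so the chosen
  -- `v` is locally constant.
  obtain ⟨z, hz1, hz2, hz3⟩ := ((hp d hds).and_eventually (hd.and (hv d hds))).exists
  rw [← hz2 hz1, ← hz3 hz1]

/-! ### Functions on the plane that are locally constant off an axis -/

/-- The two halves of a small ball are convex, hence connected. This is the local picture at an
interior point of a strand. -/
theorem exists_eventually_eq_halfplanes {B : Type*} {φ : Plane → B}
    (h : ∀ᶠ z in 𝓝 (0 : Plane), z.2 ≠ 0 → ∀ᶠ w in 𝓝 z, φ w = φ z) :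
    ∃ v₁ v₂, ∀ᶠ z in 𝓝 (0 : Plane), (0 < z.2 → φ z = v₁) ∧ (z.2 < 0 → φ z = v₂) := by
  obtain ⟨r, hr, hball⟩ := Metric.eventually_nhds_iff_ball.1 h
  have hmem : ∀ y : ℝ, |y| < r → ((0, y) : Plane) ∈ Metric.ball (0 : Plane) r := by
    intro y hy
    simp [Prod.norm_def, hy]
  have key : ∀ s : Set Plane, Convex ℝ s → (∀ z ∈ s, z.2 ≠ 0) → ∀ z ∈ Metric.ball (0 : Plane) r,
      z ∈ s → ∀ w ∈ Metric.ball (0 : Plane) r, w ∈ s → φ z = φ w := by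
    intro s hs hs2 z hz hzs w hw hws
    refine eq_of_isPreconnected ((convex_ball (0 : Plane) r).inter hs).isPreconnected ?_
      ⟨hz, hzs⟩ ⟨hw, hws⟩
    rintro a ⟨ha, has⟩
    exact nhdsWithin_le_nhds (hball a ha (hs2 a has))
  refine ⟨φ (0, r / 2), φ (0, -(r / 2)), ?_⟩
  filter_upwards [Metric.ball_mem_nhds (0 : Plane) hr] with z hz
  have hr2 : |r / 2| < r := by rw [abs_of_pos (by positivity)]; linarith
  refine ⟨fun h => ?_, fun h => ?_⟩
  · refine key {z | 0 < z.2} ?_ (fun z hz => ne_of_gt hz) z hz h _ (hmem _ hr2)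
      (by simp only [mem_ofPred_eq]; linarith)
    exact convex_halfSpace_gt (f := Prod.snd) (LinearMap.snd ℝ ℝ ℝ).isLinear 0
  · refine key {z | z.2 < 0} ?_ (fun z hz => ne_of_lt hz) z hz h _ (hmem _ (by rwa [abs_neg]))
      (by simp only [mem_ofPred_eq]; linarith)
    exact convex_halfSpace_lt (f := Prod.snd) (LinearMap.snd ℝ ℝ ℝ).isLinear 0

/-- A ball without the half-axis `σ * x ≥ 0` is star-shaped about a point of the opposite half-axis,
hence connected. This is the local picture at an endpoint of the diagram, around which there is only
one region. -/
theorem exists_eventually_eq_slit {B : Type*} {φ : Plane → B} {σ : ℝ} (hσ : σ = 1 ∨ σ = -1)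
    (h : ∀ᶠ z in 𝓝 (0 : Plane), (z.2 ≠ 0 ∨ σ * z.1 < 0) → ∀ᶠ w in 𝓝 z, φ w = φ z) :
    ∃ v, ∀ᶠ z in 𝓝 (0 : Plane), (z.2 ≠ 0 ∨ σ * z.1 < 0) → φ z = v := by
  obtain ⟨r, hr, hball⟩ := Metric.eventually_nhds_iff_ball.1 h
  have hσ2 : σ * σ = 1 := by rcases hσ with rfl | rfl <;> norm_num
  set s : Set Plane := Metric.ball (0 : Plane) r ∩ {z | z.2 ≠ 0 ∨ σ * z.1 < 0}
  have hmem : ((-σ * (r / 2), 0) : Plane) ∈ s := by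
    refine ⟨?_, Or.inr ?_⟩
    · have : |σ| = 1 := by rcases hσ with rfl | rfl <;> norm_num
      simp [Prod.norm_def, this, hr]
      rw [abs_of_pos hr]; linarith
    · simp only
      nlinarith
  have hstar : StarConvex ℝ ((-σ * (r / 2), 0) : Plane) s := by
    refine StarConvex.inter ((convex_ball (0 : Plane) r).starConvex hmem.1) ?_
    rintro z hz a b ha hb hab
    simp only [mem_ofPred_eq, Prod.snd_add, Prod.smul_snd, Prod.fst_add, Prod.smul_fst,
      smul_eq_mul, mul_zero, zero_add] at hz ⊢
    rcases hb.eq_or_lt with rfl | hb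
    · right
      have : a = 1 := by linarith
      subst this
      nlinarith
    · rcases hz with hz | hz
      · left; positivity
      · right
        have h1 : σ * (a * (-σ * (r / 2)) + b * z.1) = -(a * (r / 2)) * (σ * σ) + b * (σ * z.1) := by
          ring
        rw [h1, hσ2]
        have h2 : 0 ≤ a * (r / 2) := by positivity
        nlinarith
  refine ⟨φ (-σ * (r / 2), 0), ?_⟩
  filter_upwards [Metric.ball_mem_nhds (0 : Plane) hr] with z hz hz2
  refine eq_of_isPreconnected (hstar.isPathConnected hmem).isConnected.isPreconnected
    ?_ ⟨hz, hz2⟩ hmem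
  rintro a ⟨ha, has⟩
  exact nhdsWithin_le_nhds (hball a ha has)

/-! ### Locally constant functions on the unit interval. -/

theorem isPreconnected_of_ordConnected {s : Set unitInterval} (hs : s.OrdConnected) :
    IsPreconnected s := by
  rw [← Topology.IsInducing.subtypeVal.isPreconnected_image]
  refine OrdConnected.isPreconnected ⟨?_⟩
  rintro _ ⟨x, hx, rfl⟩ _ ⟨y, hy, rfl⟩ z ⟨hz1, hz2⟩
  exact ⟨⟨z, x.2.1.trans hz1, hz2.trans y.2.2⟩, hs.out hx hy ⟨hz1, hz2⟩, rfl⟩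

/-- A function that is locally constant near `t`, except at `t`, has one-sided values at `t`. -/
theorem exists_eventually_eq_sides {B : Type*} {F : unitInterval → B} {t : unitInterval}
    (h : ∀ᶠ s in 𝓝[≠] t, ∀ᶠ v in 𝓝 s, F v = F s) :
    ∃ x₁ x₂, ∀ᶠ v in 𝓝 t, (v < t → F v = x₁) ∧ (t < v → F v = x₂) := by
  rw [eventually_nhdsWithin_iff] at h
  obtain ⟨r, hr, hball⟩ := Metric.eventually_nhds_iff_ball.1 h
  have hord : (Metric.ball t r).OrdConnected := by
    refine ⟨fun x hx y hy z hz => ?_⟩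
    simp only [Metric.mem_ball, Subtype.dist_eq, Real.dist_eq, abs_lt] at hx hy ⊢
    have h1 : (x : ℝ) ≤ z := hz.1
    have h2 : (z : ℝ) ≤ y := hz.2
    constructor <;> linarith [hx.1, hy.2]
  have key : ∀ s : Set unitInterval, s.OrdConnected → t ∉ s → ∃ x, ∀ v ∈ Metric.ball t r ∩ s,
      F v = x := by
    intro s hs hts
    rcases (Metric.ball t r ∩ s).eq_empty_or_nonempty with h0 | ⟨w, hw⟩
    · exact ⟨F t, by simp [h0]⟩
    · refine ⟨F w, fun v hv => eq_of_isPreconnected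
        (isPreconnected_of_ordConnected (hord.inter hs)) ?_ hv hw⟩
      rintro a ⟨ha, has⟩
      exact nhdsWithin_le_nhds (hball a ha fun h => hts (h ▸ has))
  obtain ⟨x₁, h₁⟩ := key (Iio t) ordConnected_Iio (by simp)
  obtain ⟨x₂, h₂⟩ := key (Ioi t) ordConnected_Ioi (by simp)
  refine ⟨x₁, x₂, ?_⟩
  filter_upwards [Metric.ball_mem_nhds t hr] with v hv
  exact ⟨fun h => h₁ v ⟨hv, h⟩, fun h => h₂ v ⟨hv, h⟩⟩

section Diagrams

variable {S : Type*} [TopologicalSpace S]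

/-! ### Straight charts -/

/-- The parameters of `J` away from `t` have a compact image that misses `γ t`, so points near `γ t`
are reached only from parameters near `t`. The set `J` is the whole interval or the interval of a
single strand. -/
theorem eventually_mem_of_curve_eq [T2Space S] {γ : C(unitInterval, S)} {J : Set unitInterval}
    (hJ : IsClosed J) {t : unitInterval} (ht : ∀ s ∈ J, γ s = γ t → s = t) {N : Set unitInterval}
    (hN : N ∈ 𝓝 t) : ∀ᶠ q in 𝓝 (γ t), ∀ v ∈ J, γ v = q → v ∈ N := by
  have h1 : IsClosed (γ '' (J \ interior N)) :=
    ((hJ.sdiff isOpen_interior).isCompact.image γ.continuous).isClosed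
  have h2 : γ t ∉ γ '' (J \ interior N) := by
    rintro ⟨s, ⟨hs, hsN⟩, hst⟩
    exact hsN (ht s hs hst ▸ mem_interior_iff_mem_nhds.2 hN)
  filter_upwards [h1.isOpen_compl.mem_nhds h2] with q hq v hv hvq
  by_contra hvN
  exact hq ⟨v, ⟨hv, fun h => hvN (interior_subset h)⟩, hvq⟩

namespace StraightAt

variable {γ γ' : unitInterval → S} {e : OpenPartialHomeomorph S Plane} {t : unitInterval}
  {d : Plane}

theorem apply_eq (h : StraightAt γ e t d) : e (γ t) = 0 := by
  simpa using h.2.self_of_nhds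

theorem symm_zero (h : StraightAt γ e t d) : e.symm 0 = γ t := by
  rw [← h.apply_eq, e.left_inv h.1]

theorem zero_mem (h : StraightAt γ e t d) : (0 : Plane) ∈ e.target :=
  h.apply_eq ▸ e.map_source h.1

theorem tendsto (h : StraightAt γ e t d) : Tendsto e.symm (𝓝 0) (𝓝 (γ t)) := by
  have := (e.continuousAt_symm h.zero_mem).tendsto
  rwa [h.symm_zero] at this

theorem congr (h : StraightAt γ e t d) (hγ : ∀ᶠ v in 𝓝 t, γ' v = γ v) : StraightAt γ' e t d := by
  refine ⟨hγ.self_of_nhds ▸ h.1, ?_⟩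
  filter_upwards [h.2, hγ] with v hv hv2
  rw [hv2, hv]

theorem eventually_curve_eq {γ : C(unitInterval, S)} (h : StraightAt γ e t d) :
    ∀ᶠ v in 𝓝 t, γ v = e.symm (((v : ℝ) - (t : ℝ)) • d) := by
  filter_upwards [h.2, γ.continuous.continuousAt.preimage_mem_nhds (e.open_source.mem_nhds h.1)]
    with v hv hv2
  rw [← hv, e.left_inv hv2]

theorem eventually_eq [T2Space S] {γ : C(unitInterval, S)} (h : StraightAt γ e t d)
    {J : Set unitInterval} (hJ : IsClosed J) (ht : ∀ s ∈ J, γ s = γ t → s = t) :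
    ∀ᶠ z in 𝓝 (0 : Plane), ∀ v ∈ J, γ v = e.symm z → z = ((v : ℝ) - (t : ℝ)) • d := by
  filter_upwards [h.tendsto.eventually (eventually_mem_of_curve_eq hJ ht h.2),
    e.open_target.mem_nhds h.zero_mem] with z hz hz2 v hv hvz
  have h1 : e (γ v) = ((v : ℝ) - t) • d := hz v hv hvz
  rw [← h1, hvz, e.right_inv hz2]

theorem eventually_of_eventually (h : StraightAt γ e t d) {B : Type*} {φ : S → B} {p : S → Prop}
    (hφ : ∀ᶠ q in 𝓝 (γ t), p q → ∀ᶠ q' in 𝓝 q, φ q' = φ q) :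
    ∀ᶠ z in 𝓝 (0 : Plane), p (e.symm z) → ∀ᶠ w in 𝓝 z, φ (e.symm w) = φ (e.symm z) := by
  filter_upwards [h.tendsto.eventually hφ, e.open_target.mem_nhds h.zero_mem] with z hz hz2 hp
  exact (e.continuousAt_symm hz2).eventually (hz hp)

/-- In the straight chart the part of the curve over `J` stays in the first axis near the origin, so
a function that is locally constant off that part has one value on each half-disk. -/
theorem exists_sides [T2Space S] {γ : C(unitInterval, S)} (h : StraightAt γ e t (1, 0))
    {J : Set unitInterval} (hJ : IsClosed J) (ht : ∀ s ∈ J, γ s = γ t → s = t)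
    {B : Type*} {φ : S → B}
    (hφ : ∀ᶠ q in 𝓝 (γ t), q ∉ γ '' J → ∀ᶠ q' in 𝓝 q, φ q' = φ q) :
    ∃ v₁ v₂, ∀ᶠ z in 𝓝 (0 : Plane),
      (0 < z.2 → φ (e.symm z) = v₁) ∧ (z.2 < 0 → φ (e.symm z) = v₂) := by
  refine exists_eventually_eq_halfplanes (φ := fun z => φ (e.symm z)) ?_
  filter_upwards [h.eventually_of_eventually hφ, h.eventually_eq hJ ht] with z hz hz2 hz0
  refine hz ?_
  rintro ⟨v, hv, hvz⟩
  apply hz0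
  rw [hz2 v hv hvz]
  simp

/-- At an endpoint the curve fills just one half of the axis, so its complement in a small ball is a
slit disk. The sign `σ` says which half: `σ = 1` at the start, `σ = -1` at the end. -/
theorem exists_slit [T2Space S] {γ : C(unitInterval, S)} (h : StraightAt γ e t (1, 0))
    (ht : ∀ s, γ s = γ t → s = t) (ht2 : t = 0 ∨ t = 1) {B : Type*} {φ : S → B}
    (hφ : ∀ᶠ q in 𝓝 (γ t), q ∉ range γ → ∀ᶠ q' in 𝓝 q, φ q' = φ q) :
    ∃ v, (∀ᶠ q in 𝓝 (γ t), q ∉ range γ → φ q = v) ∧ ∃ᶠ q in 𝓝 (γ t), q ∉ range γ := by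
  obtain ⟨σ, hσ, hσt⟩ : ∃ σ : ℝ, (σ = 1 ∨ σ = -1) ∧
      ∀ x : ℝ, |x| < 1 → (0 ≤ σ * x ↔ 0 ≤ t + x ∧ t + x ≤ 1) := by
    rcases ht2 with rfl | rfl
    · exact ⟨1, Or.inl rfl, fun x hx => by
        rw [abs_lt] at hx
        simp only [one_mul, Icc.coe_zero, zero_add]
        exact ⟨fun h => ⟨h, hx.2.le⟩, fun h => h.1⟩⟩
    · exact ⟨-1, Or.inr rfl, fun x hx => by
        rw [abs_lt] at hx
        simp only [Icc.coe_one]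
        exact ⟨fun h => ⟨by linarith, by linarith⟩, fun h => by linarith [h.2]⟩⟩
  have hlt : ∀ᶠ z in 𝓝 (0 : Plane), |z.1| < 1 := by
    filter_upwards [Metric.ball_mem_nhds (0 : Plane) one_pos] with z hz
    exact (norm_fst_le z).trans_lt (by simpa using hz)
  have hout : ∀ᶠ z in 𝓝 (0 : Plane), (z.2 ≠ 0 ∨ σ * z.1 < 0) → e.symm z ∉ range γ := by
    filter_upwards [h.eventually_eq isClosed_univ (fun s _ => ht s), hlt] with z hz hz1 hz2
    rintro ⟨v, hv⟩
    have h3 := hz v (mem_univ _) hv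
    rcases hz2 with hz2 | hz2
    · exact hz2 (by rw [h3]; simp)
    · refine hz2.not_ge ((hσt _ hz1).2 ?_)
      rw [h3]
      simpa using ⟨v.2.1, v.2.2⟩
  obtain ⟨v, hv⟩ := exists_eventually_eq_slit (φ := fun z => φ (e.symm z)) hσ (by
    filter_upwards [h.eventually_of_eventually hφ, hout] with z hz hz2 hz0
    exact hz (hz2 hz0))
  refine ⟨v, ?_, ?_⟩
  · have h1 : Tendsto e (𝓝 (γ t)) (𝓝 0) := by
      have := (e.continuousAt h.1).tendsto
      rwa [h.apply_eq] at this
    obtain ⟨r, hr, hcur⟩ := Metric.eventually_nhds_iff_ball.1 h.eventually_curve_eq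
    have h2 : ∀ᶠ z in 𝓝 (0 : Plane), |z.1| < r := by
      filter_upwards [Metric.ball_mem_nhds (0 : Plane) hr] with z hz
      exact (norm_fst_le z).trans_lt (by simpa using hz)
    filter_upwards [h1.eventually hv, h1.eventually h2, h1.eventually hlt,
      e.open_source.mem_nhds h.1] with q hq hq2 hq3 hqs hqr
    rw [← hq, e.left_inv hqs]
    by_contra hcon
    push Not at hcon
    obtain ⟨h4, h5⟩ := hcon
    apply hqr
    have h6 := (hσt _ hq3).1 h5
    refine ⟨⟨t + (e q).1, h6⟩, ?_⟩
    rw [hcur]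
    · have : ((t : ℝ) + (e q).1 - t) • ((1, 0) : Plane) = e q := by
        ext <;> simp [h4]
      rw [this, e.left_inv hqs]
    · simpa [Subtype.dist_eq, Real.dist_eq] using hq2
  · refine h.tendsto.frequently (Frequently.mp (p := fun z : Plane => z.2 ≠ 0 ∨ σ * z.1 < 0) ?_ hout)
    have h1 : Tendsto (fun y : ℝ => ((0, y) : Plane)) (𝓝[≠] 0) (𝓝 0) := by
      have : Continuous (fun y : ℝ => ((0, y) : Plane)) := by fun_prop
      exact (this.tendsto 0).mono_left nhdsWithin_le_nhds
    refine h1.frequently (Eventually.frequently ?_)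
    filter_upwards [self_mem_nhdsWithin] with y hy
    exact Or.inl hy

end StraightAt

theorem tendsto_vertical {σ : ℝ} :
    Tendsto (fun y : ℝ => ((0, σ * y) : Plane)) (𝓝[>] 0) (𝓝 0) := by
  have : Continuous (fun y : ℝ => ((0, σ * y) : Plane)) := by fun_prop
  have h := this.tendsto 0
  simp only [mul_zero] at h
  exact h.mono_left nhdsWithin_le_nhds

theorem StraightAt.eventually_mem_range {γ : C(unitInterval, S)} {e : OpenPartialHomeomorph S Plane}
    {t : unitInterval} (h : StraightAt γ e t (1, 0)) (h0 : t ≠ 0) (h1 : t ≠ 1) :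
    ∀ᶠ z in 𝓝 (0 : Plane), z.2 = 0 → e.symm z ∈ range γ := by
  obtain ⟨r, hr, hcur⟩ := Metric.eventually_nhds_iff_ball.1 h.eventually_curve_eq
  have ht0 : (0 : ℝ) < t := unitInterval.pos_iff_ne_zero.2 h0
  have ht1 : (t : ℝ) < 1 := unitInterval.lt_one_iff_ne_one.2 h1
  filter_upwards [Metric.ball_mem_nhds (0 : Plane) hr, Metric.ball_mem_nhds (0 : Plane) ht0,
    Metric.ball_mem_nhds (0 : Plane) (sub_pos.2 ht1)] with z hz hz0 hz1 hz2
  have key : ∀ {c : ℝ}, z ∈ Metric.ball (0 : Plane) c → |z.1| < c := fun hz =>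
    (norm_fst_le z).trans_lt (by simpa using hz)
  have k0 := abs_lt.1 (key hz0)
  have k1 := abs_lt.1 (key hz1)
  refine ⟨⟨t + z.1, by linarith [k0.1], by linarith [k1.2]⟩, ?_⟩
  rw [hcur]
  · congr 1
    ext <;> simp [hz2]
  · simpa [Subtype.dist_eq, Real.dist_eq] using key hz

theorem StraightAt.frequently_notMem_range [T2Space S] {γ : C(unitInterval, S)}
    {e : OpenPartialHomeomorph S Plane} {t : unitInterval} (h : StraightAt γ e t (1, 0))
    (ht : ∀ s, γ s = γ t → s = t) : ∃ᶠ q in 𝓝 (γ t), q ∉ range γ := by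
  have h1 : Tendsto (fun y : ℝ => e.symm (0, 1 * y)) (𝓝[>] 0) (𝓝 (γ t)) :=
    h.tendsto.comp tendsto_vertical
  refine h1.frequently (Eventually.frequently ?_)
  filter_upwards [tendsto_vertical.eventually (h.eventually_eq isClosed_univ fun s _ => ht s),
    self_mem_nhdsWithin] with y hy (hy0 : 0 < y)
  rintro ⟨v, hv⟩
  have := congrArg Prod.snd (hy v (mem_univ v) hv)
  simp at this
  exact hy0.ne' this

end Diagrams

/-! ### Colorings as locally constant functions of points. -/

section Diagrams

variable {S : Type*} [TopologicalSpace S] [ChartedSpace Plane S]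

namespace KnotoidDiagram

variable (D : KnotoidDiagram S)

theorem finite_under : D.under.Finite :=
  D.finite_double.subset fun t ht => D.under_double t ht

theorem eventually_notMem_under (t : unitInterval) : ∀ᶠ v in 𝓝[≠] t, v ∉ D.under := by
  have h : (D.under \ {t})ᶜ ∈ 𝓝 t :=
    (D.finite_under.subset sdiff_subset).isClosed.isOpen_compl.mem_nhds (by simp)
  rw [eventually_nhdsWithin_iff]
  filter_upwards [h] with v hv hvt hvu
  exact hv ⟨hvu, hvt⟩

/-- The arc that contains a given point of the curve. -/
def arcAt (t : unitInterval) (h : t ∉ D.under) : D.Arc := ConnectedComponents.mk ⟨t, h⟩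

/-- The region that contains a given point off the curve. -/
def regionAt (p : S) (h : p ∉ range D.curve) : D.Region := ConnectedComponents.mk ⟨p, h⟩

variable {D}

theorem Arc.mem_params {a : D.Arc} {t : unitInterval} :
    t ∈ a.params ↔ ∃ h : t ∉ D.under, D.arcAt t h = a := Iff.rfl

theorem Region.mem_points {r : D.Region} {p : S} :
    p ∈ r.points ↔ ∃ h : p ∉ range D.curve, D.regionAt p h = r := Iff.rfl

theorem eventually_notMem_under_of_notMem {t : unitInterval} (ht : t ∉ D.under) :
    ∀ᶠ v in 𝓝 t, v ∉ D.under :=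
  D.finite_under.isClosed.isOpen_compl.mem_nhds ht

theorem notMem_under_of_forall {t : unitInterval} (ht : ∀ s, D.curve s = D.curve t → s = t) :
    t ∉ D.under := fun h => by
  obtain ⟨s, hs, hst⟩ := D.under_double t h
  exact hs (ht s hst)

variable (D) in
theorem eq_of_curve_eq_endpoint {t : unitInterval} (ht : t = 0 ∨ t = 1) (s : unitInterval)
    (hs : D.curve s = D.curve t) : s = t := by
  rcases ht with rfl | rfl
  · exact (D.endpoints s).1 hs
  · exact (D.endpoints s).2 hs

theorem ne_endpoint_of_mem_under {t : unitInterval} (ht : t ∈ D.under) : t ≠ 0 ∧ t ≠ 1 :=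
  ⟨fun h => notMem_under_of_forall (D.eq_of_curve_eq_endpoint (Or.inl h)) ht,
    fun h => notMem_under_of_forall (D.eq_of_curve_eq_endpoint (Or.inr h)) ht⟩

theorem notMem_under_of_curve_eq {s t : unitInterval} (ht : t ∈ D.under) (hst : s ≠ t)
    (h : D.curve s = D.curve t) : s ∉ D.under := fun hs =>
  (D.under_iff s t hst h).1 hs ht

theorem isClosed_range [T2Space S] : IsClosed (range D.curve) :=
  (isCompact_range D.curve.continuous).isClosed

end KnotoidDiagram

open KnotoidDiagram

theorem frequently_sides {t : unitInterval} (h0 : t ≠ 0) (h1 : t ≠ 1) {ε : ℝ}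
    (hε : ε = 1 ∨ ε = -1) :
    (∃ᶠ v : unitInterval in 𝓝 t, ε * ((v : ℝ) - t) < 0) ∧
      ∃ᶠ v : unitInterval in 𝓝 t, 0 < ε * ((v : ℝ) - t) := by
  have hl : ∃ᶠ v in 𝓝 t, v < t := by
    have : (𝓝[<] t).NeBot := nhdsLT_neBot_of_exists_lt ⟨0, unitInterval.pos_iff_ne_zero.2 h0⟩
    exact frequently_nhdsWithin_iff.1 (frequently_true_iff_neBot (𝓝[<] t) |>.2 this)
      |>.mono fun v hv => hv.2
  have hr : ∃ᶠ v in 𝓝 t, t < v := by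
    have : (𝓝[>] t).NeBot := nhdsGT_neBot_of_exists_gt ⟨1, unitInterval.lt_one_iff_ne_one.2 h1⟩
    exact frequently_nhdsWithin_iff.1 (frequently_true_iff_neBot (𝓝[>] t) |>.2 this)
      |>.mono fun v hv => hv.2
  have key : ∀ v w : unitInterval, v < w ↔ (v : ℝ) < w := fun v w => Iff.rfl
  rcases hε with rfl | rfl
  · exact ⟨hl.mono fun v hv => by rw [key] at hv; linarith,
      hr.mono fun v hv => by rw [key] at hv; linarith⟩
  · exact ⟨hr.mono fun v hv => by rw [key] at hv; linarith,
      hl.mono fun v hv => by rw [key] at hv; linarith⟩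

variable {X Y : Type*} [Quandle X] [QuandleSet X Y]

/-- A coloring, given by functions on the points of the curve that are not under-passages and on the
points of the surface that are not on the curve. -/
structure IsColoring (D : KnotoidDiagram S) (F : unitInterval → X) (G : S → Y) : Prop where
  arc_eq : ∀ t ∉ D.under, ∀ᶠ v in 𝓝 t, F v = F t
  region_eq : ∀ p ∉ range D.curve, ∀ᶠ q in 𝓝 p, G q = G p
  crossing : ∀ s t, s ≠ t → t ∈ D.under → D.curve s = D.curve t →
    ∀ (e : OpenPartialHomeomorph S Plane) (ε : ℝ), IsOrientedChart e → (ε = 1 ∨ ε = -1) →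
      StraightAt D.curve e s (1, 0) → StraightAt D.curve e t (0, ε) →
      ∀ x₁ x₂, (∀ᶠ v : unitInterval in 𝓝 t, (ε * ((v : ℝ) - t) < 0 → F v = x₁) ∧
        (0 < ε * ((v : ℝ) - t) → F v = x₂)) → x₂ = F s ◃ x₁
  side : ∀ t, t ≠ 0 → t ≠ 1 → (∀ v, D.curve v = D.curve t → v = t) →
    ∀ e : OpenPartialHomeomorph S Plane, IsOrientedChart e → StraightAt D.curve e t (1, 0) →
      ∀ᶠ y in 𝓝[>] (0 : ℝ), QuandleSet.act (G (e.symm (0, -y))) (F t) = G (e.symm (0, y))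
  endpoint : ∀ t, t = 0 ∨ t = 1 → ∀ᶠ q in 𝓝 (D.curve t), q ∉ range D.curve →
    QuandleSet.act (G q) (F t) = G q

variable {D : KnotoidDiagram S}

theorem IsColoring.exists_sides {F : unitInterval → X} {G : S → Y} (h : IsColoring D F G)
    (t : unitInterval) {ε : ℝ} (hε : ε = 1 ∨ ε = -1) :
    ∃ x₁ x₂, ∀ᶠ v : unitInterval in 𝓝 t, (ε * ((v : ℝ) - t) < 0 → F v = x₁) ∧
        (0 < ε * ((v : ℝ) - t) → F v = x₂) := by
  have h1 : ∀ᶠ s in 𝓝[≠] t, ∀ᶠ v in 𝓝 s, F v = F s :=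
    (D.eventually_notMem_under t).mono fun s hs => h.arc_eq s hs
  obtain ⟨x₁, x₂, hx⟩ := exists_eventually_eq_sides h1
  have key : ∀ v w : unitInterval, v < w ↔ (v : ℝ) < w := fun v w => Iff.rfl
  simp only [key] at hx
  rcases hε with rfl | rfl
  · exact ⟨x₁, x₂, hx.mono fun v hv =>
      ⟨fun h => hv.1 (by linarith), fun h => hv.2 (by linarith)⟩⟩
  · exact ⟨x₂, x₁, hx.mono fun v hv =>
      ⟨fun h => hv.2 (by linarith), fun h => hv.1 (by linarith)⟩⟩

/-- The functions `F` and `G` take the values of the coloring `c`. -/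
def Coloring.Represents (c : Coloring X Y D) (F : unitInterval → X) (G : S → Y) : Prop :=
  (∀ t (h : t ∉ D.under), F t = c.arcColor (D.arcAt t (h))) ∧
    ∀ p (h : p ∉ range D.curve), G p = c.regionColor (D.regionAt p (h))

theorem Coloring.Represents.arc {c : Coloring X Y D} {F : unitInterval → X} {G : S → Y}
    (h : c.Represents F G) {a : D.Arc} {t : unitInterval} (ht : t ∈ a.params) :
    F t = c.arcColor a := by
  obtain ⟨h1, rfl⟩ := ht
  exact h.1 t h1

theorem Coloring.Represents.region {c : Coloring X Y D} {F : unitInterval → X} {G : S → Y}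
    (h : c.Represents F G) {r : D.Region} {p : S} (hp : p ∈ r.points) :
    G p = c.regionColor r := by
  obtain ⟨h1, rfl⟩ := hp
  exact h.2 p h1

theorem Coloring.Represents.ext {c c' : Coloring X Y D} {F F' : unitInterval → X} {G G' : S → Y}
    (h : c.Represents F G) (h' : c'.Represents F' G') (hF : ∀ t ∉ D.under, F t = F' t)
    (hG : ∀ p ∉ range D.curve, G p = G' p) : c = c' := by
  apply Coloring.ext
  · funext a
    obtain ⟨⟨t, ht⟩, rfl⟩ := ConnectedComponents.surjective_coe a
    exact (h.1 t ht).symm.trans ((hF t ht).trans (h'.1 t ht))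
  · funext r
    obtain ⟨⟨p, hp⟩, rfl⟩ := ConnectedComponents.surjective_coe r
    exact (h.2 p hp).symm.trans ((hG p hp).trans (h'.2 p hp))

/-- A locally constant function on an open set factors through its connected components. -/
theorem exists_lift_connectedComponents {A B : Type*} [TopologicalSpace A] {p : A → Prop}
    {f : A → B} (hf : ∀ a, p a → ∀ᶠ b in 𝓝 a, f b = f a) :
    ∃ g : ConnectedComponents {a // p a} → B, ∀ a (h : p a),
      f a = g (ConnectedComponents.mk ⟨a, h⟩) := by
  refine ⟨Quotient.lift (fun a : {a // p a} => f a) fun a b hab => ?_, fun a h => rfl⟩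
  have hab : connectedComponent a = connectedComponent b := hab
  refine eq_of_isPreconnected (f := fun a : {a // p a} => f a) isPreconnected_connectedComponent
    (fun c _ => nhdsWithin_le_nhds ?_) mem_connectedComponent
    (hab ▸ mem_connectedComponent : b ∈ connectedComponent a)
  exact continuous_subtype_val.continuousAt.eventually (hf c c.2)

/-- Locally constant functions descend to connected components, that is, to arcs and regions. Each
incidence in the definition of a coloring is then tested at points close to the crossing, side or
endpoint concerned. -/
theorem IsColoring.exists_coloring {F : unitInterval → X} {G : S → Y} (h : IsColoring D F G) :
    ∃ c : Coloring X Y D, c.Represents F G := by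
  obtain ⟨f, hf⟩ := exists_lift_connectedComponents (p := fun t => t ∉ D.under) h.arc_eq
  obtain ⟨g, hg⟩ := exists_lift_connectedComponents (p := fun p => p ∉ range D.curve) h.region_eq
  have hfa : ∀ (a : D.Arc) t, t ∈ a.params → F t = f a := by
    rintro a t ⟨ht, rfl⟩
    exact hf t ht
  have hgr : ∀ (r : D.Region) p, p ∈ r.points → G p = g r := by
    rintro a t ⟨ht, rfl⟩
    exact hg t ht
  refine ⟨⟨f, g, ?_, ?_, ?_⟩, hf, hg⟩
  · rintro a b c ⟨s, t, hs, ht, hst, e, ε, he, hε, hes, het, hv⟩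
    rw [← hfa b s hs]
    obtain ⟨hs', -⟩ := hs
    refine h.crossing s t (fun h => hs' (h ▸ ht)) ht hst e ε he hε hes het _ _ ?_
    exact hv.mono fun v hv => ⟨fun h => hfa a v (hv.1 h), fun h => hfa c v (hv.2 h)⟩
  · rintro a r₁ r₂ ⟨t, ht, h0, h1, hinj, e, he, het, hy⟩
    obtain ⟨y, hy1, hy2⟩ := (hy.and (h.side t h0 h1 hinj e he het)).exists
    rwa [hgr r₁ _ hy1.1, hgr r₂ _ hy1.2, hfa a t ht] at hy2
  · rintro a r ⟨t, ht, hta, hcl⟩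
    obtain ⟨q, hq1, hq2⟩ :=
      ((mem_closure_iff_frequently.1 hcl).and_eventually (h.endpoint t ht)).exists
    have h2 := hq2 hq1.1
    rwa [hgr r _ hq1, hfa a t hta] at h2

theorem eventually_mk_eq_mk {A : Type*} [TopologicalSpace A] [LocallyConnectedSpace A]
    {p : A → Prop} (hp : IsOpen {a | p a}) {a : A} (ha : p a) :
    ∀ᶠ b in 𝓝 a, ∃ h : p b, (ConnectedComponents.mk (⟨b, h⟩ : {a // p a})) =
      ConnectedComponents.mk ⟨a, ha⟩ := by
  have : LocallyConnectedSpace {a // p a} := hp.locallyConnectedSpace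
  have h1 : IsOpen (connectedComponent (⟨a, ha⟩ : {a // p a})) := isOpen_connectedComponent
  have h2 := (hp.isOpenEmbedding_subtypeVal.isOpenMap _ h1).mem_nhds
    (mem_image_of_mem _ mem_connectedComponent)
  filter_upwards [h2] with b hb
  obtain ⟨⟨c, hc⟩, hc2, rfl⟩ := hb
  exact ⟨hc, ConnectedComponents.coe_eq_coe'.2 hc2⟩

theorem locallyConnectedSpace_unitInterval : LocallyConnectedSpace unitInterval := by
  have : LocallyPathConnectedSpace (Icc (0 : ℝ) 1) := (convex_Icc 0 1).locallyPathConnectedSpace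
  exact inferInstanceAs (LocallyConnectedSpace (Icc (0 : ℝ) 1))

/-- The interval and the surface are locally connected, so components of open sets are open and the
functions that a coloring induces on points are locally constant. Values at under-passages and on
the curve are immaterial. -/
theorem Coloring.exists_represents [T2Space S] (c : Coloring X Y D) :
    ∃ (F : unitInterval → X) (G : S → Y), IsColoring D F G ∧ c.Represents F G := by
  classical
  have hI := locallyConnectedSpace_unitInterval
  have hS : LocallyConnectedSpace S := ChartedSpace.locallyConnectedSpace Plane S
  have harc : ∀ t (ht : t ∉ D.under), ∀ᶠ v in 𝓝 t, v ∈ Arc.params (D.arcAt t ht) := fun t ht =>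
    eventually_mk_eq_mk (p := fun t => t ∉ D.under) D.finite_under.isClosed.isOpen_compl ht
  have hreg : ∀ p (hp : p ∉ range D.curve), ∀ᶠ q in 𝓝 p, q ∈ Region.points (D.regionAt p hp) := fun p hp =>
    eventually_mk_eq_mk (p := fun p => p ∉ range D.curve) D.isClosed_range.isOpen_compl hp
  -- The maps from points to arcs and to regions are made total with the value `none`, so that the
  -- lemmas on locally constant functions apply to the arcs and regions themselves and not only to
  -- their colors.
  let ra : unitInterval → Option D.Arc := fun t =>
    if h : t ∉ D.under then some (D.arcAt t (h)) else none
  let rr : S → Option D.Region := fun p =>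
    if h : p ∉ range D.curve then some (D.regionAt p (h)) else none
  have hra : ∀ t a, ra t = some a ↔ t ∈ a.params := by
    intro t a
    rw [Arc.mem_params]
    by_cases h : t ∈ D.under <;> simp [ra, h]
  have hrr : ∀ p r, rr p = some r ↔ p ∈ r.points := by
    intro p r
    rw [Region.mem_points]
    by_cases h : p ∉ range D.curve
    · simp only [rr, h, not_false_eq_true, dite_true, Option.some.injEq, exists_true_left]
    · simp only [rr, h, dite_false, IsEmpty.exists_iff, reduceCtorEq]
  have hra1 : ∀ t, t ∉ D.under → ∀ᶠ v in 𝓝 t, ra v = ra t := by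
    intro t ht
    filter_upwards [harc t ht] with v hv
    rw [(hra _ _).2 hv, eq_comm, hra]
    exact ⟨ht, rfl⟩
  have hrr1 : ∀ p, p ∉ range D.curve → ∀ᶠ q in 𝓝 p, rr q = rr p := by
    intro t ht
    filter_upwards [hreg t ht] with v hv
    rw [(hrr _ _).2 hv, eq_comm, hrr]
    exact ⟨ht, rfl⟩
  have hrr0 : ∀ p ∉ range D.curve, ∃ r, rr p = some r := fun p hp =>
    ⟨_, (hrr p _).2 ⟨hp, rfl⟩⟩
  have slit : ∀ t, t = 0 ∨ t = 1 → ∃ r : D.Region, (∀ᶠ q in 𝓝 (D.curve t), q ∉ range D.curve →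
      q ∈ r.points) ∧ ∃ᶠ q in 𝓝 (D.curve t), q ∉ range D.curve := by
    intro t ht
    obtain ⟨e, -, he⟩ := D.immersion t
    obtain ⟨v, hv, hf⟩ := he.exists_slit (D.eq_of_curve_eq_endpoint ht) ht (φ := rr)
      (Eventually.of_forall fun q hq => hrr1 q hq)
    obtain ⟨q, hq1, hq2⟩ := (hf.and_eventually hv).exists
    obtain ⟨r, hr⟩ := hrr0 q hq1
    refine ⟨r, hv.mono fun p hp hpr => ?_, hf⟩
    rw [← hrr, hp hpr, ← hq2 hq1, hr]
  have hY : Nonempty Y := by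
    obtain ⟨r, -, -⟩ := slit 0 (Or.inl rfl)
    exact ⟨c.regionColor r⟩
  have hX : Nonempty X := ⟨c.arcColor (D.arcAt 0
    (notMem_under_of_forall (D.eq_of_curve_eq_endpoint (Or.inl rfl))))⟩
  let F : unitInterval → X := fun t => (ra t).elim hX.some c.arcColor
  let G : S → Y := fun p => (rr p).elim hY.some c.regionColor
  have hF : ∀ (a : D.Arc) t, t ∈ a.params → F t = c.arcColor a := by
    intro a t ht
    simp only [F, (hra t a).2 ht, Option.elim]
  have hG : ∀ (r : D.Region) p, p ∈ r.points → G p = c.regionColor r := by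
    intro a t ht
    simp only [G, (hrr t a).2 ht, Option.elim]
  refine ⟨F, G, ⟨?_, ?_, ?_, ?_, ?_⟩, fun t ht => hF _ t ⟨ht, rfl⟩, fun p hp => hG _ p ⟨hp, rfl⟩⟩
  · intro t ht
    filter_upwards [hra1 t ht] with v hv
    simp only [F, hv]
  · intro t ht
    filter_upwards [hrr1 t ht] with v hv
    simp only [G, hv]
  · intro s t hst ht hcur e ε he hε hes het x₁ x₂ hx
    have h1 : ∀ᶠ s in 𝓝[≠] t, ∀ᶠ v in 𝓝 s, ra v = ra s :=
      (D.eventually_notMem_under t).mono fun s hs => hra1 s hs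
    have h2 := (D.eventually_notMem_under t)
    rw [eventually_nhdsWithin_iff] at h2
    have hs : s ∉ D.under := notMem_under_of_curve_eq ht hst hcur
    obtain ⟨h0, h0'⟩ := ne_endpoint_of_mem_under ht
    obtain ⟨hl, hr⟩ := frequently_sides h0 h0' hε
    obtain ⟨y₁, y₂, hy⟩ : ∃ y₁ y₂, ∀ᶠ v : unitInterval in 𝓝 t,
        (ε * ((v : ℝ) - t) < 0 → ra v = y₁) ∧ (0 < ε * ((v : ℝ) - t) → ra v = y₂) := by
      obtain ⟨y₁, y₂, hy⟩ := exists_eventually_eq_sides h1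
      have key : ∀ v w : unitInterval, v < w ↔ (v : ℝ) < w := fun v w => Iff.rfl
      simp only [key] at hy
      rcases hε with rfl | rfl
      · exact ⟨y₁, y₂, hy.mono fun v hv =>
          ⟨fun h => hv.1 (by linarith), fun h => hv.2 (by linarith)⟩⟩
      · exact ⟨y₂, y₁, hy.mono fun v hv =>
          ⟨fun h => hv.2 (by linarith), fun h => hv.1 (by linarith)⟩⟩
    -- The parameters `v` and `w` lie close to `t` on its two sides, where they represent the
    -- incoming and the outgoing under-arc with respect to the normal of the over-arc.
    obtain ⟨v, hv1, hv2, hv3, hv4⟩ := (hl.and_eventually (h2.and (hy.and hx))).exists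
    obtain ⟨w, hw1, hw2, hw3, hw4⟩ := (hr.and_eventually (h2.and (hy.and hx))).exists
    have hvt : v ≠ t := by rintro rfl; simp at hv1
    have hwt : w ≠ t := by rintro rfl; simp at hw1
    have h3 : CrossingTriple (D := D) (D.arcAt v (hv2 hvt))
        (D.arcAt s (hs)) (D.arcAt w (hw2 hwt)) := by
      refine ⟨s, t, ⟨hs, rfl⟩, ht, hcur, e, ε, he, hε, hes, het, ?_⟩
      filter_upwards [hy] with z hz
      refine ⟨fun h => ?_, fun h => ?_⟩
      · rw [← hra, hz.1 h, ← hv3.1 hv1, hra]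
        exact ⟨_, rfl⟩
      · rw [← hra, hz.2 h, ← hw3.2 hw1, hra]
        exact ⟨_, rfl⟩
    rw [← hv4.1 hv1, ← hw4.2 hw1, hF _ v ⟨hv2 hvt, rfl⟩, hF _ w ⟨hw2 hwt, rfl⟩,
      hF _ s ⟨hs, rfl⟩]
    exact c.crossing _ _ _ h3
  · intro t h0 h1 hinj e he het
    have ht : t ∉ D.under := notMem_under_of_forall hinj
    obtain ⟨v₁, v₂, hv⟩ := het.exists_sides isClosed_univ (fun s _ => hinj s) (φ := rr)
      (Eventually.of_forall fun q hq => hrr1 q (by simpa using hq))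
    have hb := het.eventually_eq isClosed_univ (fun s _ => hinj s)
    have hup := (tendsto_vertical (σ := 1)).eventually (hv.and hb)
    have hdn := (tendsto_vertical (σ := -1)).eventually (hv.and hb)
    simp only [one_mul, neg_one_mul] at hup hdn
    have hreg2 : ∀ y : ℝ, y ≠ 0 → (∀ v ∈ univ, D.curve v = e.symm (0, y) →
        ((0, y) : Plane) = ((v : ℝ) - t) • (1, 0)) → e.symm (0, y) ∉ range D.curve := by
      rintro y hy h ⟨v, hv⟩
      have := congrArg Prod.snd (h v (mem_univ v) hv)
      simp at this
      exact hy this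
    have hall := hup.and (hdn.and (self_mem_nhdsWithin (a := (0 : ℝ)) (s := Ioi 0)))
    obtain ⟨y, ⟨hy1, hy2⟩, ⟨hy3, hy4⟩, hy0⟩ := hall.exists
    have hy0 : 0 < y := hy0
    obtain ⟨r₂, hr₂⟩ := hrr0 _ (hreg2 y hy0.ne' hy2)
    obtain ⟨r₁, hr₁⟩ := hrr0 _ (hreg2 (-y) (neg_ne_zero.2 hy0.ne') hy4)
    rw [hy1.1 hy0] at hr₂
    rw [hy3.2 (neg_lt_zero.2 hy0)] at hr₁
    have hboth : ∀ᶠ y in 𝓝[>] (0 : ℝ), e.symm (0, -y) ∈ r₁.points ∧ e.symm (0, y) ∈ r₂.points := by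
      filter_upwards [hall] with y hy
      obtain ⟨⟨hy1, -⟩, ⟨hy3, -⟩, hy0⟩ := hy
      rw [← hrr, ← hrr, hy1.1 hy0, hy3.2 (neg_lt_zero.2 hy0)]
      exact ⟨hr₁, hr₂⟩
    filter_upwards [hboth] with y hy
    rw [hG _ _ hy.1, hG _ _ hy.2, hF (D.arcAt t (ht)) t ⟨ht, rfl⟩]
    exact c.side _ _ _ ⟨t, ⟨ht, rfl⟩, h0, h1, hinj, e, he, het, hboth⟩
  · intro t ht
    have htu : t ∉ D.under := notMem_under_of_forall (D.eq_of_curve_eq_endpoint ht)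
    obtain ⟨r, hr1, hr2⟩ := slit t ht
    filter_upwards [hr1] with q hq hqr
    rw [hG _ _ (hq hqr), hF (D.arcAt t (htu)) t ⟨htu, rfl⟩]
    refine c.endpoint _ _ ⟨t, ht, ⟨htu, rfl⟩, ?_⟩
    rw [mem_closure_iff_frequently]
    exact (hr2.and_eventually hr1).mono fun p hp => hp.2 hp.1

end Diagrams

/-! ### Strands in a disk, their index functions and the jumps of the holonomy. -/

section Diagrams

variable {S : Type*} [TopologicalSpace S] [ChartedSpace Plane S]

open KnotoidDiagram

theorem KnotoidDiagram.exists_crossing_chart (D : KnotoidDiagram S) {s t : unitInterval}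
    (hst : s ≠ t) (h : D.curve s = D.curve t) :
    ∃ (e : OpenPartialHomeomorph S Plane) (ε : ℝ), IsOrientedChart e ∧ (ε = 1 ∨ ε = -1) ∧
      StraightAt D.curve e s (1, 0) ∧ StraightAt D.curve e t (0, ε) := by
  obtain ⟨e, he, hs, ht | ht⟩ := D.transverse s t hst h
  · exact ⟨e, 1, he, Or.inl rfl, hs, ht⟩
  · exact ⟨e, -1, he, Or.inr rfl, hs, ht⟩

/-- The open set `U` meets the diagram in the `n` strands `D.curve '' Ioo (a i) (b i)`, each of which
passes under those of smaller index, and `W i` is an index function of the strand `i`: it is locally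
constant off the strand and increases by one across the strand, from right to left. -/
structure DiskModel (D : KnotoidDiagram S) (U : Set S) (n : ℕ) (a b : ℕ → unitInterval)
    (W : ℕ → S → ℤ) : Prop where
  isOpen : IsOpen U
  isPreconnected : ∀ Z : Set S, Z.Finite → IsPreconnected (U \ Z)
  lt : ∀ i < n, a i < b i
  disjoint : ∀ i < n, ∀ j < n, i ≠ j → Disjoint (Icc (a i) (b i)) (Icc (a j) (b j))
  left_end : ∀ i s, D.curve s = D.curve (a i) → s = a i
  right_end : ∀ i < n, ∀ s, D.curve s = D.curve (b i) → s = b i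
  left_notMem : ∀ i, D.curve (a i) ∉ U
  mem_iff : ∀ t, D.curve t ∈ U ↔ ∃ i < n, t ∈ Ioo (a i) (b i)
  under_iff : ∀ i < n, ∀ j < n, i ≠ j → ∀ s ∈ Ioo (a i) (b i), ∀ t ∈ Ioo (a j) (b j),
    D.curve s = D.curve t → (s ∈ D.under ↔ j < i)
  self_crossing : ∀ i < n, ∀ s ∈ Ioo (a i) (b i), ∀ t ∈ Ioo (a i) (b i), ∀ s' ∈ Ioo (a i) (b i),
    ∀ t' ∈ Ioo (a i) (b i), s ≠ t → D.curve s = D.curve t → s' ≠ t' → D.curve s' = D.curve t' →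
    t ∈ D.under → t' ∈ D.under → t = t'
  index_eq : ∀ i < n, ∀ p ∈ closure U, p ∉ D.curve '' Icc (a i) (b i) →
    ∀ᶠ q in 𝓝 p, W i q = W i p
  index_jump : ∀ i < n, ∀ t ∈ Ioo (a i) (b i),
    (∀ s ∈ Icc (a i) (b i), D.curve s = D.curve t → s = t) →
    ∀ e : OpenPartialHomeomorph S Plane, IsOrientedChart e → StraightAt D.curve e t (1, 0) →
      ∀ᶠ y in 𝓝[>] (0 : ℝ), W i (e.symm (0, y)) = W i (e.symm (0, -y)) + 1

namespace DiskModel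

variable {D : KnotoidDiagram S} {U : Set S} {n : ℕ} {a b : ℕ → unitInterval} {W : ℕ → S → ℤ}

theorem mem_closure (M : DiskModel D U n a b W) {i : ℕ} (hi : i < n) {t : unitInterval}
    (ht : t ∈ Icc (a i) (b i)) : D.curve t ∈ closure U := by
  rw [← closure_Ioo (M.lt i hi).ne] at ht
  refine closure_mono ?_ (image_closure_subset_closure_image D.curve.continuous
    (mem_image_of_mem _ ht))
  rintro _ ⟨s, hs, rfl⟩
  exact (M.mem_iff s).2 ⟨i, hi, hs⟩

theorem mem_Ioo_of_ne (M : DiskModel D U n a b W) {i : ℕ} (hi : i < n) {s t : unitInterval}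
    (ht : t ∈ Icc (a i) (b i)) (hst : s ≠ t) (h : D.curve s = D.curve t) :
    t ∈ Ioo (a i) (b i) := by
  refine ⟨lt_of_le_of_ne ht.1 ?_, lt_of_le_of_ne ht.2 ?_⟩
  · rintro rfl
    exact hst (M.left_end i s h)
  · rintro rfl
    exact hst (M.right_end i hi s h)

theorem eq_of_mem (M : DiskModel D U n a b W) {i j : ℕ} (hi : i < n) (hj : j < n) {t : unitInterval}
    (ht : t ∈ Icc (a i) (b i)) (ht' : t ∈ Icc (a j) (b j)) : i = j := by
  by_contra hij
  exact disjoint_left.1 (M.disjoint i hi j hj hij) ht ht'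

/-- If strand `i` met a strand of smaller index at `t`, it would pass under it there. So the
holonomy up to `i` is locally constant along strand `i` except at its under-passages. -/
theorem notMem_image (M : DiskModel D U n a b W) {i : ℕ} (hi : i < n) {t : unitInterval}
    (ht : t ∈ Icc (a i) (b i)) (htu : t ∉ D.under) :
    ∀ j < i, D.curve t ∉ D.curve '' Icc (a j) (b j) := by
  rintro j hj ⟨s, hs, hst⟩
  have hne : s ≠ t := by
    rintro rfl
    exact hj.ne (M.eq_of_mem (hj.trans hi) hi hs ht)
  have h1 := M.mem_Ioo_of_ne hi ht hne hst
  have h2 := M.mem_Ioo_of_ne (hj.trans hi) hs hne.symm hst.symm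
  exact htu ((M.under_iff i hi j (hj.trans hi) hj.ne' t h1 s h2 hst.symm).2 hj)

/-- The over-strand at an under-passage lies higher, hence has smaller index; `k = i` is the case of
a self-crossing. -/
theorem exists_over (M : DiskModel D U n a b W) {i : ℕ} (hi : i < n) {t : unitInterval}
    (ht : t ∈ Icc (a i) (b i)) (htu : t ∈ D.under) :
    t ∈ Ioo (a i) (b i) ∧ ∃ k ≤ i, ∃ s ∈ Ioo (a k) (b k), s ≠ t ∧ D.curve s = D.curve t := by
  obtain ⟨s, hne, hst⟩ := D.under_double t htu
  have h1 := M.mem_Ioo_of_ne hi ht hne hst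
  have h2 : D.curve s ∈ U := hst ▸ (M.mem_iff t).2 ⟨i, hi, h1⟩
  obtain ⟨k, hk, hs⟩ := (M.mem_iff s).1 h2
  refine ⟨h1, k, ?_, s, hs, hne, hst⟩
  rcases eq_or_ne k i with rfl | hki
  · exact le_rfl
  · exact ((M.under_iff i hi k hk hki.symm t h1 s hs hst.symm).1 htu).le

variable {X Y : Type*} [Quandle X] [QuandleSet X Y] {x : ℕ → X}

theorem eventually_holonomy_eq (M : DiskModel D U n a b W) {d : ℕ} (hd : d ≤ n) {p : S}
    (hp : p ∈ closure U) (h : ∀ k < d, p ∉ D.curve '' Icc (a k) (b k)) :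
    ∀ᶠ q in 𝓝 p, holonomy Y x W d q = holonomy Y x W d p :=
  Knotoids.eventually_holonomy_eq fun k hk => M.index_eq k (hk.trans_le hd) p hp (h k hk)

/-- Near `D.curve t` the only one of the first `d` indices that varies is `W k`, and it does so just
across the axis. Thus the holonomy has a value `g` below the axis, and `holonomy_jump` computes the
one above. -/
theorem exists_holonomy_jump [T2Space S] (M : DiskModel D U n a b W) {k d : ℕ} (hk : k < d)
    (hd : d ≤ n) {t : unitInterval} (ht : t ∈ Ioo (a k) (b k))
    (hself : ∀ s ∈ Icc (a k) (b k), D.curve s = D.curve t → s = t)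
    (hoth : ∀ j < d, j ≠ k → D.curve t ∉ D.curve '' Icc (a j) (b j))
    {e : OpenPartialHomeomorph S Plane} (he : IsOrientedChart e)
    (het : StraightAt D.curve e t (1, 0)) :
    ∃ g ∈ compatible X Y, ∀ᶠ z in 𝓝 (0 : Plane),
      (0 < z.2 → holonomy Y x W d (e.symm z)
        = operator Y ((holonomy Y x W k (D.curve t)).1 (x k)) * g) ∧
      (z.2 < 0 → holonomy Y x W d (e.symm z) = g) := by
  have hkn := hk.trans_le hd
  have hU : D.curve t ∈ U := (M.mem_iff t).2 ⟨k, hkn, ht⟩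
  obtain ⟨v₁, v₂, hv⟩ := het.exists_sides isClosed_Icc hself (φ := W k) (by
    filter_upwards [M.isOpen.mem_nhds hU] with q hq hq2
    exact M.index_eq k hkn q (subset_closure hq) hq2)
  have h12 : v₁ = v₂ + 1 := by
    have hup := (tendsto_vertical (σ := 1)).eventually hv
    have hdn := (tendsto_vertical (σ := -1)).eventually hv
    simp only [one_mul, neg_one_mul] at hup hdn
    have := hup.and (hdn.and ((M.index_jump k hkn t ht hself e he het).and self_mem_nhdsWithin))
    obtain ⟨y, hy1, hy2, hy3, hy4⟩ := this.exists
    have hy4 : 0 < y := hy4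
    rw [← hy1.1 hy4, ← hy2.2 (neg_lt_zero.2 hy4), hy3]
  -- A two-point model of the neighborhood: `true` is the left side and `false` the right side of
  -- the strand, and all other indices are frozen.
  let W' : ℕ → Bool → ℤ := fun j c => if j = k then (if c then v₁ else v₂) else W j (D.curve t)
  have hev : ∀ᶠ z in 𝓝 (0 : Plane), ∀ j ∈ Finset.range d, j ≠ k →
      W j (e.symm z) = W j (D.curve t) := by
    refine (Finset.eventually_all _).2 fun j hj => ?_
    have hj := Finset.mem_range.1 hj
    by_cases hjk : j = k
    · exact Eventually.of_forall fun z h => absurd hjk h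
    · exact (het.tendsto.eventually (M.index_eq j (hj.trans_le hd) _ (subset_closure hU)
        (hoth j hj hjk))).mono fun z hz _ => hz
  have hW : holonomy Y x W k (D.curve t) = holonomy Y x W' k false :=
    holonomy_congr (fun _ _ => rfl) fun j hj => by simp [W', hj.ne]
  refine ⟨holonomy Y x W' d false, holonomy_mem_compatible _ _, ?_⟩
  filter_upwards [hv, hev] with z hz hz2
  refine ⟨fun h => ?_, fun h => ?_⟩
  · have h1 : holonomy Y x W d (e.symm z) = holonomy Y x W' d true := by
      refine holonomy_congr (fun _ _ => rfl) fun j hj => ?_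
      by_cases hjk : j = k
      · subst hjk; simp [W', hz.1 h]
      · simp [W', hjk, hz2 j (Finset.mem_range.2 hj) hjk]
    rw [h1, hW]
    refine holonomy_jump hk (fun j hj hjk => by simp [W', hjk]) (by simp [W', h12])
  · refine holonomy_congr (fun _ _ => rfl) fun j hj => ?_
    by_cases hjk : j = k
    · subst hjk; simp [W', hz.2 h]
    · simp [W', hjk, hz2 j (Finset.mem_range.2 hj) hjk]

/-- The holonomy along a strand that passes under the strand `k`. -/
theorem exists_holonomy_jump_under [T2Space S] (M : DiskModel D U n a b W) {k i : ℕ} (hk : k < i)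
    (hi : i < n) {s t : unitInterval} (hs : s ∈ Ioo (a k) (b k)) (ht : t ∈ Ioo (a i) (b i))
    (hst : D.curve s = D.curve t) {e : OpenPartialHomeomorph S Plane} (he : IsOrientedChart e)
    (hes : StraightAt D.curve e s (1, 0)) {ε : ℝ} (het : StraightAt D.curve e t (0, ε)) :
    ∃ g ∈ compatible X Y, ∀ᶠ v : unitInterval in 𝓝 t,
      (0 < ε * ((v : ℝ) - t) → holonomy Y x W i (D.curve v)
        = operator Y ((holonomy Y x W k (D.curve s)).1 (x k)) * g) ∧
      (ε * ((v : ℝ) - t) < 0 → holonomy Y x W i (D.curve v) = g) := by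
  have hne : s ≠ t := by
    rintro rfl
    exact hk.ne (M.eq_of_mem (hk.trans hi) hi (Ioo_subset_Icc_self hs) (Ioo_subset_Icc_self ht))
  obtain ⟨g, hg, hz⟩ := M.exists_holonomy_jump (Y := Y) (x := x) hk hi.le hs
    -- Strands `k` and `i` already account for both branches at the crossing, so by `noTriple` no
    -- other branch passes through it.
    (fun r hr hrs => by
      rcases D.noTriple r s t hrs hst with h | h | h
      · exact h
      · exact absurd h hne
      · subst h
        exact absurd (M.eq_of_mem (hk.trans hi) hi hr (Ioo_subset_Icc_self ht)) hk.ne)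
    (fun j hj hjk => by
      rintro ⟨r, hr, hrs⟩
      rcases D.noTriple r s t hrs hst with h | h | h
      · subst h
        exact hjk (M.eq_of_mem (hj.trans hi) (hk.trans hi) hr (Ioo_subset_Icc_self hs))
      · exact hne h
      · subst h
        exact hj.ne (M.eq_of_mem (hj.trans hi) hi hr (Ioo_subset_Icc_self ht))) he hes
  refine ⟨g, hg, ?_⟩
  have h1 : Tendsto (fun v : unitInterval => ((v : ℝ) - t) • ((0, ε) : Plane)) (𝓝 t) (𝓝 0) := by
    have : Continuous (fun v : unitInterval => ((v : ℝ) - t) • ((0, ε) : Plane)) := by fun_prop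
    simpa using this.tendsto t
  filter_upwards [h1.eventually hz, het.eventually_curve_eq] with v hv hv2
  rw [hv2]
  simp only [Prod.smul_snd, smul_eq_mul, mul_comm _ ε] at hv
  exact hv

end DiskModel

end Diagrams

/-! ### Every coloring is given by the holonomy inside the disk. -/

section Diagrams

variable {S : Type*} [TopologicalSpace S] [ChartedSpace Plane S]

open KnotoidDiagram

theorem frequently_notMem_under {D : KnotoidDiagram S} {t : unitInterval} {s : Set unitInterval}
    (ht : t ∈ s) (hs : t ∈ D.under → s ∈ 𝓝 t) : ∃ᶠ v in 𝓝[s] t, v ∉ D.under := by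
  by_cases htu : t ∈ D.under
  · rw [nhdsWithin_eq_nhds.2 (hs htu)]
    obtain ⟨h0, h1⟩ := ne_endpoint_of_mem_under htu
    have h2 := D.eventually_notMem_under t
    rw [eventually_nhdsWithin_iff] at h2
    refine ((frequently_sides h0 h1 (Or.inl rfl)).1.and_eventually h2).mono fun v hv => hv.2 ?_
    rintro rfl
    simpa using hv.1
  · exact frequently_nhdsWithin_iff.2 (Frequently.mono (frequently_pure.2 ⟨htu, ht⟩ :
      ∃ᶠ v in pure t, v ∉ D.under ∧ v ∈ s) (fun _ h => h) |>.filter_mono (pure_le_nhds t))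

/-- The colors of the regions on the two sides of a strand. -/
theorem IsColoring.exists_side_values [T2Space S] {D : KnotoidDiagram S} {X Y : Type*} [Quandle X]
    [QuandleSet X Y] {F : unitInterval → X} {G : S → Y} (h : IsColoring D F G) {t : unitInterval}
    (h0 : t ≠ 0) (h1 : t ≠ 1) (hinj : ∀ s, D.curve s = D.curve t → s = t)
    {e : OpenPartialHomeomorph S Plane} (he : IsOrientedChart e)
    (het : StraightAt D.curve e t (1, 0)) :
    ∃ y₁ y₂, QuandleSet.act y₂ (F t) = y₁ ∧ ∀ᶠ z in 𝓝 (0 : Plane),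
      (0 < z.2 → G (e.symm z) = y₁) ∧ (z.2 < 0 → G (e.symm z) = y₂) := by
  obtain ⟨y₁, y₂, hy⟩ := het.exists_sides isClosed_univ (fun s _ => hinj s) (φ := G)
    (Eventually.of_forall fun q hq => h.region_eq q (by simpa using hq))
  have hside := h.side t h0 h1 hinj e he het
  have hup := (tendsto_vertical (σ := 1)).eventually hy
  have hdn := (tendsto_vertical (σ := -1)).eventually hy
  simp only [one_mul, neg_one_mul] at hup hdn
  refine ⟨y₁, y₂, ?_, hy⟩
  obtain ⟨y, hy1, hy2, hy3, hy4⟩ := (hup.and (hdn.and (hside.and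
    (self_mem_nhdsWithin (a := (0 : ℝ)) (s := Ioi 0))))).exists
  have hy4 : 0 < y := hy4
  rw [← hy1.1 hy4, ← hy2.2 (neg_lt_zero.2 hy4), hy3]

namespace DiskModel

variable {D : KnotoidDiagram S} {U : Set S} {n : ℕ} {a b : ℕ → unitInterval} {W : ℕ → S → ℤ}
  {X Y : Type*} [Quandle X] [QuandleSet X Y] {x : ℕ → X} {F : unitInterval → X} {G : S → Y}

/-- Corrected by the holonomy, the color of a strand does not change where the strand passes under
another one. -/
theorem exists_eventually_color_eq [T2Space S] (M : DiskModel D U n a b W) (h : IsColoring D F G)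
    {i : ℕ} (hi : i < n)
    (hcol : ∀ k < i, ∀ t ∈ Icc (a k) (b k), t ∉ D.under →
      F t = (holonomy Y x W k (D.curve t)).1 (x k))
    {t : unitInterval} (ht : t ∈ Icc (a i) (b i))
    (hself : t ∈ D.under → ∀ s ∈ Ioo (a i) (b i), D.curve s = D.curve t → s = t) :
    ∃ v, ∀ᶠ s in 𝓝 t, s ∉ D.under → (holonomy Y x W i (D.curve s))⁻¹.1 (F s) = v := by
  by_cases htu : t ∈ D.under
  · obtain ⟨ht', k, hk, s, hs, hst, hcur⟩ := M.exists_over hi ht htu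
    have hki : k < i := by
      refine lt_of_le_of_ne hk ?_
      rintro rfl
      exact hst (hself htu s hs hcur)
    obtain ⟨e, ε, he, hε, hes, het⟩ := D.exists_crossing_chart hst hcur
    obtain ⟨g, hg, hjump⟩ := M.exists_holonomy_jump_under (Y := Y) (x := x) hki hi hs ht' hcur he
      hes het
    obtain ⟨x₁, x₂, hx⟩ := h.exists_sides t hε
    have h12 := h.crossing s t hst htu hcur e ε he hε hes het x₁ x₂ hx
    have hFs := hcol k hki s (Ioo_subset_Icc_self hs) (notMem_under_of_curve_eq htu hst hcur)
    refine ⟨g⁻¹.1 x₁, ?_⟩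
    filter_upwards [hjump, hx] with v hv hv2 hvu
    have hvt : (v : ℝ) - t ≠ 0 := by
      intro h0
      exact hvu ((Subtype.ext (sub_eq_zero.1 h0) : v = t) ▸ htu)
    have hne : ε * ((v : ℝ) - t) ≠ 0 :=
      mul_ne_zero (by rcases hε with rfl | rfl <;> norm_num) hvt
    -- The color and the holonomy both change by the operator of the color of the over-strand, so
    -- the quotient is the same on the two sides.
    rcases hne.lt_or_gt with h0 | h0
    · rw [hv.2 h0, hv2.1 h0]
    · rw [hv.1 h0, hv2.2 h0, h12, hFs]
      rw [← operator_fst (Y := Y), mul_inv_rev, Prod.fst_mul, Equiv.Perm.mul_apply, Prod.fst_inv,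
        Prod.fst_inv]
      exact congrArg _ (Equiv.symm_apply_apply _ _)
  · refine ⟨(holonomy Y x W i (D.curve t))⁻¹.1 (F t), ?_⟩
    have h1 := D.curve.continuous.continuousAt.eventually (M.eventually_holonomy_eq (Y := Y) (x := x)
      hi.le (M.mem_closure hi ht) (M.notMem_image hi ht htu))
    filter_upwards [h1, h.arc_eq t htu] with v hv hv2 _
    rw [hv, hv2]

/-- The colors of the strands are the values of the holonomy. -/
theorem color_eq [T2Space S] (M : DiskModel D U n a b W) (h : IsColoring D F G)
    (hx : ∀ i < n, x i = (holonomy Y x W i (D.curve (a i)))⁻¹.1 (F (a i))) :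
    ∀ i < n, ∀ t ∈ Icc (a i) (b i), t ∉ D.under →
      F t = (holonomy Y x W i (D.curve t)).1 (x i) := by
  intro i
  induction i using Nat.strong_induction_on with
  | _ i ih =>
  intro hi
  have hcol : ∀ k < i, ∀ t ∈ Icc (a k) (b k), t ∉ D.under →
      F t = (holonomy Y x W k (D.curve t)).1 (x k) := fun k hk => ih k hk (hk.trans hi)
  have hsuff : ∀ t ∈ Icc (a i) (b i), t ∉ D.under →
      (holonomy Y x W i (D.curve t))⁻¹.1 (F t)
        = (holonomy Y x W i (D.curve (a i)))⁻¹.1 (F (a i)) := by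
    have hau : a i ∉ D.under := notMem_under_of_forall (M.left_end i)
    have hai : a i ∈ Icc (a i) (b i) := left_mem_Icc.2 (M.lt i hi).le
    -- Crossings with higher strands do not change the corrected color. Only a self-crossing of
    -- strand `i` could, and there is at most one.
    by_cases hex : ∃ t₀ ∈ D.under, ∃ s₀ ∈ Ioo (a i) (b i), t₀ ∈ Ioo (a i) (b i) ∧ s₀ ≠ t₀ ∧
        D.curve s₀ = D.curve t₀
    · obtain ⟨t₀, ht₀u, s₀, hs₀, ht₀, hne, hcur⟩ := hex
      have hev : ∀ t ∈ Icc (a i) (b i), t ≠ t₀ → ∃ v, ∀ᶠ s in 𝓝 t, s ∉ D.under →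
          (holonomy Y x W i (D.curve s))⁻¹.1 (F s) = v := by
        refine fun t ht htt₀ => M.exists_eventually_color_eq h hi hcol ht fun htu s hs hst => ?_
        by_contra hst'
        exact htt₀ (M.self_crossing i hi s hs t (M.mem_Ioo_of_ne hi ht hst' hst) s₀ hs₀ t₀ ht₀ hst'
          hst hne hcur htu ht₀u)
      have hconst : ∀ J : Set unitInterval, J.OrdConnected → t₀ ∉ J → IsOpen J →
          ∀ s ∈ Icc (a i) (b i) ∩ J, ∀ t ∈ Icc (a i) (b i) ∩ J, s ∉ D.under → t ∉ D.under →
            (holonomy Y x W i (D.curve s))⁻¹.1 (F s)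
              = (holonomy Y x W i (D.curve t))⁻¹.1 (F t) := by
        intro J hJ htJ hJo s hs t ht hsu htu
        refine eq_of_isPreconnected_of_dense (p := fun t => t ∉ D.under)
          (f := fun s => (holonomy Y x W i (D.curve s))⁻¹.1 (F s))
          (isPreconnected_of_ordConnected (ordConnected_Icc.inter hJ)) (fun v hv => ?_)
          (fun v hv => ?_) hs ht hsu htu
        · refine frequently_notMem_under hv fun hvu => inter_mem ?_ (hJo.mem_nhds hv.2)
          exact Icc_mem_nhds (M.exists_over hi hv.1 hvu).1.1 (M.exists_over hi hv.1 hvu).1.2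
        · obtain ⟨w, hw⟩ := hev v hv.1 fun h => htJ (h ▸ hv.2)
          exact ⟨w, nhdsWithin_le_nhds hw⟩
      have hleft := hconst (Iio t₀) ordConnected_Iio (by simp) isOpen_Iio
      have hright := hconst (Ioi t₀) ordConnected_Ioi (by simp) isOpen_Ioi
      have hs₀u : s₀ ∉ D.under := notMem_under_of_curve_eq ht₀u hne hcur
      obtain ⟨h0, h1⟩ := ne_endpoint_of_mem_under ht₀u
      obtain ⟨e, ε, he, hε, hes, het⟩ := D.exists_crossing_chart hne hcur
      obtain ⟨x₁, x₂, hx12⟩ := h.exists_sides t₀ hε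
      have h12 := h.crossing s₀ t₀ hne ht₀u hcur e ε he hε hes het x₁ x₂ hx12
      have hol := D.curve.continuous.continuousAt.eventually
        (M.eventually_holonomy_eq (Y := Y) (x := x) hi.le
          (M.mem_closure hi (Ioo_subset_Icc_self ht₀))
          (hcur ▸ M.notMem_image hi (Ioo_subset_Icc_self hs₀) hs₀u))
      have hun := D.eventually_notMem_under t₀
      rw [eventually_nhdsWithin_iff] at hun
      have hall := hol.and (hx12.and (hun.and (Icc_mem_nhds ht₀.1 ht₀.2)))
      obtain ⟨hl, hr⟩ := frequently_sides h0 h1 hε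
      obtain ⟨v, hv0, hv1, hv2, hv3, hv4⟩ := (hl.and_eventually hall).exists
      obtain ⟨w, hw0, hw1, hw2, hw3, hw4⟩ := (hr.and_eventually hall).exists
      have hvt : v ≠ t₀ := by rintro rfl; simp at hv0
      have hwt : w ≠ t₀ := by rintro rfl; simp at hw0
      have hvu := hv3 hvt
      have hwu := hw3 hwt
      -- The holonomy of the higher strands is constant near the self-crossing, since the
      -- over-passage `s₀` lies on none of them. As it acts by automorphisms, it can be removed from
      -- the crossing relation.
      have hrel : (holonomy Y x W i (D.curve w))⁻¹.1 (F w)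
          = (holonomy Y x W i (D.curve s₀))⁻¹.1 (F s₀) ◃
            (holonomy Y x W i (D.curve v))⁻¹.1 (F v) := by
        rw [hv1, hw1, hcur, ← compatible_act (inv_mem (holonomy_mem_compatible _ _)), hv2.1 hv0,
          hw2.2 hw0, h12]
      have hvw : (holonomy Y x W i (D.curve w))⁻¹.1 (F w)
          = (holonomy Y x W i (D.curve v))⁻¹.1 (F v) := by
        have hside : (v < t₀ ∧ t₀ < w) ∨ (w < t₀ ∧ t₀ < v) := by
          have key : ∀ v w : unitInterval, v < w ↔ (v : ℝ) < w := fun v w => Iff.rfl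
          simp only [key]
          rcases hε with rfl | rfl
          · left; constructor <;> linarith
          · right; constructor <;> linarith
        -- The over-passage `s₀` is on one of the two pieces into which `t₀` cuts the strand, so its
        -- corrected color is one of the two values to be compared. Then `x ◃ x = x`, together with
        -- cancellation in the second case, makes them equal.
        have hs₀' : (holonomy Y x W i (D.curve s₀))⁻¹.1 (F s₀)
              = (holonomy Y x W i (D.curve v))⁻¹.1 (F v) ∨
            (holonomy Y x W i (D.curve s₀))⁻¹.1 (F s₀)
              = (holonomy Y x W i (D.curve w))⁻¹.1 (F w) := by
          have hs₀c := Ioo_subset_Icc_self hs₀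
          rcases hne.lt_or_gt with hs | hs <;> rcases hside with ⟨hv, hw⟩ | ⟨hw, hv⟩
          · exact Or.inl (hleft s₀ ⟨hs₀c, hs⟩ v ⟨hv4, hv⟩ hs₀u hvu)
          · exact Or.inr (hleft s₀ ⟨hs₀c, hs⟩ w ⟨hw4, hw⟩ hs₀u hwu)
          · exact Or.inr (hright s₀ ⟨hs₀c, hs⟩ w ⟨hw4, hw⟩ hs₀u hwu)
          · exact Or.inl (hright s₀ ⟨hs₀c, hs⟩ v ⟨hv4, hv⟩ hs₀u hvu)
        rcases hs₀' with hs | hs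
        · rw [hrel, hs, Quandle.fix]
        · rw [hs] at hrel
          have h3 := hrel.symm.trans (Quandle.fix (x := (holonomy Y x W i (D.curve w))⁻¹.1 (F w))).symm
          exact ((Rack.left_cancel _).1 h3).symm
      intro t ht htu
      have htt₀ : t ≠ t₀ := fun h => htu (h ▸ ht₀u)
      have hside : (v < t₀ ∧ t₀ < w) ∨ (w < t₀ ∧ t₀ < v) := by
        have key : ∀ v w : unitInterval, v < w ↔ (v : ℝ) < w := fun v w => Iff.rfl
        simp only [key]
        rcases hε with rfl | rfl
        · left; constructor <;> linarith
        · right; constructor <;> linarith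
      rcases htt₀.lt_or_gt with hlt | hlt
      · exact hleft t ⟨ht, hlt⟩ _ ⟨hai, ht₀.1⟩ htu hau
      · rcases hside with ⟨hv, hw⟩ | ⟨hw, hv⟩
        · rw [hright t ⟨ht, hlt⟩ w ⟨hw4, hw⟩ htu hwu, hvw]
          exact hleft v ⟨hv4, hv⟩ _ ⟨hai, ht₀.1⟩ hvu hau
        · rw [hright t ⟨ht, hlt⟩ v ⟨hv4, hv⟩ htu hvu, ← hvw]
          exact hleft w ⟨hw4, hw⟩ _ ⟨hai, ht₀.1⟩ hwu hau
    · push Not at hex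
      intro t ht htu
      refine eq_of_isPreconnected_of_dense (p := fun t => t ∉ D.under)
        (f := fun s => (holonomy Y x W i (D.curve s))⁻¹.1 (F s))
        (isPreconnected_of_ordConnected ordConnected_Icc) (fun v hv => ?_)
        (fun v hv => ?_) ht hai htu hau
      · exact frequently_notMem_under hv fun hvu =>
          Icc_mem_nhds (M.exists_over hi hv hvu).1.1 (M.exists_over hi hv hvu).1.2
      · obtain ⟨w, hw⟩ := M.exists_eventually_color_eq h hi hcol hv fun hvu s hs hsv => by
          by_contra hne
          exact hex v hvu s hs (M.mem_Ioo_of_ne hi hv hne hsv) hne hsv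
        exact ⟨w, nhdsWithin_le_nhds hw⟩
  intro t ht htu
  have h1 := hsuff t ht htu
  rw [← hx i hi] at h1
  rw [← h1]
  simp

theorem exists_region_jump [T2Space S] (M : DiskModel D U n a b W) {i : ℕ} (hi : i < n)
    {t : unitInterval} (ht : t ∈ Ioo (a i) (b i)) (hinj : ∀ s, D.curve s = D.curve t → s = t)
    {e : OpenPartialHomeomorph S Plane} (he : IsOrientedChart e)
    (het : StraightAt D.curve e t (1, 0)) :
    ∃ g ∈ compatible X Y, ∀ᶠ z in 𝓝 (0 : Plane),
      (0 < z.2 → holonomy Y x W n (e.symm z)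
        = operator Y ((holonomy Y x W i (D.curve t)).1 (x i)) * g) ∧
      (z.2 < 0 → holonomy Y x W n (e.symm z) = g) := by
  refine M.exists_holonomy_jump hi le_rfl ht (fun s _ => hinj s) (fun j hj hji => ?_) he het
  rintro ⟨s, hs, hst⟩
  obtain rfl := hinj s hst
  exact hji (M.eq_of_mem hj hi hs (Ioo_subset_Icc_self ht))

/-- The colors of the regions are the values of the holonomy. -/
theorem region_eq [T2Space S] (M : DiskModel D U n a b W) (h : IsColoring D F G)
    (hx : ∀ i < n, x i = (holonomy Y x W i (D.curve (a i)))⁻¹.1 (F (a i)))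
    {p₀ : S} (hp₀ : p₀ ∈ closure U) (hp₀r : p₀ ∉ range D.curve) :
    ∀ p ∈ U, p ∉ range D.curve →
      G p = (holonomy Y x W n p).2 ((holonomy Y x W n p₀)⁻¹.2 (G p₀)) := by
  have hcol := M.color_eq h hx
  have hoff : ∀ p ∈ closure U, p ∉ range D.curve → ∀ᶠ q in 𝓝 p,
      (holonomy Y x W n q)⁻¹.2 (G q) = (holonomy Y x W n p)⁻¹.2 (G p) := by
    intro p hp hpr
    filter_upwards [h.region_eq p hpr, M.eventually_holonomy_eq (Y := Y) (x := x) le_rfl hp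
      fun k _ hk => hpr (image_subset_range _ _ hk)] with q hq hq2
    rw [hq, hq2]
  -- Without the finitely many double points the disk is still connected, and any two regions in it
  -- can be compared across simple points of strands alone.
  set Z : Set S := D.curve '' {t | ∃ s, s ≠ t ∧ D.curve s = D.curve t} with hZ
  have hZf : Z.Finite := D.finite_double.image _
  have hUZ : IsOpen (U \ Z) := M.isOpen.sdiff hZf.isClosed
  have hmem : ∀ p ∈ U, p ∉ range D.curve → p ∈ U \ Z := fun p hp hpr =>
    ⟨hp, fun hpZ => hpr (image_subset_range _ _ hpZ)⟩
  have hsingle : ∀ t, D.curve t ∈ U \ Z → ∀ s, D.curve s = D.curve t → s = t := by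
    intro t ht s hst
    by_contra hne
    exact ht.2 ⟨t, ⟨s, hne, hst⟩, rfl⟩
  have hconst : ∀ p ∈ U, p ∉ range D.curve → ∀ q ∈ U, q ∉ range D.curve →
      (holonomy Y x W n p)⁻¹.2 (G p) = (holonomy Y x W n q)⁻¹.2 (G q) := by
    intro p hp hpr q hq hqr
    refine eq_of_isPreconnected_of_dense (p := fun p => p ∉ range D.curve)
      (f := fun p => (holonomy Y x W n p)⁻¹.2 (G p)) (M.isPreconnected Z hZf) (fun r hr => ?_)
      (fun r hr => ?_) (hmem p hp hpr) (hmem q hq hqr) hpr hqr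
    · rw [nhdsWithin_eq_nhds.2 (hUZ.mem_nhds hr)]
      by_cases hrr : r ∈ range D.curve
      · obtain ⟨t, rfl⟩ := hrr
        obtain ⟨e, he, het⟩ := D.immersion t
        exact het.frequently_notMem_range (hsingle t hr)
      · exact (frequently_pure.2 hrr : ∃ᶠ v in pure r, v ∉ range D.curve).filter_mono
          (pure_le_nhds r)
    · rw [nhdsWithin_eq_nhds.2 (hUZ.mem_nhds hr)]
      by_cases hrr : r ∈ range D.curve
      · obtain ⟨t, rfl⟩ := hrr
        obtain ⟨e, he, het⟩ := D.immersion t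
        obtain ⟨i, hi, ht⟩ := (M.mem_iff t).1 hr.1
        have hinj := hsingle t hr
        have h0 : t ≠ 0 := (unitInterval.nonneg'.trans_lt ht.1).ne'
        have h1 : t ≠ 1 := (ht.2.trans_le unitInterval.le_one').ne
        obtain ⟨g, -, hg⟩ := M.exists_region_jump (Y := Y) (x := x) hi ht hinj he het
        obtain ⟨y₁, y₂, hy12, hy⟩ := h.exists_side_values h0 h1 hinj he het
        have hFt := hcol i hi t (Ioo_subset_Icc_self ht) (notMem_under_of_forall hinj)
        refine ⟨g⁻¹.2 y₂, ?_⟩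
        have hte : Tendsto e (𝓝 (D.curve t)) (𝓝 0) := by
          have := (e.continuousAt het.1).tendsto
          rwa [het.apply_eq] at this
        filter_upwards [hte.eventually hg, hte.eventually hy,
          hte.eventually (het.eventually_mem_range h0 h1), e.open_source.mem_nhds het.1]
          with q hq1 hq2 hq3 hqs hqr
        rw [e.left_inv hqs] at hq1 hq2 hq3
        have hne : (e q).2 ≠ 0 := fun h => hqr (hq3 h)
        rcases hne.lt_or_gt with hlt | hlt
        · rw [hq1.2 hlt, hq2.2 hlt]
        · rw [hq1.1 hlt, hq2.1 hlt, ← hy12, hFt]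
          rw [← operator_snd (Y := Y), mul_inv_rev, Prod.snd_mul, Equiv.Perm.mul_apply,
            Prod.snd_inv, Prod.snd_inv]
          exact congrArg _ (Equiv.symm_apply_apply _ _)
      · exact ⟨_, (hoff r (subset_closure hr.1) hrr).mono fun q hq _ => hq⟩
  intro p hp hpr
  -- The base point may lie on the boundary of `U`; the corrected color is locally constant there
  -- too, so `p₀` may be replaced by a nearby point of `U`.
  have h1 : (holonomy Y x W n p)⁻¹.2 (G p) = (holonomy Y x W n p₀)⁻¹.2 (G p₀) := by
    obtain ⟨q, hqU, hq1, hq2⟩ := ((mem_closure_iff_frequently.1 hp₀).and_eventually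
      ((hoff p₀ hp₀ hp₀r).and (D.isClosed_range.isOpen_compl.mem_nhds hp₀r))).exists
    rw [← hq1]
    exact hconst p hp hpr q hqU hq2
  rw [← h1]
  simp

end DiskModel

end Diagrams

/-! ### Transfer of colorings between two diagrams that differ in a disk. -/

section Diagrams

variable {S : Type*} [TopologicalSpace S] [ChartedSpace Plane S]

open KnotoidDiagram

/-- The diagrams `D` and `D'` and their index functions `W` and `W'` agree outside `U`. -/
structure AgreeOutside (D D' : KnotoidDiagram S) (U : Set S) (n : ℕ) (a b : ℕ → unitInterval)
    (W W' : ℕ → S → ℤ) : Prop where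
  curve_eq : ∀ t, (∀ i < n, t ∉ Ioo (a i) (b i)) → ∀ᶠ v in 𝓝 t, D'.curve v = D.curve v
  under_iff : ∀ t, (∀ i < n, t ∉ Ioo (a i) (b i)) → (t ∈ D'.under ↔ t ∈ D.under)
  index_eq : ∀ i < n, ∀ p ∈ frontier U, ∀ᶠ q in 𝓝 p, W' i q = W i q

namespace AgreeOutside

variable {D D' : KnotoidDiagram S} {U : Set S} {n : ℕ} {a b : ℕ → unitInterval} {W W' : ℕ → S → ℤ}

theorem symm (A : AgreeOutside D D' U n a b W W') : AgreeOutside D' D U n a b W' W where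
  curve_eq t ht := (A.curve_eq t ht).mono fun _ h => h.symm
  under_iff t ht := (A.under_iff t ht).symm
  index_eq i hi p hp := (A.index_eq i hi p hp).mono fun _ h => h.symm

/-- The parameters at which the curves differ have their closure in the open strand intervals, so
the corresponding part of `D'` is a compact subset of `U` and stays away from `p`. -/
theorem eventually_mem_range [T2Space S] (A : AgreeOutside D D' U n a b W W')
    (M' : DiskModel D' U n a b W') {p : S} (hp : p ∉ U) :
    ∀ᶠ q in 𝓝 p, q ∈ range D'.curve → q ∈ range D.curve := by
  have hT : closure {t | D'.curve t ≠ D.curve t} ⊆ {t | ∃ i < n, t ∈ Ioo (a i) (b i)} := by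
    intro t ht
    simp only [mem_ofPred_eq]
    by_contra hcon
    push Not at hcon
    obtain ⟨v, hv1, hv2⟩ :=
      ((mem_closure_iff_frequently.1 ht).and_eventually (A.curve_eq t hcon)).exists
    exact hv1 hv2
  have hcl : IsClosed (D'.curve '' closure {t | D'.curve t ≠ D.curve t}) :=
    (isClosed_closure.isCompact.image D'.curve.continuous).isClosed
  have hpn : p ∉ D'.curve '' closure {t | D'.curve t ≠ D.curve t} := by
    rintro ⟨t, ht, rfl⟩
    exact hp ((M'.mem_iff t).2 (hT ht))
  filter_upwards [hcl.isOpen_compl.mem_nhds hpn] with q hq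
  rintro ⟨t, rfl⟩
  by_cases h : D'.curve t = D.curve t
  · exact ⟨t, h.symm⟩
  · exact absurd ⟨t, subset_closure h, rfl⟩ hq

end AgreeOutside

namespace DiskModel

variable {D D' : KnotoidDiagram S} {U : Set S} {n : ℕ} {a b : ℕ → unitInterval} {W W' : ℕ → S → ℤ}
  {X Y : Type*} [Quandle X] [QuandleSet X Y] {F : unitInterval → X} {G : S → Y}

/-- Keep the coloring outside `U` and put the holonomy formula of `D'` inside, with the base
elements `x` and the constant `y₀` of the old coloring. Inside `U` the coloring conditions are the
jumps of the holonomy. Near points outside `U` old and new values coincide, because the old ones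
obey the same formula and the index functions agree there. -/
theorem exists_transfer [T2Space S] (M : DiskModel D U n a b W) (M' : DiskModel D' U n a b W')
    (A : AgreeOutside D D' U n a b W W') {p₀ : S} (hp₀ : p₀ ∈ closure U)
    (hp₀r : p₀ ∉ range D.curve) (h : IsColoring D F G) :
    ∃ (F' : unitInterval → X) (G' : S → Y), IsColoring D' F' G' ∧
      (∀ t, (∀ i < n, t ∉ Ioo (a i) (b i)) → F' t = F t) ∧ ∀ p ∉ U, G' p = G p := by
  classical
  set x : ℕ → X := baseColor Y W (fun i => D.curve (a i)) fun i => F (a i) with hxdef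
  have hx : ∀ i < n, x i = (holonomy Y x W i (D.curve (a i)))⁻¹.1 (F (a i)) := fun i _ =>
    baseColor_eq W (fun i => D.curve (a i)) (fun i => F (a i)) i
  have hcol := M.color_eq h hx
  have hreg := M.region_eq h hx hp₀ hp₀r
  set y₀ : Y := (holonomy Y x W n p₀)⁻¹.2 (G p₀)
  -- The strand index chosen here is unique, since the strand intervals are disjoint.
  let F' : unitInterval → X := fun t => if ht : ∃ i < n, t ∈ Ioo (a i) (b i) then
    (holonomy Y x W' ht.choose (D'.curve t)).1 (x ht.choose) else F t
  let G' : S → Y := fun p => if p ∈ U then (holonomy Y x W' n p).2 y₀ else G p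
  have hF'i : ∀ i < n, ∀ t ∈ Ioo (a i) (b i), F' t = (holonomy Y x W' i (D'.curve t)).1 (x i) := by
    intro i hi t ht
    have hex : ∃ i < n, t ∈ Ioo (a i) (b i) := ⟨i, hi, ht⟩
    have hch : hex.choose = i := M.eq_of_mem hex.choose_spec.1 hi
      (Ioo_subset_Icc_self hex.choose_spec.2) (Ioo_subset_Icc_self ht)
    simp only [F', dif_pos hex, hch]
  have hF'o : ∀ t, (∀ i < n, t ∉ Ioo (a i) (b i)) → F' t = F t := by
    intro t ht
    refine dif_neg ?_
    push Not
    exact ht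
  have hG'i : ∀ p ∈ U, G' p = (holonomy Y x W' n p).2 y₀ := fun p hp => if_pos hp
  have hG'o : ∀ p ∉ U, G' p = G p := fun p hp => if_neg hp
  have hout : ∀ t, D.curve t ∉ U ↔ ∀ i < n, t ∉ Ioo (a i) (b i) := by
    intro t
    rw [M.mem_iff]
    push Not
    rfl
  have hout' : ∀ t, D'.curve t ∉ U ↔ ∀ i < n, t ∉ Ioo (a i) (b i) := by
    intro t
    rw [M'.mem_iff]
    push Not
    rfl
  have hWev : ∀ p ∉ U, ∀ᶠ q in 𝓝 p, q ∈ U → ∀ i < n, W' i q = W i q := by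
    intro p hp
    by_cases hpc : p ∈ closure U
    · have hpf : p ∈ frontier U := ⟨hpc, fun h => hp (interior_subset h)⟩
      have := (Finset.eventually_all (Finset.range n)).2 fun i hi =>
        A.index_eq i (Finset.mem_range.1 hi) p hpf
      filter_upwards [this] with q hq _ i hi
      exact hq i (Finset.mem_range.2 hi)
    · filter_upwards [isClosed_closure.isOpen_compl.mem_nhds hpc] with q hq hqU
      exact absurd (subset_closure hqU) hq
  -- At the end of a strand nearby parameters may lie inside `U`; there `color_eq` writes the old
  -- color by the formula that defines the new one.
  have hF'ev : ∀ t, (∀ i < n, t ∉ Ioo (a i) (b i)) → ∀ᶠ v in 𝓝 t, v ∉ D.under → F' v = F v := by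
    intro t ht
    filter_upwards [A.curve_eq t ht,
      D.curve.continuous.continuousAt.eventually (hWev _ ((hout t).2 ht))] with v hv hvW hvu
    by_cases hvo : ∀ i < n, v ∉ Ioo (a i) (b i)
    · exact hF'o v hvo
    · push Not at hvo
      obtain ⟨i, hi, hvi⟩ := hvo
      rw [hF'i i hi v hvi, hcol i hi v (Ioo_subset_Icc_self hvi) hvu, hv]
      congr 2
      exact holonomy_congr (fun _ _ => rfl) fun k hk =>
        hvW ((M.mem_iff v).2 ⟨i, hi, hvi⟩) k (hk.trans hi)
  have hrange : ∀ p ∉ U, ∀ᶠ q in 𝓝 p, q ∉ range D'.curve → q ∉ range D.curve := fun p hp =>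
    (A.symm.eventually_mem_range M hp).mono fun q hq h1 h2 => h1 (hq h2)
  have hG'ev : ∀ p ∉ U, ∀ᶠ q in 𝓝 p, q ∉ range D'.curve → G' q = G q := by
    intro p hp
    filter_upwards [hWev p hp, hrange p hp] with q hqW hqr hqr'
    by_cases hqU : q ∈ U
    · rw [hG'i q hqU, hreg q hqU (hqr hqr')]
      congr 2
      exact holonomy_congr (fun _ _ => rfl) fun k hk => hqW hqU k hk
    · exact hG'o q hqU
  have hcurve : ∀ t, (∀ i < n, t ∉ Ioo (a i) (b i)) → D'.curve t = D.curve t := fun t ht =>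
    (A.curve_eq t ht).self_of_nhds
  have hF'near : ∀ i < n, ∀ t ∈ Ioo (a i) (b i),
      (∀ k < i, D'.curve t ∉ D'.curve '' Icc (a k) (b k)) →
      ∀ᶠ v in 𝓝 t, F' v = (holonomy Y x W' i (D'.curve t)).1 (x i) := by
    intro i hi t ht hn
    have := D'.curve.continuous.continuousAt.eventually (M'.eventually_holonomy_eq (Y := Y) (x := x)
      hi.le (M'.mem_closure hi (Ioo_subset_Icc_self ht)) hn)
    filter_upwards [this, Ioo_mem_nhds ht.1 ht.2] with v hv hvi
    rw [hF'i i hi v hvi, hv]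
  refine ⟨F', G', ⟨?_, ?_, ?_, ?_, ?_⟩, hF'o, hG'o⟩
  · intro t ht
    by_cases hto : ∀ i < n, t ∉ Ioo (a i) (b i)
    · have htu : t ∉ D.under := fun h => ht ((A.under_iff t hto).2 h)
      filter_upwards [hF'ev t hto, h.arc_eq t htu, eventually_notMem_under_of_notMem htu]
        with v hv hv2 hv3
      rw [hv hv3, hv2, hF'o t hto]
    · push Not at hto
      obtain ⟨i, hi, hti⟩ := hto
      have h1 := hF'near i hi t hti (M'.notMem_image hi (Ioo_subset_Icc_self hti) ht)
      rw [hF'i i hi t hti]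
      exact h1
  · intro p hp
    by_cases hpU : p ∈ U
    · filter_upwards [M'.isOpen.mem_nhds hpU, M'.eventually_holonomy_eq (Y := Y) (x := x) le_rfl
        (subset_closure hpU) fun k _ hk => hp (image_subset_range _ _ hk)] with q hq hq2
      rw [hG'i q hq, hG'i p hpU, hq2]
    · filter_upwards [hG'ev p hpU, D'.isClosed_range.isOpen_compl.mem_nhds hp,
        h.region_eq p ((hrange p hpU).self_of_nhds hp)] with q hq hq2 hq3
      rw [hq hq2, hq3, hG'o p hpU]
  · intro s t hst htu hcur e ε he hε hes het x₁ x₂ hx12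
    obtain ⟨h0, h1⟩ := ne_endpoint_of_mem_under htu
    obtain ⟨hl, hr⟩ := frequently_sides h0 h1 hε
    by_cases hto : ∀ i < n, t ∉ Ioo (a i) (b i)
    · have hso : ∀ i < n, s ∉ Ioo (a i) (b i) := by
        rw [← hout', hcur, hout']
        exact hto
      rw [hF'o s hso]
      refine h.crossing s t hst ((A.under_iff t hto).1 htu) ?_ e ε he hε
        (hes.congr (A.symm.curve_eq s hso)) (het.congr (A.symm.curve_eq t hto)) x₁ x₂ ?_
      · rw [← hcurve s hso, ← hcurve t hto, hcur]
      · have hun := D.eventually_notMem_under t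
        rw [eventually_nhdsWithin_iff] at hun
        filter_upwards [hx12, hF'ev t hto, hun] with v hv hv2 hv3
        have hvt : ε * ((v : ℝ) - t) ≠ 0 → v ∉ D.under := fun h => hv3 (by rintro rfl; simp at h)
        refine ⟨fun hlt => ?_, fun hlt => ?_⟩
        · rw [← hv2 (hvt hlt.ne), hv.1 hlt]
        · rw [← hv2 (hvt hlt.ne'), hv.2 hlt]
    · push Not at hto
      obtain ⟨i, hi, hti⟩ := hto
      obtain ⟨k, hk, hsk⟩ := (M'.mem_iff s).1 (hcur ▸ (M'.mem_iff t).2 ⟨i, hi, hti⟩)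
      have hsu : s ∉ D'.under := notMem_under_of_curve_eq htu hst hcur
      -- At a self-crossing the formula gives the same element to the over-strand and to both
      -- under-arcs, and `x ◃ x = x` is all that is required. At any other crossing the relation is
      -- the jump of the holonomy.
      rcases eq_or_ne k i with rfl | hki
      · have hn := M'.notMem_image hi (Ioo_subset_Icc_self hsk) hsu
        rw [hcur] at hn
        have h2 := hx12.and (hF'near k hi t hti hn)
        obtain ⟨v, hv, hv1, hv2⟩ := (hl.and_eventually h2).exists
        obtain ⟨w, hw, hw1, hw2⟩ := (hr.and_eventually h2).exists
        rw [← hv1.1 hv, ← hw1.2 hw, hv2, hw2, hF'i k hi s hsk, hcur, Quandle.fix]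
      · have hki' : k < i := (M'.under_iff i hi k hk hki.symm t hti s hsk hcur.symm).1 htu
        obtain ⟨g, -, hg⟩ := M'.exists_holonomy_jump_under (Y := Y) (x := x) hki' hi hsk hti hcur he
          hes het
        have h2 := hx12.and (hg.and (Ioo_mem_nhds hti.1 hti.2))
        obtain ⟨v, hv, hv1, hv2, hv3⟩ := (hl.and_eventually h2).exists
        obtain ⟨w, hw, hw1, hw2, hw3⟩ := (hr.and_eventually h2).exists
        rw [← hv1.1 hv, ← hw1.2 hw, hF'i i hi v hv3, hF'i i hi w hw3, hv2.2 hv, hw2.1 hw,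
          hF'i k hk s hsk]
        rfl
  · intro t h0 h1 hinj e he het
    have hoff : ∀ σ : ℝ, σ ≠ 0 → ∀ᶠ y in 𝓝[>] (0 : ℝ), e.symm (0, σ * y) ∉ range D'.curve := by
      intro σ hσ
      filter_upwards [tendsto_vertical.eventually (het.eventually_eq isClosed_univ
        fun s _ => hinj s), self_mem_nhdsWithin] with y hy (hy0 : 0 < y)
      rintro ⟨v, hv⟩
      have := congrArg Prod.snd (hy v (mem_univ v) hv)
      simp only [Prod.smul_snd, smul_zero, mul_eq_zero] at this
      rcases this with h | h
      · exact hσ h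
      · exact hy0.ne' h
    have hoff1 := hoff 1 one_ne_zero
    have hoff2 := hoff (-1) (by norm_num)
    simp only [one_mul, neg_one_mul] at hoff1 hoff2
    have hlim1 : Tendsto (fun y : ℝ => e.symm (0, y)) (𝓝[>] 0) (𝓝 (D'.curve t)) := by
      simpa [Function.comp_def] using het.tendsto.comp (tendsto_vertical (σ := 1))
    have hlim2 : Tendsto (fun y : ℝ => e.symm (0, -y)) (𝓝[>] 0) (𝓝 (D'.curve t)) := by
      simpa [Function.comp_def] using het.tendsto.comp (tendsto_vertical (σ := -1))
    by_cases hto : ∀ i < n, t ∉ Ioo (a i) (b i)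
    · have hinjD : ∀ v, D.curve v = D.curve t → v = t := by
        intro v hv
        have hvo : ∀ i < n, v ∉ Ioo (a i) (b i) := by
          rw [← hout, hv, hout]
          exact hto
        exact hinj v (by rw [hcurve v hvo, hcurve t hto, hv])
      have hG := hG'ev _ ((hout' t).2 hto)
      filter_upwards [h.side t h0 h1 hinjD e he (het.congr (A.symm.curve_eq t hto)), hoff1, hoff2,
        hlim1.eventually hG, hlim2.eventually hG] with y hy hy1 hy2 hy3 hy4
      rw [hy3 hy1, hy4 hy2, hF'o t hto, hy]
    · push Not at hto
      obtain ⟨i, hi, hti⟩ := hto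
      obtain ⟨g, -, hg⟩ := M'.exists_region_jump (Y := Y) (x := x) hi hti hinj he het
      have hup := (tendsto_vertical (σ := 1)).eventually hg
      have hdn := (tendsto_vertical (σ := -1)).eventually hg
      simp only [one_mul, neg_one_mul] at hup hdn
      have hU := M'.isOpen.mem_nhds ((M'.mem_iff t).2 ⟨i, hi, hti⟩)
      filter_upwards [hup, hdn, hlim1 hU, hlim2 hU, self_mem_nhdsWithin]
        with y hy1 hy2 hy3 hy4 (hy0 : 0 < y)
      rw [hG'i _ hy3, hG'i _ hy4, hF'i i hi t hti, hy1.1 hy0, hy2.2 (neg_lt_zero.2 hy0)]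
      rfl
  · intro t ht
    have hto : ∀ i < n, t ∉ Ioo (a i) (b i) := by
      rintro i hi hti
      rcases ht with rfl | rfl
      · exact hti.1.not_ge unitInterval.nonneg'
      · exact hti.2.not_ge unitInterval.le_one'
    have hU := (hout' t).2 hto
    have hend := h.endpoint t ht
    rw [← hcurve t hto] at hend
    filter_upwards [hend, hrange _ hU, hG'ev _ hU] with q hq hq2 hq3 hq4
    rw [hq3 hq4, hF'o t hto, hq (hq2 hq4)]

/-- A coloring is determined outside `U`. -/
theorem coloring_ext [T2Space S] (M : DiskModel D U n a b W) {p₀ : S} (hp₀ : p₀ ∈ closure U)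
    (hp₀U : p₀ ∉ U) (hp₀r : p₀ ∉ range D.curve) {F' : unitInterval → X} {G' : S → Y}
    (h : IsColoring D F G) (h' : IsColoring D F' G')
    (hF : ∀ t, (∀ i < n, t ∉ Ioo (a i) (b i)) → t ∉ D.under → F t = F' t)
    (hG : ∀ p ∉ U, p ∉ range D.curve → G p = G' p) :
    (∀ t ∉ D.under, F t = F' t) ∧ ∀ p ∉ range D.curve, G p = G' p := by
  -- Equality is needed for every index, also beyond `n`, so that the two colorings have literally
  -- the same `baseColor`.
  have hFa : (fun i => F (a i)) = fun i => F' (a i) := by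
    funext i
    refine hF _ (fun j hj hij => M.left_notMem i ((M.mem_iff _).2 ⟨j, hj, hij⟩)) ?_
    exact notMem_under_of_forall (M.left_end i)
  set x : ℕ → X := baseColor Y W (fun i => D.curve (a i)) fun i => F (a i) with hxdef
  have hx : ∀ i < n, x i = (holonomy Y x W i (D.curve (a i)))⁻¹.1 (F (a i)) := fun i _ =>
    baseColor_eq W (fun i => D.curve (a i)) (fun i => F (a i)) i
  have hx' : ∀ i < n, x i = (holonomy Y x W i (D.curve (a i)))⁻¹.1 (F' (a i)) := fun i hi =>
    (hx i hi).trans (by rw [congrFun hFa i])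
  refine ⟨fun t ht => ?_, fun p hp => ?_⟩
  · by_cases hto : ∀ i < n, t ∉ Ioo (a i) (b i)
    · exact hF t hto ht
    · push Not at hto
      obtain ⟨i, hi, hti⟩ := hto
      rw [M.color_eq h hx i hi t (Ioo_subset_Icc_self hti) ht,
        M.color_eq h' hx' i hi t (Ioo_subset_Icc_self hti) ht]
  · by_cases hpU : p ∈ U
    · rw [M.region_eq h hx hp₀ hp₀r p hpU hp, M.region_eq h' hx' hp₀ hp₀r p hpU hp,
        hG p₀ hp₀U hp₀r]
    · exact hG p hpU hp

/-- Transfer leaves the values outside `U` alone and these determine a coloring, which gives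
injectivity. For surjectivity, transfer a coloring of `D'` back to `D` and forth again. -/
theorem nonempty_equiv [T2Space S] (M : DiskModel D U n a b W) (M' : DiskModel D' U n a b W')
    (A : AgreeOutside D D' U n a b W W') {p₀ : S} (hp₀ : p₀ ∈ closure U) (hp₀U : p₀ ∉ U)
    (hp₀r : p₀ ∉ range D.curve) : Nonempty (Coloring X Y D ≃ Coloring X Y D') := by
  have hr' : ∀ p ∉ U, p ∉ range D'.curve → p ∉ range D.curve := fun p hp h1 h2 =>
    h1 ((A.symm.eventually_mem_range M hp).self_of_nhds h2)
  have hr : ∀ p ∉ U, p ∉ range D.curve → p ∉ range D'.curve := fun p hp h1 h2 =>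
    h1 ((A.eventually_mem_range M' hp).self_of_nhds h2)
  have hp₀r' := hr p₀ hp₀U hp₀r
  have hex : ∀ c : Coloring X Y D, ∃ c' : Coloring X Y D', ∃ F G F' G', IsColoring D F G ∧
      IsColoring D' F' G' ∧ c.Represents F G ∧ c'.Represents F' G' ∧
      (∀ t, (∀ i < n, t ∉ Ioo (a i) (b i)) → F' t = F t) ∧ ∀ p ∉ U, G' p = G p := by
    intro c
    obtain ⟨F, G, h, hc⟩ := c.exists_represents
    obtain ⟨F', G', h', hF, hG⟩ := M.exists_transfer M' A hp₀ hp₀r h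
    obtain ⟨c', hc'⟩ := h'.exists_coloring
    exact ⟨c', F, G, F', G', h, h', hc, hc', hF, hG⟩
  choose f hf using hex
  refine ⟨Equiv.ofBijective f ⟨fun c₁ c₂ hc => ?_, fun c' => ?_⟩⟩
  · obtain ⟨F₁, G₁, F₁', G₁', h₁, h₁', hr₁, hr₁', hF₁, hG₁⟩ := hf c₁
    obtain ⟨F₂, G₂, F₂', G₂', h₂, h₂', hr₂, hr₂', hF₂, hG₂⟩ := hf c₂
    rw [← hc] at hr₂'
    obtain ⟨e1, e2⟩ := M.coloring_ext hp₀ hp₀U hp₀r h₁ h₂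
      (fun t ht htu => by
        have htu' : t ∉ D'.under := fun h => htu ((A.under_iff t ht).1 h)
        rw [← hF₁ t ht, ← hF₂ t ht, hr₁'.1 t htu', hr₂'.1 t htu'])
      (fun p hp hpr => by
        have hpr' := hr p hp hpr
        rw [← hG₁ p hp, ← hG₂ p hp, hr₁'.2 p hpr', hr₂'.2 p hpr'])
    exact hr₁.ext hr₂ e1 e2
  · obtain ⟨F₀, G₀, h₀, hr₀⟩ := c'.exists_represents
    obtain ⟨F₁, G₁, h₁, hF₁, hG₁⟩ := M'.exists_transfer M A.symm hp₀ hp₀r' h₀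
    obtain ⟨c, hc⟩ := h₁.exists_coloring
    refine ⟨c, ?_⟩
    obtain ⟨F, G, F', G', h, h', hcr, hcr', hF, hG⟩ := hf c
    obtain ⟨e1, e2⟩ := M'.coloring_ext hp₀ hp₀U hp₀r' h' h₀
      (fun t ht htu => by
        have htu' : t ∉ D.under := fun h => htu ((A.under_iff t ht).2 h)
        rw [hF t ht, ← hF₁ t ht, hcr.1 t htu', hc.1 t htu'])
      (fun p hp hpr => by
        have hpr' := hr' p hp hpr
        rw [hG p hp, ← hG₁ p hp, hcr.2 p hpr', hc.2 p hpr'])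
    exact hcr'.ext hr₀ e1 e2

end DiskModel

end Diagrams

/-! ### Orientation preserving maps of the plane -/

theorem det_eq (A : Plane →L[ℝ] Plane) :
    A.det = (A (1, 0)).1 * (A (0, 1)).2 - (A (0, 1)).1 * (A (1, 0)).2 := by
  rw [ContinuousLinearMap.det, ← LinearMap.det_toMatrix (Module.Basis.finTwoProd ℝ),
    Matrix.det_fin_two]
  simp [LinearMap.toMatrix_apply]

/-- A map of the plane that is smooth near a point, with positive Jacobian determinant there. -/
def OrientedAt (φ : Plane → Plane) (z : Plane) : Prop :=
  ContDiffAt ℝ ∞ φ z ∧ 0 < (fderiv ℝ φ z).det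

namespace OrientedAt

variable {φ ψ : Plane → Plane} {z : Plane}

theorem differentiableAt (h : OrientedAt φ z) : DifferentiableAt ℝ φ z :=
  h.1.differentiableAt (by simp)

theorem congr (h : OrientedAt φ z) (hψ : ψ =ᶠ[𝓝 z] φ) : OrientedAt ψ z :=
  ⟨h.1.congr_of_eventuallyEq hψ, by rw [hψ.fderiv_eq]; exact h.2⟩

theorem comp (hψ : OrientedAt ψ (φ z)) (hφ : OrientedAt φ z) : OrientedAt (ψ ∘ φ) z := by
  refine ⟨hψ.1.comp z hφ.1, ?_⟩
  rw [fderiv_comp z hψ.differentiableAt hφ.differentiableAt]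
  have h3 : ((fderiv ℝ ψ (φ z)).comp (fderiv ℝ φ z)).det
      = (fderiv ℝ ψ (φ z)).det * (fderiv ℝ φ z).det := by
    simp [ContinuousLinearMap.det, LinearMap.det_comp]
  rw [h3]
  exact mul_pos hψ.2 hφ.2

theorem of_mem_groupoid {T : OpenPartialHomeomorph Plane Plane} (hT : T ∈ orientedGroupoid)
    (hz : z ∈ T.source) : OrientedAt T z := by
  have h := (mem_groupoid_of_pregroupoid.1 hT).1
  exact ⟨h.1.contDiffAt (T.open_source.mem_nhds hz), h.2 z hz⟩

/-- The columns of the Jacobian matrix are `(p, q)` and `(r, s)`. The derivatives are strict so that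
the inverse function theorem can be applied to one coordinate. -/
theorem exists_hasStrictDerivAt {x₀ y₀ : ℝ} (h : OrientedAt φ (x₀, y₀)) : ∃ p q r s : ℝ,
    HasStrictDerivAt (fun x => (φ (x, y₀)).1) p x₀ ∧ HasStrictDerivAt (fun x => (φ (x, y₀)).2) q x₀ ∧
    HasStrictDerivAt (fun y => (φ (x₀, y)).1) r y₀ ∧ HasStrictDerivAt (fun y => (φ (x₀, y)).2) s y₀ ∧
    0 < p * s - r * q := by
  have hφ : HasStrictFDerivAt φ (fderiv ℝ φ (x₀, y₀)) (x₀, y₀) := h.1.hasStrictFDerivAt (by simp)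
  have hx : HasStrictDerivAt (fun x : ℝ => ((x, y₀) : Plane)) (1, 0) x₀ :=
    (hasStrictDerivAt_id x₀).prodMk (hasStrictDerivAt_const x₀ y₀)
  have hy : HasStrictDerivAt (fun y : ℝ => ((x₀, y) : Plane)) (0, 1) y₀ :=
    (hasStrictDerivAt_const y₀ x₀).prodMk (hasStrictDerivAt_id y₀)
  have h1 := hφ.comp_hasStrictDerivAt x₀ hx
  have h2 := hφ.comp_hasStrictDerivAt y₀ hy
  have hd := h.2
  rw [det_eq] at hd
  exact ⟨_, _, _, _,
    (ContinuousLinearMap.fst ℝ ℝ ℝ).hasStrictFDerivAt.comp_hasStrictDerivAt x₀ h1,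
    (ContinuousLinearMap.snd ℝ ℝ ℝ).hasStrictFDerivAt.comp_hasStrictDerivAt x₀ h1,
    (ContinuousLinearMap.fst ℝ ℝ ℝ).hasStrictFDerivAt.comp_hasStrictDerivAt y₀ h2,
    (ContinuousLinearMap.snd ℝ ℝ ℝ).hasStrictFDerivAt.comp_hasStrictDerivAt y₀ h2, hd⟩

end OrientedAt

theorem eventually_lt_of_hasDerivAt_pos {f : ℝ → ℝ} {c a : ℝ} (h : HasDerivAt f c a) (hc : 0 < c) :
    ∀ᶠ y in 𝓝 a, (a < y → f a < f y) ∧ (y < a → f y < f a) := by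
  have h1 := (hasDerivAt_iff_tendsto_slope.1 h).eventually (lt_mem_nhds hc)
  rw [eventually_nhdsWithin_iff] at h1
  filter_upwards [h1] with y hy
  refine ⟨fun hlt => ?_, fun hlt => ?_⟩
  · have := hy (ne_of_gt hlt)
    rw [slope_def_field, div_pos_iff] at this
    rcases this with h | h <;> linarith [h.1, h.2]
  · have := hy (ne_of_lt hlt)
    rw [slope_def_field, div_pos_iff] at this
    rcases this with h | h <;> linarith [h.1, h.2]

theorem eventually_lt_of_hasDerivAt_neg {f : ℝ → ℝ} {c a : ℝ} (h : HasDerivAt f c a) (hc : c < 0) :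
    ∀ᶠ y in 𝓝 a, (a < y → f y < f a) ∧ (y < a → f a < f y) :=
  (eventually_lt_of_hasDerivAt_pos h.neg (neg_pos.2 hc)).mono fun _ hy =>
    ⟨fun h => neg_lt_neg_iff.1 (hy.1 h), fun h => neg_lt_neg_iff.1 (hy.2 h)⟩

/-- If an orientation preserving map carries the positive direction of the first axis to itself, it
carries the positive direction of the second axis to the upper side of the first axis. -/
theorem OrientedAt.eventually_snd_sign {T : Plane → Plane} (h : OrientedAt T 0) (h0 : T 0 = 0)
    (haxis : ∃ᶠ x in 𝓝[>] (0 : ℝ), 0 ≤ (T (x, 0)).1 ∧ (T (x, 0)).2 = 0) :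
    ∀ᶠ y in 𝓝 (0 : ℝ), (0 < y → 0 < (T (0, y)).2) ∧ (y < 0 → (T (0, y)).2 < 0) := by
  obtain ⟨p, q, r, s, hp, hq, -, hs, hd⟩ := exists_hasStrictDerivAt (x₀ := 0) (y₀ := 0) h
  have h00 : T (0, 0) = 0 := h0
  -- The image of the axis returns to the axis at arbitrarily small `x > 0`, on its nonnegative
  -- half. So the first column is `(p, 0)` with `p ≥ 0`, and a positive determinant forces `s > 0`.
  have hq0 : q = 0 := by
    by_contra hne
    rcases lt_or_gt_of_ne hne with hlt | hlt
    · obtain ⟨x, ⟨hx1, hx2⟩, hx3, hx4⟩ := (haxis.and_eventually ((eventually_nhdsWithin_of_eventually_nhds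
        (eventually_lt_of_hasDerivAt_neg hq.hasDerivAt hlt)).and self_mem_nhdsWithin)).exists
      have := hx3.1 hx4
      rw [h00, hx2] at this
      exact lt_irrefl _ this
    · obtain ⟨x, ⟨hx1, hx2⟩, hx3, hx4⟩ := (haxis.and_eventually ((eventually_nhdsWithin_of_eventually_nhds
        (eventually_lt_of_hasDerivAt_pos hq.hasDerivAt hlt)).and self_mem_nhdsWithin)).exists
      have := hx3.1 hx4
      rw [h00, hx2] at this
      exact lt_irrefl _ this
  have hp0 : 0 ≤ p := by
    by_contra! hlt
    obtain ⟨x, ⟨hx1, hx2⟩, hx3, hx4⟩ := (haxis.and_eventually ((eventually_nhdsWithin_of_eventually_nhds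
      (eventually_lt_of_hasDerivAt_neg hp.hasDerivAt hlt)).and self_mem_nhdsWithin)).exists
    have := hx3.1 hx4
    rw [h00] at this
    exact this.not_ge hx1
  have hs0 : 0 < s := by
    rw [hq0, mul_zero, sub_zero] at hd
    exact pos_of_mul_pos_right hd hp0
  simpa [h00] using eventually_lt_of_hasDerivAt_pos hs.hasDerivAt hs0

section Diagrams

variable {S : Type*} [TopologicalSpace S] [ChartedSpace Plane S]

theorem OrientedAt.transition {e e' : OpenPartialHomeomorph S Plane} (he : IsOrientedChart e)
    (he' : IsOrientedChart e') {z : Plane} (hz : z ∈ e.target) (hz' : e.symm z ∈ e'.source) :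
    OrientedAt (e' ∘ e.symm) z :=
  OrientedAt.of_mem_groupoid (T := e.symm ≫ₕ e')
    (StructureGroupoid.compatible_of_mem_maximalAtlas he he') (by simp [hz, hz'])

/-- A structomorphism is controlled only in charts of the atlas, so `e` and `e'` are compared with
the preferred charts at the point and at its image, and the three oriented maps are composed. -/
theorem OrientedAt.structomorph [HasGroupoid S orientedGroupoid]
    (h : Structomorph orientedGroupoid S S) {e e' : OpenPartialHomeomorph S Plane}
    (he : IsOrientedChart e) (he' : IsOrientedChart e') {z : Plane} (hz : z ∈ e.target)
    (hz' : h.toHomeomorph (e.symm z) ∈ e'.source) :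
    OrientedAt (fun w => e' (h.toHomeomorph (e.symm w))) z := by
  set c := chartAt Plane (e.symm z) with hc
  set c' := chartAt Plane (h.toHomeomorph (e.symm z)) with hc'
  have hzc : e.symm z ∈ c.source := mem_chart_source _ _
  have hzc' : h.toHomeomorph (e.symm z) ∈ c'.source := mem_chart_source _ _
  have h1 : OrientedAt (c ∘ e.symm) z := OrientedAt.transition he
    (StructureGroupoid.subset_maximalAtlas _ (chart_mem_atlas _ _)) hz hzc
  have h2 : OrientedAt (fun w => c' (h.toHomeomorph (c.symm w))) (c (e.symm z)) := by
    refine OrientedAt.of_mem_groupoid (h.mem_groupoid c c' (chart_mem_atlas _ _)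
      (chart_mem_atlas _ _)) ?_
    simp [hzc, hzc']
  have h3 : OrientedAt (e' ∘ c'.symm) (c' (h.toHomeomorph (e.symm z))) := by
    refine OrientedAt.transition (StructureGroupoid.subset_maximalAtlas _ (chart_mem_atlas _ _)) he'
      (c'.map_source hzc') ?_
    rwa [c'.left_inv hzc']
  have h2' : OrientedAt (fun w => c' (h.toHomeomorph (c.symm w))) ((c ∘ e.symm) z) := h2
  have h4 := h2'.comp h1
  have h3' : OrientedAt (e' ∘ c'.symm)
      (((fun w => c' (h.toHomeomorph (c.symm w))) ∘ (c ∘ e.symm)) z) := by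
    simp only [Function.comp_apply, c.left_inv hzc]
    exact h3
  refine (h3'.comp h4).congr ?_
  have hcont := e.continuousAt_symm hz
  have ev1 : ∀ᶠ w in 𝓝 z, e.symm w ∈ c.source := hcont (c.open_source.mem_nhds hzc)
  have ev2 : ∀ᶠ w in 𝓝 z, h.toHomeomorph (e.symm w) ∈ c'.source :=
    (h.toHomeomorph.continuous.continuousAt.comp hcont) (c'.open_source.mem_nhds hzc')
  filter_upwards [ev1, ev2] with w hw hw2
  simp only [Function.comp_apply, c.left_inv hw, c'.left_inv hw2]

/-! ### Isotopies -/

/-- `D'` is the image of `D` under an orientation preserving diffeomorphism, up to an increasing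
change of the parameter. -/
def IsImage (h : Structomorph orientedGroupoid S S) (ρ : unitInterval ≃o unitInterval)
    (D D' : KnotoidDiagram S) : Prop :=
  ∀ t, D'.curve t = h.toHomeomorph (D.curve (ρ t)) ∧ (t ∈ D'.under ↔ ρ t ∈ D.under)

variable {D D' : KnotoidDiagram S} {h : Structomorph orientedGroupoid S S}
  {ρ : unitInterval ≃o unitInterval}

theorem IsImage.symm (H : IsImage h ρ D D') : IsImage h.symm ρ.symm D' D := by
  intro t
  have h1 := H (ρ.symm t)
  rw [ρ.apply_symm_apply] at h1
  refine ⟨?_, h1.2.symm⟩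
  rw [h1.1]
  exact (h.toHomeomorph.symm_apply_apply _).symm

theorem IsImage.mem_range (H : IsImage h ρ D D') (p : S) :
    p ∈ range D'.curve ↔ h.toHomeomorph.symm p ∈ range D.curve := by
  constructor
  · rintro ⟨t, rfl⟩
    exact ⟨ρ t, by rw [(H t).1, h.toHomeomorph.symm_apply_apply]⟩
  · rintro ⟨t, ht⟩
    refine ⟨ρ.symm t, ?_⟩
    rw [(H _).1, ρ.apply_symm_apply, ht, h.toHomeomorph.apply_symm_apply]

/-- The comparison of the chart `e'` of `D'` with the chart `e` of `D`. -/
theorem IsImage.comparison [HasGroupoid S orientedGroupoid] (H : IsImage h ρ D D')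
    {t : unitInterval} (ht1 : t ≠ 1) {e e' : OpenPartialHomeomorph S Plane}
    (he : IsOrientedChart e) (he' : IsOrientedChart e')
    (het : StraightAt D.curve e (ρ t) (1, 0)) (het' : StraightAt D'.curve e' t (1, 0)) :
    Tendsto (fun w => e (h.symm.toHomeomorph (e'.symm w))) (𝓝 0) (𝓝 0) ∧
    (∀ᶠ w in 𝓝 (0 : Plane), h.symm.toHomeomorph (e'.symm w) ∈ e.source) ∧
    ∀ᶠ y in 𝓝 (0 : ℝ), (0 < y → 0 < (e (h.symm.toHomeomorph (e'.symm (0, y)))).2) ∧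
      (y < 0 → (e (h.symm.toHomeomorph (e'.symm (0, y)))).2 < 0) := by
  have hpt : h.symm.toHomeomorph (D'.curve t) = D.curve (ρ t) := by
    rw [(H t).1]
    exact h.toHomeomorph.symm_apply_apply _
  have hsrc : h.symm.toHomeomorph (e'.symm 0) ∈ e.source := by
    rw [het'.symm_zero, hpt]
    exact het.1
  have hor := OrientedAt.structomorph h.symm he' he het'.zero_mem hsrc
  have h0 : e (h.symm.toHomeomorph (e'.symm 0)) = 0 := by
    rw [het'.symm_zero, hpt, het.apply_eq]
  refine ⟨?_, ?_, ?_⟩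
  · have := hor.1.continuousAt.tendsto
    rwa [h0] at this
  · exact (h.symm.toHomeomorph.continuous.continuousAt.comp
      (e'.continuousAt_symm het'.zero_mem)) (e.open_source.mem_nhds hsrc)
  · refine hor.eventually_snd_sign h0 ?_
    have hlim : Tendsto (fun v : unitInterval => (v : ℝ) - t) (𝓝[>] t) (𝓝[>] 0) := by
      refine tendsto_nhdsWithin_iff.2 ⟨?_, ?_⟩
      · have : Continuous (fun v : unitInterval => (v : ℝ) - t) := by fun_prop
        exact (by simpa using this.tendsto t : Tendsto _ _ _).mono_left nhdsWithin_le_nhds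
      · filter_upwards [self_mem_nhdsWithin] with v (hv : t < v)
        exact sub_pos.2 (show (t : ℝ) < v from hv)
    have hne : (𝓝[>] t).NeBot :=
      nhdsGT_neBot_of_exists_gt ⟨1, unitInterval.lt_one_iff_ne_one.2 ht1⟩
    refine hlim.frequently (Eventually.frequently ?_)
    have e1 := nhdsWithin_le_nhds (s := Ioi t) het'.eventually_curve_eq
    have e2 := nhdsWithin_le_nhds (s := Ioi t)
      (ρ.continuous.continuousAt.eventually het.2)
    filter_upwards [e1, e2, self_mem_nhdsWithin] with v hv hv2 (hv3 : t < v)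
    -- Points of the positive axis lie on `D'` just after `t`. They come from points of `D` just
    -- after `ρ t`, because `ρ` is increasing, so the comparison map sends them into the positive
    -- axis.
    have h4 : e (h.symm.toHomeomorph (e'.symm ((v : ℝ) - t, 0)))
        = ((ρ v : ℝ) - ρ t) • (1, 0) := by
      rw [← hv2]
      congr 1
      have : (((v : ℝ) - t, 0) : Plane) = ((v : ℝ) - t) • (1, 0) := by ext <;> simp
      rw [this, ← hv, (H v).1]
      exact h.toHomeomorph.symm_apply_apply _
    rw [h4]
    have h5 : (ρ t : ℝ) < ρ v := ρ.strictMono hv3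
    simp [h5.le]

/-- The comparison of charts preserves the upper and the lower side of a strand, so the sides of
arcs and the signs of crossings are the same in `D` and `D'`. -/
theorem IsImage.isColoring [T2Space S] [HasGroupoid S orientedGroupoid] (H : IsImage h ρ D D')
    {X Y : Type*} [Quandle X] [QuandleSet X Y] {F : unitInterval → X} {G : S → Y}
    (hc : IsColoring D F G) : IsColoring D' (F ∘ ρ) (G ∘ h.symm.toHomeomorph) := by
  have hpt : ∀ t, h.symm.toHomeomorph (D'.curve t) = D.curve (ρ t) := by
    intro t
    rw [(H t).1]
    exact h.toHomeomorph.symm_apply_apply _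
  have heq : ∀ s t, D.curve (ρ s) = D.curve (ρ t) ↔ D'.curve s = D'.curve t := by
    intro s t
    rw [(H s).1, (H t).1, h.toHomeomorph.injective.eq_iff]
  have hinj : ∀ t, (∀ v, D'.curve v = D'.curve t → v = t) →
      ∀ v, D.curve v = D.curve (ρ t) → v = ρ t := by
    intro t ht v hv
    obtain ⟨w, rfl⟩ := ρ.surjective v
    rw [ht w ((heq w t).1 hv)]
  have hρ0 : ∀ t, t ≠ 0 → ρ t ≠ 0 := fun t ht h0 => ht (ρ.injective (h0.trans ρ.map_bot.symm))
  have hρ1 : ∀ t, t ≠ 1 → ρ t ≠ 1 := fun t ht h0 => ht (ρ.injective (h0.trans ρ.map_top.symm))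
  refine ⟨?_, ?_, ?_, ?_, ?_⟩
  · intro t ht
    exact ρ.continuous.continuousAt.eventually (hc.arc_eq (ρ t) fun hu => ht ((H t).2.2 hu))
  · intro p hp
    exact h.symm.toHomeomorph.continuous.continuousAt.eventually
      (hc.region_eq _ fun hu => hp ((H.mem_range p).2 hu))
  · intro s t hst htu hcur e' ε he' hε hes' het' x₁ x₂ hx
    obtain ⟨h0, h1⟩ := KnotoidDiagram.ne_endpoint_of_mem_under htu
    have hs1 : s ≠ 1 := by
      rintro rfl
      exact hst ((D'.endpoints t).2 hcur.symm).symm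
    have hst' : ρ s ≠ ρ t := fun h => hst (ρ.injective h)
    have hcur' := (heq s t).2 hcur
    obtain ⟨e, ε₀, he, hε₀, hes, het⟩ := D.exists_crossing_chart hst' hcur'
    obtain ⟨-, -, hsign⟩ := H.comparison hs1 he he' hes hes'
    -- If the signs differed, a point of the under-strand of `D'` above the over-strand would come
    -- from a point of `D` below it.
    have hεε : ε = ε₀ := by
      have hl := (frequently_sides h0 h1 hε).2
      have hlim : Tendsto (fun v : unitInterval => ε * ((v : ℝ) - t)) (𝓝 t) (𝓝 0) := by
        have : Continuous (fun v : unitInterval => ε * ((v : ℝ) - t)) := by fun_prop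
        simpa using this.tendsto t
      obtain ⟨v, hv, hv1, hv2, hv3⟩ := (hl.and_eventually ((hlim.eventually hsign).and
        (het'.eventually_curve_eq.and (ρ.continuous.continuousAt.eventually het.2)))).exists
      have h4 : e (h.symm.toHomeomorph (e'.symm (0, ε * ((v : ℝ) - t))))
          = ((ρ v : ℝ) - ρ t) • (0, ε₀) := by
        rw [← hv3, ← hpt]
        have : ((0, ε * ((v : ℝ) - t)) : Plane) = ((v : ℝ) - t) • (0, ε) := by
          ext <;> simp [mul_comm]
        rw [this, ← hv2]
      have h5 := hv1.1 hv
      rw [h4] at h5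
      have key : ∀ v w : unitInterval, v < w ↔ (v : ℝ) < w := fun v w => Iff.rfl
      simp only [Prod.smul_snd, smul_eq_mul] at h5
      rcases hε with rfl | rfl <;> rcases hε₀ with rfl | rfl
      · rfl
      · have : (ρ t : ℝ) < ρ v := ρ.strictMono ((key t v).2 (by linarith))
        linarith
      · have : (ρ v : ℝ) < ρ t := ρ.strictMono ((key v t).2 (by linarith))
        linarith
      · rfl
    subst hεε
    refine hc.crossing (ρ s) (ρ t) hst' ((H t).2.1 htu) hcur' e ε he hε hes het x₁ x₂ ?_
    have hx' : ∀ᶠ w in 𝓝 (ρ t), (ε * (((ρ.symm w : unitInterval) : ℝ) - t) < 0 →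
        F (ρ (ρ.symm w)) = x₁) ∧ (0 < ε * (((ρ.symm w : unitInterval) : ℝ) - t) →
        F (ρ (ρ.symm w)) = x₂) := by
      have hlim := ρ.symm.continuous.tendsto (ρ t)
      rw [ρ.symm_apply_apply] at hlim
      exact hlim.eventually hx
    filter_upwards [hx'] with w hw
    rw [ρ.apply_symm_apply] at hw
    have key : ∀ v w : unitInterval, v < w ↔ (v : ℝ) < w := fun v w => Iff.rfl
    have h1 : w < ρ t ↔ ρ.symm w < t := by rw [← ρ.symm.lt_iff_lt, ρ.symm_apply_apply]
    have h2 : ρ t < w ↔ t < ρ.symm w := by rw [← ρ.symm.lt_iff_lt, ρ.symm_apply_apply]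
    simp only [key] at h1 h2
    rcases hε with rfl | rfl
    · refine ⟨fun h => hw.1 ?_, fun h => hw.2 ?_⟩
      · linarith [h1.1 (by linarith)]
      · linarith [h2.1 (by linarith)]
    · refine ⟨fun h => hw.1 ?_, fun h => hw.2 ?_⟩
      · linarith [h2.1 (by linarith)]
      · linarith [h1.1 (by linarith)]
  · intro t h0 h1 ht e' he' het'
    obtain ⟨e, he, het⟩ := D.immersion (ρ t)
    obtain ⟨hlim, hsrc, hsign⟩ := H.comparison h1 he he' het het'
    obtain ⟨y₁, y₂, hy12, hy⟩ := hc.exists_side_values (hρ0 t h0) (hρ1 t h1) (hinj t ht) he het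
    have hup := (tendsto_vertical (σ := 1)).eventually ((hlim.eventually hy).and hsrc)
    have hdn := (tendsto_vertical (σ := -1)).eventually ((hlim.eventually hy).and hsrc)
    have hneg : Tendsto (fun y : ℝ => -y) (𝓝[>] 0) (𝓝 0) := by
      have := (continuous_neg (G := ℝ)).tendsto 0
      rw [neg_zero] at this
      exact this.mono_left nhdsWithin_le_nhds
    simp only [one_mul, neg_one_mul] at hup hdn
    filter_upwards [hup, hdn, nhdsWithin_le_nhds hsign, hneg.eventually hsign, self_mem_nhdsWithin]
      with y hy1 hy2 hy3 hy4 (hy0 : 0 < y)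
    have h5 := hy1.1.1 (hy3.1 hy0)
    have h6 := hy2.1.2 (hy4.2 (neg_lt_zero.2 hy0))
    rw [e.left_inv hy1.2] at h5
    rw [e.left_inv hy2.2] at h6
    simp only [Function.comp_apply, h5, h6, hy12]
  · intro t ht
    have ht' : ρ t = 0 ∨ ρ t = 1 := by
      rcases ht with rfl | rfl
      · exact Or.inl ρ.map_bot
      · exact Or.inr ρ.map_top
    have h1 := hc.endpoint (ρ t) ht'
    rw [← hpt] at h1
    filter_upwards [h.symm.toHomeomorph.continuous.continuousAt.eventually h1] with q hq hqr
    exact hq fun hu => hqr ((H.mem_range q).2 hu)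

theorem IsImage.nonempty_equiv [T2Space S] [HasGroupoid S orientedGroupoid] (H : IsImage h ρ D D')
    (X Y : Type*) [Quandle X] [QuandleSet X Y] :
    Nonempty (Coloring X Y D ≃ Coloring X Y D') := by
  have hex : ∀ c : Coloring X Y D, ∃ c' : Coloring X Y D', ∃ F G, c.Represents F G ∧
      c'.Represents (F ∘ ρ) (G ∘ h.symm.toHomeomorph) := by
    intro c
    obtain ⟨F, G, hFG, hc⟩ := c.exists_represents
    obtain ⟨c', hc'⟩ := (H.isColoring hFG).exists_coloring
    exact ⟨c', F, G, hc, hc'⟩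
  choose f hf using hex
  refine ⟨Equiv.ofBijective f ⟨fun c₁ c₂ hc => ?_, fun c' => ?_⟩⟩
  · obtain ⟨F₁, G₁, hr₁, hr₁'⟩ := hf c₁
    obtain ⟨F₂, G₂, hr₂, hr₂'⟩ := hf c₂
    rw [← hc] at hr₂'
    refine hr₁.ext hr₂ (fun t ht => ?_) fun p hp => ?_
    · obtain ⟨t, rfl⟩ := ρ.surjective t
      have htu : t ∉ D'.under := fun hu => ht ((H t).2.1 hu)
      exact (hr₁'.1 t htu).trans (hr₂'.1 t htu).symm
    · have hp' : h.toHomeomorph p ∉ range D'.curve := fun hu => by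
        rw [H.mem_range, h.toHomeomorph.symm_apply_apply] at hu
        exact hp hu
      have h3 := (hr₁'.2 _ hp').trans (hr₂'.2 _ hp').symm
      have h4 : h.symm.toHomeomorph (h.toHomeomorph p) = p := h.toHomeomorph.symm_apply_apply p
      simpa only [Function.comp_apply, h4] using h3
  · obtain ⟨F₀, G₀, h₀, hr₀⟩ := c'.exists_represents
    obtain ⟨c, hc⟩ := (H.symm.isColoring h₀).exists_coloring
    refine ⟨c, ?_⟩
    obtain ⟨F, G, hcr, hcr'⟩ := hf c
    refine hcr'.ext hr₀ (fun t ht => ?_) fun p hp => ?_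
    · have htu : ρ t ∉ D.under := fun hu => ht ((H t).2.2 hu)
      have := (hcr.1 _ htu).trans (hc.1 _ htu).symm
      simpa using this
    · have hp' : h.symm.toHomeomorph p ∉ range D.curve := fun hu => hp ((H.mem_range p).2 hu)
      have h3 := (hcr.2 _ hp').trans (hc.2 _ hp').symm
      have h4 : h.symm.symm.toHomeomorph (h.symm.toHomeomorph p) = p :=
        h.toHomeomorph.apply_symm_apply p
      simpa only [Function.comp_apply, h4] using h3

theorem Isotopic.nonempty_equiv [T2Space S] [HasGroupoid S orientedGroupoid] (H : Isotopic D D')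
    (X Y : Type*) [Quandle X] [QuandleSet X Y] :
    Nonempty (Coloring X Y D ≃ Coloring X Y D') := by
  obtain ⟨K, ρ, -, -, hK⟩ := H
  exact IsImage.nonempty_equiv (h := K 1) (ρ := ρ) hK X Y

end Diagrams

/-! ### Index functions in the plane -/

/-- The side of a graph on which the image of the second axis lies. -/
theorem OrientedAt.eventually_graph_sign {φ : Plane → Plane} {x₀ p : ℝ} (h : OrientedAt φ (x₀, 0))
    (hp : HasDerivAt (fun x => (φ (x, 0)).1) p x₀) (hp0 : p ≠ 0) {f : ℝ → ℝ}
    (hf : ∀ᶠ x in 𝓝 x₀, (φ (x, 0)).2 = f (φ (x, 0)).1) :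
    ∀ᶠ y in 𝓝[>] (0 : ℝ), 0 < p * ((φ (x₀, y)).2 - f (φ (x₀, y)).1) ∧
      p * ((φ (x₀, -y)).2 - f (φ (x₀, -y)).1) < 0 := by
  obtain ⟨p', q, r, s, hp', hq, hr, hs, hd⟩ := h.exists_hasStrictDerivAt
  obtain rfl := hp'.hasDerivAt.unique hp
  set P : ℝ → ℝ := fun x => (φ (x, 0)).1 with hP
  -- No smoothness of `f` is assumed. Near `x₀` the first coordinate is invertible, so the graph can
  -- be parametrized smoothly by it, which shows that `f` has the slope `q / p'` at that point.
  set g := hp'.localInverse P p' x₀ hp0 with hg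
  have hgd : HasStrictDerivAt g p'⁻¹ (P x₀) := hp'.to_localInverse hp0
  have hgx : g (P x₀) = x₀ := (hp'.hasStrictFDerivAt_equiv hp0).localInverse_apply_image
  have hgP : ∀ᶠ u in 𝓝 (P x₀), P (g u) = u :=
    (hp'.hasStrictFDerivAt_equiv hp0).eventually_right_inverse
  have hfd : HasDerivAt f (q * p'⁻¹) (P x₀) := by
    have h1 : HasDerivAt (fun u => (φ (g u, 0)).2) (q * p'⁻¹) (P x₀) := by
      refine HasDerivAt.comp (h₂ := fun x => (φ (x, 0)).2) (P x₀) ?_ hgd.hasDerivAt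
      rw [hgx]
      exact hq.hasDerivAt
    refine h1.congr_of_eventuallyEq ?_
    have h2 : Tendsto g (𝓝 (P x₀)) (𝓝 x₀) := by
      have := hgd.hasDerivAt.continuousAt.tendsto
      rwa [hgx] at this
    filter_upwards [h2.eventually hf, hgP] with u hu hu2
    rw [hu]
    exact (congrArg f hu2).symm
  have hfc : HasDerivAt (fun y => f (φ (x₀, y)).1) (q * p'⁻¹ * r) 0 :=
    HasDerivAt.comp (h₂ := f) 0 hfd hr.hasDerivAt
  have hΔ := (hs.hasDerivAt.sub hfc).const_mul p'
  -- The derivative of the height above the graph along the second axis, times `p'`, is the Jacobian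
  -- determinant.
  have hpos : 0 < p' * (s - q * p'⁻¹ * r) := by
    have : p' * (s - q * p'⁻¹ * r) = p' * s - r * q := by field_simp
    rwa [this]
  have hev := eventually_lt_of_hasDerivAt_pos hΔ hpos
  have hneg : Tendsto (fun y : ℝ => -y) (𝓝[>] 0) (𝓝 0) := by
    have := (continuous_neg (G := ℝ)).tendsto 0
    rw [neg_zero] at this
    exact this.mono_left nhdsWithin_le_nhds
  have h0 := hf.self_of_nhds
  filter_upwards [nhdsWithin_le_nhds hev, hneg.eventually hev, self_mem_nhdsWithin]
    with y hy1 hy2 (hy0 : 0 < y)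
  have h1 := hy1.1 hy0
  have h2 := hy2.2 (neg_lt_zero.2 hy0)
  simp only [Pi.sub_apply, h0, sub_self, mul_zero] at h1 h2
  exact ⟨h1, h2⟩

/-- The rotation of the plane by a right angle, clockwise. -/
noncomputable def quarterTurn : Plane →L[ℝ] Plane :=
  (ContinuousLinearMap.snd ℝ ℝ ℝ).prod (-ContinuousLinearMap.fst ℝ ℝ ℝ)

theorem quarterTurn_apply (z : Plane) : quarterTurn z = (z.2, -z.1) := rfl

theorem orientedAt_quarterTurn (z : Plane) : OrientedAt quarterTurn z := by
  refine ⟨quarterTurn.contDiff.contDiffAt, ?_⟩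
  rw [ContinuousLinearMap.fderiv, det_eq]
  simp [quarterTurn_apply]

/-- The version for curves that are graphs over the second axis: rotate by a right angle and use the
previous case. -/
theorem OrientedAt.eventually_graph_sign' {φ : Plane → Plane} {x₀ q : ℝ}
    (h : OrientedAt φ (x₀, 0)) (hq : HasDerivAt (fun x => (φ (x, 0)).2) q x₀) (hq0 : q ≠ 0)
    {f : ℝ → ℝ} (hf : ∀ᶠ x in 𝓝 x₀, (φ (x, 0)).1 = f (φ (x, 0)).2) :
    ∀ᶠ y in 𝓝[>] (0 : ℝ), q * ((φ (x₀, y)).1 - f (φ (x₀, y)).2) < 0 ∧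
      0 < q * ((φ (x₀, -y)).1 - f (φ (x₀, -y)).2) := by
  have h1 := OrientedAt.eventually_graph_sign (φ := quarterTurn ∘ φ) (f := fun u => -f u)
    ((orientedAt_quarterTurn _).comp h) hq hq0 (hf.mono fun x hx => by
      simp only [Function.comp_apply, quarterTurn_apply, hx])
  filter_upwards [h1] with y hy
  simp only [Function.comp_apply, quarterTurn_apply] at hy
  constructor <;> nlinarith [hy.1, hy.2]

/-- The function `w` increases by one across the curve `c`, from right to left, in the sense that it
does so at some point of each part of the curve. Here the curve appears in coordinates in which it
runs along the first axis, and in its original or the opposite direction. -/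
def HasJump (c : ℝ → Plane) (w : Plane → ℤ) : Prop :=
  ∀ (φ : Plane → Plane) (τ : ℝ → ℝ) (σ : ℤ) (δ : ℝ), 0 < δ → (σ = 1 ∨ σ = -1) →
    StrictMonoOn (fun x => σ * τ x) (Ioo (-δ) δ) → (∀ x ∈ Ioo (-δ) δ, |τ x| < 1) →
    (∀ x ∈ Ioo (-δ) δ, OrientedAt φ (x, 0)) → (∀ x ∈ Ioo (-δ) δ, φ (x, 0) = c (τ x)) →
    ∃ x₀ ∈ Ioo (-δ) δ, ∀ᶠ y in 𝓝[>] (0 : ℝ), w (φ (x₀, y)) = w (φ (x₀, -y)) + σ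

/-- The mean value theorem. A strictly monotone parameter may have critical points, but not only
critical points; this is why `HasJump` asks for the jump at one point of each part of the curve. -/
theorem exists_deriv_pos {g : ℝ → ℝ} {l r : ℝ} (hlr : l < r) (hg : StrictMonoOn g (Ioo l r))
    (hd : ∀ x ∈ Ioo l r, DifferentiableAt ℝ g x) : ∃ x ∈ Ioo l r, 0 < deriv g x := by
  obtain ⟨x₁, hx₁, hx₁'⟩ := exists_between hlr
  obtain ⟨x₂, hx₂, hx₂'⟩ := exists_between hx₁'
  have hsub : Icc x₁ x₂ ⊆ Ioo l r := fun x hx => ⟨hx₁.trans_le hx.1, hx.2.trans_lt hx₂'⟩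
  obtain ⟨x, hx, hxd⟩ := exists_deriv_eq_slope g hx₂
    (fun y hy => (hd y (hsub hy)).continuousAt.continuousWithinAt)
    fun y hy => (hd y (hsub (Ioo_subset_Icc_self hy))).differentiableWithinAt
  refine ⟨x, hsub (Ioo_subset_Icc_self hx), ?_⟩
  rw [hxd]
  exact div_pos (sub_pos.2 (hg (hsub (left_mem_Icc.2 hx₂.le)) (hsub (right_mem_Icc.2 hx₂.le)) hx₂))
    (sub_pos.2 hx₂)

open Classical in
/-- The index function of the graph of `f`. -/
noncomputable def graphIndex (f : ℝ → ℝ) (z : Plane) : ℤ := if f z.1 < z.2 then 1 else 0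

theorem hasJump_graphIndex {f : ℝ → ℝ} {c : ℝ → Plane} (hc : ∀ u, |u| ≤ 1 → c u = (u, f u)) :
    HasJump c (graphIndex f) := by
  intro φ τ σ δ hδ hσ hτ hτ1 hφ hφc
  have hφc : ∀ x ∈ Ioo (-δ) δ, φ (x, 0) = (τ x, f (τ x)) := fun x hx => by
    rw [hφc x hx, hc _ (hτ1 x hx).le]
  have hmono : StrictMonoOn (fun x => (σ : ℝ) * (φ (x, 0)).1) (Ioo (-δ) δ) := by
    intro x hx y hy hxy
    simp only [hφc x hx, hφc y hy]
    exact hτ hx hy hxy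
  have hdiff : ∀ x ∈ Ioo (-δ) δ, ∃ p, HasDerivAt (fun x => (φ (x, 0)).1) p x := fun x hx => by
    obtain ⟨p, -, -, -, hp, -⟩ := (hφ x hx).exists_hasStrictDerivAt
    exact ⟨p, hp.hasDerivAt⟩
  obtain ⟨x₀, hx₀, hpos⟩ := exists_deriv_pos (by linarith) hmono fun x hx => by
    obtain ⟨p, hp⟩ := hdiff x hx
    exact (hp.const_mul (σ : ℝ)).differentiableAt
  obtain ⟨p, hp⟩ := hdiff x₀ hx₀
  rw [(hp.const_mul (σ : ℝ)).deriv] at hpos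
  have hp0 : p ≠ 0 := by rintro rfl; simp at hpos
  refine ⟨x₀, hx₀, ?_⟩
  have hev := (hφ x₀ hx₀).eventually_graph_sign hp hp0 (f := f) (by
    filter_upwards [Ioo_mem_nhds hx₀.1 hx₀.2] with x hx
    rw [hφc x hx])
  filter_upwards [hev] with y hy
  rcases hσ with rfl | rfl
  · have hp : 0 < p := by simpa using hpos
    have h1 := pos_of_mul_pos_right hy.1 hp.le
    have h2 : (φ (x₀, -y)).2 - f (φ (x₀, -y)).1 < 0 := by nlinarith [hy.2]
    rw [graphIndex, graphIndex, if_pos (by linarith), if_neg (by linarith)]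
    rfl
  · have hp : p < 0 := by simpa using hpos
    have h1 : (φ (x₀, y)).2 - f (φ (x₀, y)).1 < 0 := by nlinarith [hy.1]
    have h2 : 0 < (φ (x₀, -y)).2 - f (φ (x₀, -y)).1 := by nlinarith [hy.2]
    rw [graphIndex, graphIndex, if_neg (by linarith), if_pos (by linarith)]
    rfl

theorem eventually_graphIndex_eq {f : ℝ → ℝ} (hf : Continuous f) {z : Plane} (hz : z.2 ≠ f z.1) :
    ∀ᶠ z' in 𝓝 z, graphIndex f z' = graphIndex f z := by
  have h1 : Continuous fun z : Plane => f z.1 := hf.comp continuous_fst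
  rcases hz.lt_or_gt with h | h
  · filter_upwards [continuous_snd.continuousAt.eventually_lt h1.continuousAt h] with z' hz'
    rw [graphIndex, graphIndex, if_neg hz'.not_gt, if_neg h.not_gt]
  · filter_upwards [h1.continuousAt.eventually_lt continuous_snd.continuousAt h] with z' hz'
    rw [graphIndex, graphIndex, if_pos hz', if_pos h]

/-- The half width at height `y` of the curve `u ↦ (u * k u, -u ^ 2 / 2)`. -/
noncomputable def loopWidth (k : ℝ → ℝ) (y : ℝ) : ℝ := √(-2 * y) * k √(-2 * y)

open Classical in
/-- The index function of the curve `u ↦ (u * k u, -u ^ 2 / 2)`. -/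
noncomputable def loopIndex (k : ℝ → ℝ) (z : Plane) : ℤ :=
  (if loopWidth k z.2 ≤ z.1 then 1 else 0) + if z.1 < -loopWidth k z.2 then 1 else 0

theorem loopWidth_eq {k : ℝ → ℝ} {η u : ℝ} (hη : η = 1 ∨ η = -1) (hu : 0 ≤ η * u)
    (hk : ∀ u, k (-u) = k u) : loopWidth k (-u ^ 2 / 2) = η * (u * k u) := by
  have h1 : √(-2 * (-u ^ 2 / 2)) = η * u := by
    rw [show -2 * (-u ^ 2 / 2) = (η * u) ^ 2 by rcases hη with rfl | rfl <;> ring]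
    exact Real.sqrt_sq hu
  rw [loopWidth, h1]
  rcases hη with rfl | rfl
  · simp
  · simp [hk]

theorem exists_Ioo_subset {g : ℝ → ℝ} {l r : ℝ} (hlr : l < r) (hg : StrictMonoOn g (Ioo l r))
    (v : ℝ) : ∃ l' r', l' < r' ∧ Ioo l' r' ⊆ Ioo l r ∧
      ((∀ x ∈ Ioo l' r', g x < v) ∨ ∀ x ∈ Ioo l' r', v < g x) := by
  obtain ⟨m, hm, hm'⟩ := exists_between hlr
  rcases le_or_gt (g m) v with h | h
  · exact ⟨l, m, hm, Ioo_subset_Ioo_right hm'.le, Or.inl fun x hx =>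
      (hg ⟨hx.1, hx.2.trans hm'⟩ ⟨hm, hm'⟩ hx.2).trans_le h⟩
  · exact ⟨m, r, hm', Ioo_subset_Ioo_left hm.le, Or.inr fun x hx =>
      h.trans (hg ⟨hm, hm'⟩ ⟨hm.trans hx.1, hx.2⟩ hx.1)⟩

/-- The halves `u > 0` and `u < 0` of the curve are the graphs `x = ± loopWidth k y` over the second
axis. The index is 0 between them below the double point, 2 inside the loop and 1 elsewhere. Near a
point of one graph that is not on the other, just one of the two indicators in `loopIndex` changes.
-/
theorem hasJump_loopIndex {k : ℝ → ℝ} (hk : ∀ u, k (-u) = k u)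
    (hk0 : ∀ u, |u| < 1 → k u = 0 → |u| = 1 / 2) (hcont : Continuous (loopWidth k)) :
    HasJump (fun u => (u * k u, -u ^ 2 / 2)) (loopIndex k) := by
  intro φ τ σ δ hδ hσ hτ hτ1 hφ hφc
  have hσσ : (σ : ℝ) * σ = 1 := by rcases hσ with rfl | rfl <;> norm_num
  -- Shrink the interval until `τ` avoids 0, where the two branches are joined, and `± 1 / 2`, where
  -- the double point can be.
  obtain ⟨l₁, r₁, hlr₁, hsub₁, hs₁⟩ := exists_Ioo_subset (by linarith) hτ 0
  obtain ⟨l₂, r₂, hlr₂, hsub₂, hs₂⟩ := exists_Ioo_subset hlr₁ (hτ.mono hsub₁) (1 / 2)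
  obtain ⟨l, r, hlr, hsub₃, hs₃⟩ := exists_Ioo_subset hlr₂ (hτ.mono (hsub₂.trans hsub₁)) (-(1 / 2))
  have hsub : Ioo l r ⊆ Ioo (-δ) δ := hsub₃.trans (hsub₂.trans hsub₁)
  obtain ⟨η, hη, hητ⟩ : ∃ η : ℝ, (η = 1 ∨ η = -1) ∧ ∀ x ∈ Ioo l r, 0 < η * τ x := by
    rcases hσ with rfl | rfl <;> rcases hs₁ with h | h
    · exact ⟨-1, Or.inr rfl, fun x hx => by
        have := h x (hsub₂ (hsub₃ hx)); push_cast at this; linarith⟩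
    · exact ⟨1, Or.inl rfl, fun x hx => by
        have := h x (hsub₂ (hsub₃ hx)); push_cast at this; linarith⟩
    · exact ⟨1, Or.inl rfl, fun x hx => by
        have := h x (hsub₂ (hsub₃ hx)); push_cast at this; linarith⟩
    · exact ⟨-1, Or.inr rfl, fun x hx => by
        have := h x (hsub₂ (hsub₃ hx)); push_cast at this; linarith⟩
  have hhalf : ∀ x ∈ Ioo l r, |τ x| ≠ 1 / 2 := by
    intro x hx habs
    have h2 : (σ : ℝ) * τ x ≠ 1 / 2 := by
      rcases hs₂ with h | h
      · exact (h x (hsub₃ hx)).ne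
      · exact (h x (hsub₃ hx)).ne'
    have h3 : (σ : ℝ) * τ x ≠ -(1 / 2) := by
      rcases hs₃ with h | h
      · exact (h x hx).ne
      · exact (h x hx).ne'
    revert h2 h3
    rcases (abs_eq (by norm_num)).1 habs with h | h <;> rcases hσ with rfl | rfl <;>
      rw [h] <;> norm_num
  -- The function is `σ * η * τ ^ 2 / 2`, which increases since `σ * τ` does and `η * τ` is
  -- positive. Its derivative gives the sign of `q`, namely that of `-(σ * η)`.
  have hmono : StrictMonoOn (fun x => -(σ * η) * (φ (x, 0)).2) (Ioo l r) := by
    intro x hx y hy hxy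
    simp only [hφc x (hsub hx), hφc y (hsub hy)]
    have h1 : 0 < σ * τ y - σ * τ x := sub_pos.2 (hτ (hsub hx) (hsub hy) hxy)
    nlinarith [mul_pos h1 (add_pos (hητ x hx) (hητ y hy))]
  have hdiff : ∀ x ∈ Ioo l r, ∃ p, HasDerivAt (fun x => (φ (x, 0)).2) p x := fun x hx => by
    obtain ⟨-, q, -, -, -, hq, -⟩ := (hφ x (hsub hx)).exists_hasStrictDerivAt
    exact ⟨q, hq.hasDerivAt⟩
  obtain ⟨x₀, hx₀, hpos⟩ := exists_deriv_pos hlr hmono fun x hx => by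
    obtain ⟨p, hp⟩ := hdiff x hx
    exact (hp.const_mul _).differentiableAt
  obtain ⟨q, hq⟩ := hdiff x₀ hx₀
  rw [(hq.const_mul _).deriv] at hpos
  have hq0 : q ≠ 0 := by rintro rfl; simp at hpos
  refine ⟨x₀, hsub hx₀, ?_⟩
  have hηη : η * η = 1 := by rcases hη with rfl | rfl <;> norm_num
  have hgraph : ∀ x ∈ Ioo l r, (φ (x, 0)).1 = η * loopWidth k (φ (x, 0)).2 := by
    intro x hx
    rw [hφc x (hsub hx)]
    simp only [loopWidth_eq hη (hητ x hx).le hk]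
    rw [← mul_assoc, hηη, one_mul]
  have hev := (hφ x₀ (hsub hx₀)).eventually_graph_sign' hq hq0 (f := fun y => η * loopWidth k y) (by
    filter_upwards [Ioo_mem_nhds hx₀.1 hx₀.2] with x hx
    exact hgraph x hx)
  have hτ0 : τ x₀ ≠ 0 := by
    intro h
    have := hητ x₀ hx₀
    rw [h] at this
    simp at this
  have hw0 : loopWidth k (φ (x₀, 0)).2 ≠ 0 := by
    rw [hφc x₀ (hsub hx₀), loopWidth_eq hη (hητ x₀ hx₀).le hk]
    refine mul_ne_zero (by rcases hη with rfl | rfl <;> norm_num) (mul_ne_zero hτ0 fun h => ?_)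
    exact hhalf x₀ hx₀ (hk0 _ (hτ1 x₀ (hsub hx₀)) h)
  have hcφ := (hφ x₀ (hsub hx₀)).1.continuousAt
  have hc1 : ContinuousAt (fun z => η * (φ z).1 + loopWidth k (φ z).2) (x₀, 0) :=
    (continuousAt_const.mul (continuous_fst.continuousAt.comp hcφ)).add
      (hcont.continuousAt.comp (continuous_snd.continuousAt.comp hcφ))
  have hval : η * (φ (x₀, 0)).1 + loopWidth k (φ (x₀, 0)).2 = 2 * loopWidth k (φ (x₀, 0)).2 := by
    rw [hgraph x₀ hx₀, ← mul_assoc, hηη]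
    ring
  have hlim : ∀ σ : ℝ, Tendsto (fun y : ℝ => ((x₀, σ * y) : Plane)) (𝓝[>] 0) (𝓝 (x₀, 0)) := by
    intro σ
    have : Continuous (fun y : ℝ => ((x₀, σ * y) : Plane)) := by fun_prop
    have h := this.tendsto 0
    simp only [mul_zero] at h
    exact h.mono_left nhdsWithin_le_nhds
  -- The other branch is the zero set of `η * x + loopWidth k y`. At the chosen point this
  -- expression is twice a nonzero width, so its sign is constant nearby.
  have hfar : (∀ᶠ y in 𝓝[>] (0 : ℝ), 0 < η * (φ (x₀, y)).1 + loopWidth k (φ (x₀, y)).2 ∧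
        0 < η * (φ (x₀, -y)).1 + loopWidth k (φ (x₀, -y)).2) ∨
      ∀ᶠ y in 𝓝[>] (0 : ℝ), η * (φ (x₀, y)).1 + loopWidth k (φ (x₀, y)).2 < 0 ∧
        η * (φ (x₀, -y)).1 + loopWidth k (φ (x₀, -y)).2 < 0 := by
    rcases hw0.lt_or_gt with h | h
    · right
      have h1 := hc1.eventually_lt continuousAt_const (by rw [hval]; linarith :
        η * (φ (x₀, 0)).1 + loopWidth k (φ (x₀, 0)).2 < 0)
      have := ((hlim 1).eventually h1).and ((hlim (-1)).eventually h1)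
      simpa only [one_mul, neg_one_mul] using this
    · left
      have h1 := continuousAt_const.eventually_lt hc1 (by rw [hval]; linarith :
        0 < η * (φ (x₀, 0)).1 + loopWidth k (φ (x₀, 0)).2)
      have := ((hlim 1).eventually h1).and ((hlim (-1)).eventually h1)
      simpa only [one_mul, neg_one_mul] using this
  have hsgn : ∀ v : ℝ, (q * v < 0 → 0 < σ * η * v) ∧ (0 < q * v → σ * η * v < 0) := by
    intro v
    have hsq : (σ * η) * (σ * η) = 1 := by
      calc (σ * η) * (σ * η) = ((σ : ℝ) * σ) * (η * η) := by ring
        _ = 1 := by rw [hσσ, hηη, one_mul]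
    have h1 : q * v = -(-(σ * η) * q) * (σ * η * v) := by
      have : -(-(σ * η) * q) * (σ * η * v) = (σ * η) * (σ * η) * (q * v) := by ring
      rw [this, hsq, one_mul]
    rw [h1]
    constructor <;> intro h <;> nlinarith
  rcases hfar with hfar | hfar <;> filter_upwards [hev, hfar] with y hy hy2 <;>
    obtain ⟨h1, h2⟩ := hy <;> replace h1 := (hsgn _).1 h1 <;> replace h2 := (hsgn _).2 h2 <;>
    obtain ⟨h3, h4⟩ := hy2 <;> generalize φ (x₀, y) = z at * <;>
    generalize φ (x₀, -y) = z' at * <;>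
    rcases hσ with rfl | rfl <;> rcases hη with rfl | rfl <;> push_cast at h1 h2 <;>
    simp only [loopIndex] <;> split_ifs <;> first | rfl | (exfalso; linarith)

theorem eventually_loopIndex_eq {k : ℝ → ℝ} (hcont : Continuous (loopWidth k)) {z : Plane}
    (h1 : z.1 ≠ loopWidth k z.2) (h2 : z.1 ≠ -loopWidth k z.2) :
    ∀ᶠ z' in 𝓝 z, loopIndex k z' = loopIndex k z := by
  have hc : Continuous fun z : Plane => loopWidth k z.2 := hcont.comp continuous_snd
  have ev1 : ∀ᶠ z' in 𝓝 z, (loopWidth k z'.2 ≤ z'.1 ↔ loopWidth k z.2 ≤ z.1) := by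
    rcases h1.lt_or_gt with h | h
    · filter_upwards [continuous_fst.continuousAt.eventually_lt hc.continuousAt h] with z' hz'
      simp [hz'.not_ge, h.not_ge]
    · filter_upwards [hc.continuousAt.eventually_lt continuous_fst.continuousAt h] with z' hz'
      simp [hz'.le, h.le]
  have ev2 : ∀ᶠ z' in 𝓝 z, (z'.1 < -loopWidth k z'.2 ↔ z.1 < -loopWidth k z.2) := by
    rcases h2.lt_or_gt with h | h
    · filter_upwards [continuous_fst.continuousAt.eventually_lt hc.neg.continuousAt h] with z' hz'
      exact ⟨fun _ => h, fun _ => hz'⟩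
    · filter_upwards [hc.neg.continuousAt.eventually_lt continuous_fst.continuousAt h] with z' hz'
      exact ⟨fun h' => absurd h' hz'.not_gt, fun h' => absurd h' h.not_gt⟩
  filter_upwards [ev1, ev2] with z' hz1 hz2
  simp only [loopIndex, hz1, hz2]

/-! ### The square as the unit ball of the maximum norm, and its preimage in the surface. -/

theorem mem_square_iff {z : Plane} : z ∈ square ↔ ‖z‖ ≤ 1 := by
  rw [square, mem_prod, mem_Icc, mem_Icc, Prod.norm_def, max_le_iff, Real.norm_eq_abs,
    Real.norm_eq_abs, abs_le, abs_le]

/-- The open ball is homeomorphic to the plane, and the complement of a countable set in a real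
vector space of dimension at least two is connected. -/
theorem isPreconnected_ball_diff {Z : Set Plane} (hZ : Z.Finite) :
    IsPreconnected (Metric.ball (0 : Plane) 1 \ Z) := by
  have hrank : 1 < Module.rank ℝ Plane := by
    rw [← Module.finrank_eq_rank]
    simp
  set ψ : Plane → Plane := fun z => Homeomorph.unitBall z with hψ
  have hψc : Continuous ψ := continuous_subtype_val.comp Homeomorph.unitBall.continuous
  have hψi : Function.Injective ψ := Subtype.val_injective.comp Homeomorph.unitBall.injective
  have h1 := (hZ.preimage hψi.injOn).countable.isConnected_compl_of_one_lt_rank hrank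
  have h2 : ψ '' (ψ ⁻¹' Z)ᶜ = Metric.ball (0 : Plane) 1 \ Z := by
    ext z
    constructor
    · rintro ⟨w, hw, rfl⟩
      exact ⟨(Homeomorph.unitBall w).2, hw⟩
    · rintro ⟨hz, hzZ⟩
      obtain ⟨w, hw⟩ := Homeomorph.unitBall.surjective (⟨z, hz⟩ : Metric.ball (0 : Plane) 1)
      have hw' : ψ w = z := congrArg Subtype.val hw
      exact ⟨w, by simpa [hw'] using hzZ, hw'⟩
  rw [← h2]
  exact h1.isPreconnected.image ψ hψc.continuousOn

/-- The functions `w i`, `i < n`, are index functions of the strands `c i` in the square. -/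
structure CurveIndex (n : ℕ) (c : ℕ → ℝ → Plane) (w : ℕ → Plane → ℤ) : Prop where
  inside : ∀ i < n, ∀ u, |u| < 1 → ‖c i u‖ < 1
  ends : ∀ i < n, ∀ u, |u| = 1 → ‖c i u‖ = 1
  ends_inj : ∀ i < n, ∀ j < n, ∀ u v, |u| = 1 → |v| ≤ 1 → c i u = c j v → i = j ∧ u = v
  self_crossing : ∀ i < n, ∀ u v u' v', |u| < 1 → |v| < 1 → |u'| < 1 → |v'| < 1 → u ≠ v →
    c i u = c i v → u' ≠ v' → c i u' = c i v' → u = u' ∨ u = v'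
  index_eq : ∀ i < n, ∀ z, ‖z‖ ≤ 1 → (∀ u, |u| ≤ 1 → z ≠ c i u) → ∀ᶠ z' in 𝓝 z, w i z' = w i z
  jump : ∀ i < n, HasJump (c i) (w i)
  bottom : ∀ i < n, ∀ u, |u| ≤ 1 → c i u ≠ (0, -1)

section Disk

variable {S : Type*} [TopologicalSpace S]

/-- The preimage of the open square under the chart `e`. -/
def openDisk (e : OpenPartialHomeomorph S Plane) : Set S := e.source ∩ e ⁻¹' Metric.ball 0 1

theorem mem_openDisk {e : OpenPartialHomeomorph S Plane} {p : S} :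
    p ∈ openDisk e ↔ p ∈ e.source ∧ ‖e p‖ < 1 := by
  simp [openDisk]

theorem isOpen_openDisk (e : OpenPartialHomeomorph S Plane) : IsOpen (openDisk e) :=
  e.isOpen_inter_preimage Metric.isOpen_ball

/-- The preimage of the closed square is compact, hence closed in the Hausdorff surface, so the
closure of the open disk does not leave the chart. -/
theorem closure_openDisk_subset [T2Space S] {e : OpenPartialHomeomorph S Plane}
    (he : square ⊆ e.target) {p : S} (hp : p ∈ closure (openDisk e)) :
    p ∈ e.source ∧ ‖e p‖ ≤ 1 := by
  have hsq : IsCompact square := isCompact_Icc.prod isCompact_Icc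
  have hK : IsClosed (e.symm '' square) :=
    (hsq.image_of_continuousOn (e.continuousOn_symm.mono he)).isClosed
  have hsub : openDisk e ⊆ e.symm '' square := fun q hq =>
    ⟨e q, mem_square_iff.2 (mem_openDisk.1 hq).2.le, e.left_inv hq.1⟩
  obtain ⟨z, hz, rfl⟩ := closure_minimal hsub hK hp
  exact ⟨e.map_target (he hz), by rw [e.right_inv (he hz)]; exact mem_square_iff.1 hz⟩

theorem frontier_openDisk_subset [T2Space S] {e : OpenPartialHomeomorph S Plane}
    (he : square ⊆ e.target) {p : S} (hp : p ∈ frontier (openDisk e)) :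
    p ∈ e.source ∧ ‖e p‖ = 1 := by
  have h1 := closure_openDisk_subset he hp.1
  refine ⟨h1.1, h1.2.antisymm (not_lt.1 fun h => hp.2 ?_)⟩
  rw [(isOpen_openDisk e).interior_eq]
  exact mem_openDisk.2 ⟨h1.1, h⟩

end Disk

/-! ### Disk models from strands along plane curves. -/

section Diagrams

variable {S : Type*} [TopologicalSpace S] [ChartedSpace Plane S]

open KnotoidDiagram

/-- The diagram `D` meets the preimage of the square under the chart `e` in `n` strands, which run
along the curves `c i`. -/
structure StrandsInDisk (D : KnotoidDiagram S) (e : OpenPartialHomeomorph S Plane) (n : ℕ)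
    (a b : ℕ → unitInterval) (τ : ℕ → unitInterval → ℝ) (σ : ℕ → ℤ) (c : ℕ → ℝ → Plane) :
    Prop where
  chart : IsOrientedChart e
  square_subset : square ⊆ e.target
  bounds : ∀ i < n, 0 < a i ∧ a i < b i ∧ b i < 1
  default : ∀ i, n ≤ i → a i = 0
  disjoint : ∀ i < n, ∀ j < n, i ≠ j → Disjoint (Icc (a i) (b i)) (Icc (a j) (b j))
  sign : ∀ i < n, σ i = 1 ∨ σ i = -1
  mono : ∀ i < n, StrictMonoOn (fun t => (σ i : ℝ) * τ i t) (Icc (a i) (b i))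
  left : ∀ i < n, τ i (a i) = -σ i
  right : ∀ i < n, τ i (b i) = σ i
  continuousOn : ∀ i < n, ContinuousOn (τ i) (Icc (a i) (b i))
  strand : ∀ i < n, ∀ t ∈ Icc (a i) (b i), D.curve t ∈ e.source ∧ e (D.curve t) = c i (τ i t)
  outside : ∀ t, (∀ i < n, t ∉ Icc (a i) (b i)) → ¬ (D.curve t ∈ e.source ∧ ‖e (D.curve t)‖ ≤ 1)
  under : ∀ i < n, ∀ j < n, i ≠ j → ∀ s ∈ Icc (a i) (b i), ∀ t ∈ Icc (a j) (b j),
    D.curve s = D.curve t → (s ∈ D.under ↔ j < i)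

namespace StrandsInDisk

variable {D : KnotoidDiagram S} {e : OpenPartialHomeomorph S Plane} {n : ℕ}
  {a b : ℕ → unitInterval} {τ : ℕ → unitInterval → ℝ} {σ : ℕ → ℤ} {c : ℕ → ℝ → Plane}
  {w : ℕ → Plane → ℤ}

theorem injOn (H : StrandsInDisk D e n a b τ σ c) {i : ℕ} (hi : i < n) :
    InjOn (τ i) (Icc (a i) (b i)) := fun s hs t ht hst =>
  (H.mono i hi).injOn hs ht (by simp only [hst])

theorem abs_lt_one (H : StrandsInDisk D e n a b τ σ c) {i : ℕ} (hi : i < n) {t : unitInterval}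
    (ht : t ∈ Ioo (a i) (b i)) : |τ i t| < 1 := by
  have hab := (H.bounds i hi).2.1.le
  have h1 := H.mono i hi (left_mem_Icc.2 hab) (Ioo_subset_Icc_self ht) ht.1
  have h2 := H.mono i hi (Ioo_subset_Icc_self ht) (right_mem_Icc.2 hab) ht.2
  simp only [H.left i hi, H.right i hi] at h1 h2
  rw [abs_lt]
  rcases H.sign i hi with h | h <;> rw [h] at h1 h2 <;> push_cast at h1 h2 <;>
    constructor <;> linarith

theorem abs_left (H : StrandsInDisk D e n a b τ σ c) {i : ℕ} (hi : i < n) : |τ i (a i)| = 1 := by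
  rw [H.left i hi]
  rcases H.sign i hi with h | h <;> rw [h] <;> norm_num

theorem abs_right (H : StrandsInDisk D e n a b τ σ c) {i : ℕ} (hi : i < n) : |τ i (b i)| = 1 := by
  rw [H.right i hi]
  rcases H.sign i hi with h | h <;> rw [h] <;> norm_num

theorem abs_le_one (H : StrandsInDisk D e n a b τ σ c) {i : ℕ} (hi : i < n) {t : unitInterval}
    (ht : t ∈ Icc (a i) (b i)) : |τ i t| ≤ 1 := by
  rcases eq_or_ne t (a i) with rfl | h1
  · exact (H.abs_left hi).le
  rcases eq_or_ne t (b i) with rfl | h2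
  · exact (H.abs_right hi).le
  · exact (H.abs_lt_one hi ⟨lt_of_le_of_ne ht.1 h1.symm, lt_of_le_of_ne ht.2 h2⟩).le

theorem exists_mem_Icc (H : StrandsInDisk D e n a b τ σ c) {t : unitInterval}
    (h : D.curve t ∈ e.source) (h1 : ‖e (D.curve t)‖ ≤ 1) : ∃ i < n, t ∈ Icc (a i) (b i) := by
  by_contra hcon
  push Not at hcon
  exact H.outside t hcon ⟨h, h1⟩

/-- The ends of strands lie on the boundary of the square, where no two strands meet; so they are
not double points. -/
theorem end_eq (H : StrandsInDisk D e n a b τ σ c) (C : CurveIndex n c w) {i : ℕ} (hi : i < n)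
    {t : unitInterval} (ht : t ∈ Icc (a i) (b i)) (h1 : |τ i t| = 1) (s : unitInterval)
    (hs : D.curve s = D.curve t) : s = t := by
  obtain ⟨h2, h3⟩ := H.strand i hi t ht
  obtain ⟨j, hj, hsj⟩ := H.exists_mem_Icc (hs ▸ h2) (by rw [hs, h3, C.ends i hi _ h1])
  have h4 := (H.strand j hj s hsj).2
  rw [hs, h3] at h4
  obtain ⟨rfl, h5⟩ := C.ends_inj i hi j hj _ _ h1 (H.abs_le_one hj hsj) h4
  exact (H.injOn hi ht hsj h5).symm

theorem mem_openDisk_iff (H : StrandsInDisk D e n a b τ σ c) (C : CurveIndex n c w)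
    (t : unitInterval) : D.curve t ∈ openDisk e ↔ ∃ i < n, t ∈ Ioo (a i) (b i) := by
  rw [mem_openDisk]
  constructor
  · rintro ⟨h1, h2⟩
    obtain ⟨i, hi, ht⟩ := H.exists_mem_Icc h1 h2.le
    have h3 : |τ i t| ≠ 1 := by
      intro h3
      rw [(H.strand i hi t ht).2, C.ends i hi _ h3] at h2
      exact lt_irrefl _ h2
    refine ⟨i, hi, lt_of_le_of_ne ht.1 ?_, lt_of_le_of_ne ht.2 ?_⟩
    · rintro rfl
      exact h3 (H.abs_left hi)
    · rintro rfl
      exact h3 (H.abs_right hi)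
  · rintro ⟨i, hi, ht⟩
    obtain ⟨h1, h2⟩ := H.strand i hi t (Ioo_subset_Icc_self ht)
    exact ⟨h1, h2 ▸ C.inside i hi _ (H.abs_lt_one hi ht)⟩

theorem isPreconnected_diff (H : StrandsInDisk D e n a b τ σ c) {Z : Set S} (hZ : Z.Finite) :
    IsPreconnected (openDisk e \ Z) := by
  have h2 : openDisk e \ Z ⊆ e.symm '' (Metric.ball (0 : Plane) 1 \ (e '' (Z ∩ e.source))) := by
    rintro p ⟨hp, hpZ⟩
    refine ⟨e p, ⟨hp.2, ?_⟩, e.left_inv hp.1⟩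
    rintro ⟨q, ⟨hqZ, hqs⟩, hq⟩
    exact hpZ (e.injOn hqs hp.1 hq ▸ hqZ)
  have h3 : e.symm '' (Metric.ball (0 : Plane) 1 \ (e '' (Z ∩ e.source))) ⊆ openDisk e \ Z := by
    rintro _ ⟨z, ⟨hz, hzZ⟩, rfl⟩
    have hzt : z ∈ e.target := H.square_subset
      (mem_square_iff.2 (by simpa using (Metric.mem_ball.1 hz).le))
    refine ⟨mem_openDisk.2 ⟨e.map_target hzt, by rw [e.right_inv hzt]; simpa using hz⟩, fun h => ?_⟩
    exact hzZ ⟨_, ⟨h, e.map_target hzt⟩, e.right_inv hzt⟩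
  rw [h2.antisymm h3]
  refine (isPreconnected_ball_diff ((hZ.inter_of_left _).image _)).image _
    (e.continuousOn_symm.mono fun z hz => H.square_subset (mem_square_iff.2 ?_))
  simpa using (Metric.mem_ball.1 hz.1).le

theorem eventually_index_eq [T2Space S] (H : StrandsInDisk D e n a b τ σ c) (C : CurveIndex n c w)
    {i : ℕ} (hi : i < n) {p : S} (hp : p ∈ closure (openDisk e))
    (hpi : p ∉ D.curve '' Icc (a i) (b i)) :
    ∀ᶠ q in 𝓝 p, σ i * w i (e q) = σ i * w i (e p) := by
  obtain ⟨hps, hp1⟩ := closure_openDisk_subset H.square_subset hp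
  have h1 : ∀ u, |u| ≤ 1 → e p ≠ c i u := by
    intro u hu hpu
    have hab := (H.bounds i hi).2.1.le
    have hIcc : (Icc (a i) (b i)).OrdConnected := ordConnected_Icc
    have himg := (isPreconnected_of_ordConnected hIcc).image (τ i) (H.continuousOn i hi)
    have hl := mem_image_of_mem (τ i) (left_mem_Icc.2 hab)
    have hr := mem_image_of_mem (τ i) (right_mem_Icc.2 hab)
    rw [H.left i hi] at hl
    rw [H.right i hi] at hr
    have hu' := abs_le.1 hu
    -- By the intermediate value theorem `τ i` takes all values between `-σ i` and `σ i`, so the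
    -- strand traces the whole curve `c i`.
    have hmem : u ∈ τ i '' Icc (a i) (b i) := by
      rcases H.sign i hi with h | h <;> rw [h] at hl hr <;> push_cast at hl hr
      · exact himg.ordConnected.out hl hr hu'
      · exact himg.ordConnected.out hr hl (by simpa using hu')
    obtain ⟨t, ht, rfl⟩ := hmem
    obtain ⟨h2, h3⟩ := H.strand i hi t ht
    exact hpi ⟨t, ht, e.injOn h2 hps (h3.trans hpu.symm)⟩
  filter_upwards [(e.continuousAt hps).eventually (C.index_eq i hi (e p) hp1 h1)] with q hq
  rw [hq]

/-- By `exists_sides` the index has one value on each half-disk, so it suffices to compute the jump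
at one point of the axis, which `HasJump` supplies. The factor `σ i` corrects for a strand that runs
against its plane curve. -/
theorem eventually_index_jump [HasGroupoid S orientedGroupoid] [T2Space S]
    (H : StrandsInDisk D e n a b τ σ c) (C : CurveIndex n c w)
    {i : ℕ} (hi : i < n) {t : unitInterval} (ht : t ∈ Ioo (a i) (b i))
    (hinj : ∀ s ∈ Icc (a i) (b i), D.curve s = D.curve t → s = t)
    {e' : OpenPartialHomeomorph S Plane} (he' : IsOrientedChart e')
    (het' : StraightAt D.curve e' t (1, 0)) :
    ∀ᶠ y in 𝓝[>] (0 : ℝ), σ i * w i (e (e'.symm (0, y)))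
      = σ i * w i (e (e'.symm (0, -y))) + 1 := by
  obtain ⟨hts, -⟩ := H.strand i hi t (Ioo_subset_Icc_self ht)
  have htU : D.curve t ∈ openDisk e := (H.mem_openDisk_iff C t).2 ⟨i, hi, ht⟩
  obtain ⟨v₁, v₂, hv⟩ := het'.exists_sides isClosed_Icc hinj (φ := fun q => σ i * w i (e q)) (by
    filter_upwards [(isOpen_openDisk e).mem_nhds htU] with q hq hq2
    exact H.eventually_index_eq C hi (subset_closure hq) hq2)
  have hsuff : v₁ = v₂ + 1 := by
    have hor : ∀ᶠ z in 𝓝 (0 : Plane), OrientedAt (e ∘ e'.symm) z := by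
      filter_upwards [e'.open_target.mem_nhds het'.zero_mem,
        het'.tendsto.eventually (e.open_source.mem_nhds hts)] with z hz hz2
      exact OrientedAt.transition he' H.chart hz hz2
    obtain ⟨r₁, hr₁, hball⟩ := Metric.eventually_nhds_iff_ball.1 (hv.and hor)
    obtain ⟨r₂, hr₂, hcur⟩ := Metric.eventually_nhds_iff_ball.1
      (het'.eventually_curve_eq.and (Ioo_mem_nhds ht.1 ht.2))
    have ht0 : (0 : ℝ) < t := (H.bounds i hi).1.trans ht.1
    have ht1 : (t : ℝ) < 1 := ht.2.trans (H.bounds i hi).2.2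
    obtain ⟨δ, hδ, hδ1⟩ := exists_between
      (lt_min (lt_min hr₁ hr₂) (lt_min ht0 (sub_pos.2 ht1)))
    simp only [lt_min_iff] at hδ1
    obtain ⟨⟨hδr₁, hδr₂⟩, hδt, hδt1⟩ := hδ1
    have hmem : ∀ x ∈ Ioo (-δ) δ, (t : ℝ) + x ∈ Icc (0 : ℝ) 1 := fun x hx =>
      ⟨by linarith [hx.1], by linarith [hx.2]⟩
    -- The projection only serves to make `t + x` a parameter; for `|x| < δ` it changes nothing.
    set pt : ℝ → unitInterval := fun x => projIcc 0 1 zero_le_one ((t : ℝ) + x)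
    have hpt : ∀ x ∈ Ioo (-δ) δ, ((pt x : unitInterval) : ℝ) = t + x := fun x hx => by
      simp only [pt, projIcc_of_mem zero_le_one (hmem x hx)]
    have hptb : ∀ x ∈ Ioo (-δ) δ, pt x ∈ Metric.ball t r₂ := fun x hx => by
      rw [Metric.mem_ball, Subtype.dist_eq, hpt x hx, Real.dist_eq, add_sub_cancel_left, abs_lt]
      exact ⟨by linarith [hx.1], by linarith [hx.2]⟩
    have hzb : ∀ x ∈ Ioo (-δ) δ, ((x, 0) : Plane) ∈ Metric.ball (0 : Plane) r₁ := fun x hx => by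
      have : |x| < r₁ := abs_lt.2 ⟨by linarith [hx.1], by linarith [hx.2]⟩
      rw [mem_ball_zero_iff, Prod.norm_def, max_lt_iff, Real.norm_eq_abs, norm_zero]
      exact ⟨this, hr₁⟩
    obtain ⟨x₀, hx₀, hjump⟩ := C.jump i hi (e ∘ e'.symm) (fun x => τ i (pt x)) (σ i) δ hδ
      (H.sign i hi)
      (fun x hx y hy hxy => H.mono i hi (Ioo_subset_Icc_self (hcur _ (hptb x hx)).2)
        (Ioo_subset_Icc_self (hcur _ (hptb y hy)).2)
        (show ((pt x : unitInterval) : ℝ) < pt y by rw [hpt x hx, hpt y hy]; linarith))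
      (fun x hx => H.abs_lt_one hi (hcur _ (hptb x hx)).2)
      (fun x hx => (hball _ (hzb x hx)).2)
      (fun x hx => by
        have h1 := (hcur _ (hptb x hx)).1
        rw [hpt x hx, add_sub_cancel_left] at h1
        have h2 : (x • ((1, 0) : Plane)) = (x, 0) := by ext <;> simp
        rw [h2] at h1
        rw [Function.comp_apply, ← h1]
        exact (H.strand i hi _ (Ioo_subset_Icc_self (hcur _ (hptb x hx)).2)).2)
    have hlim : ∀ ε : ℝ, ∀ᶠ y in 𝓝[>] (0 : ℝ), ((x₀, ε * y) : Plane) ∈ Metric.ball (0 : Plane) r₁ := by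
      intro ε
      have h1 : Continuous (fun y : ℝ => ((x₀, ε * y) : Plane)) := by fun_prop
      have h2 := h1.tendsto 0
      simp only [mul_zero] at h2
      exact (h2.mono_left nhdsWithin_le_nhds) (Metric.isOpen_ball.mem_nhds (hzb x₀ hx₀))
    have hup := hlim 1
    have hdn := hlim (-1)
    simp only [one_mul, neg_one_mul] at hup hdn
    obtain ⟨y, hy1, hy2, hy3, hy4⟩ := (hjump.and (hup.and (hdn.and
      (self_mem_nhdsWithin (a := (0 : ℝ)) (s := Ioi 0))))).exists
    have hy4 : 0 < y := hy4
    have h1 := (hball _ hy2).1.1 hy4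
    have h2 := (hball _ hy3).1.2 (neg_lt_zero.2 hy4)
    rw [← h1, ← h2]
    simp only [Function.comp_apply] at hy1
    rw [hy1]
    rcases H.sign i hi with h | h <;> rw [h] <;> ring
  have hup := (tendsto_vertical (σ := 1)).eventually hv
  have hdn := (tendsto_vertical (σ := -1)).eventually hv
  simp only [one_mul, neg_one_mul] at hup hdn
  filter_upwards [hup, hdn, self_mem_nhdsWithin] with y hy1 hy2 (hy0 : 0 < y)
  rw [hy1.1 hy0, hy2.2 (neg_lt_zero.2 hy0), hsuff]

theorem diskModel [HasGroupoid S orientedGroupoid] [T2Space S]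
    (H : StrandsInDisk D e n a b τ σ c) (C : CurveIndex n c w) :
    DiskModel D (openDisk e) n a b (fun i p => σ i * w i (e p)) where
  isOpen := isOpen_openDisk e
  isPreconnected _ hZ := H.isPreconnected_diff hZ
  lt i hi := (H.bounds i hi).2.1
  disjoint := H.disjoint
  left_end i s hs := by
    by_cases hi : i < n
    · exact H.end_eq C hi (left_mem_Icc.2 (H.bounds i hi).2.1.le) (H.abs_left hi) s hs
    · rw [H.default i (not_lt.1 hi)] at hs ⊢
      exact (D.endpoints s).1 hs
  right_end i hi := H.end_eq C hi (right_mem_Icc.2 (H.bounds i hi).2.1.le) (H.abs_right hi)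
  left_notMem i := by
    rw [H.mem_openDisk_iff C]
    rintro ⟨j, hj, hij⟩
    by_cases hi : i < n
    · by_cases h : i = j
      · subst h
        exact lt_irrefl _ hij.1
      · exact disjoint_left.1 (H.disjoint i hi j hj h) (left_mem_Icc.2 (H.bounds i hi).2.1.le)
          (Ioo_subset_Icc_self hij)
    · rw [H.default i (not_lt.1 hi)] at hij
      exact hij.1.not_ge unitInterval.nonneg'
  mem_iff := H.mem_openDisk_iff C
  under_iff i hi j hj hij s hs t ht :=
    H.under i hi j hj hij s (Ioo_subset_Icc_self hs) t (Ioo_subset_Icc_self ht)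
  self_crossing i hi s hs t ht s' hs' t' ht' hst h hst' h' htu htu' := by
    have key : ∀ {s t}, s ∈ Ioo (a i) (b i) → t ∈ Ioo (a i) (b i) → D.curve s = D.curve t →
        c i (τ i s) = c i (τ i t) := by
      intro s t hs ht h
      rw [← (H.strand i hi s (Ioo_subset_Icc_self hs)).2,
        ← (H.strand i hi t (Ioo_subset_Icc_self ht)).2, h]
    have hne : ∀ {s t}, s ∈ Ioo (a i) (b i) → t ∈ Ioo (a i) (b i) → τ i s = τ i t → s = t :=
      fun hs ht h => H.injOn hi (Ioo_subset_Icc_self hs) (Ioo_subset_Icc_self ht) h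
    rcases C.self_crossing i hi (τ i t) (τ i s) (τ i t') (τ i s') (H.abs_lt_one hi ht)
      (H.abs_lt_one hi hs) (H.abs_lt_one hi ht') (H.abs_lt_one hi hs')
      (fun h => hst (hne ht hs h).symm) (key ht hs h.symm) (fun h => hst' (hne ht' hs' h).symm)
      (key ht' hs' h'.symm) with h1 | h1
    · exact hne ht ht' h1
    -- If instead `t = s'`, then `t` would be an under-passage and also the over-passage that
    -- belongs to `t'`.
    · obtain rfl := hne ht hs' h1
      exact absurd htu (notMem_under_of_curve_eq htu' hst' h')
  index_eq _ hi _ hp hpi := H.eventually_index_eq C hi hp hpi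
  index_jump _ hi _ ht hinj _ he' het' := H.eventually_index_jump C hi ht hinj he' het'

theorem agreeOutside [HasGroupoid S orientedGroupoid] [T2Space S] {D' : KnotoidDiagram S}
    {c' : ℕ → ℝ → Plane} {w' : ℕ → Plane → ℤ} (H : StrandsInDisk D e n a b τ σ c)
    (H' : StrandsInDisk D' e n a b τ σ c') (C : CurveIndex n c w) (C' : CurveIndex n c' w')
    (hc : ∀ i < n, ∀ u, 3 / 4 ≤ |u| → c' i u = c i u)
    (hw : ∀ i < n, ∀ z, ‖z‖ = 1 → ∀ᶠ z' in 𝓝 z, w' i z' = w i z')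
    (hout : ∀ t, (∀ i < n, t ∉ Icc (a i) (b i)) → D'.curve t = D.curve t ∧
      (t ∈ D'.under ↔ t ∈ D.under)) :
    AgreeOutside D D' (openDisk e) n a b (fun i p => σ i * w i (e p))
      fun i p => σ i * w' i (e p) where
  curve_eq t ht := by
    -- If `t` lies in a strand interval it is an end of it, where `|τ i t| = 1`; so nearby
    -- parameters are in the collar in which the two plane curves coincide.
    have h1 : ∀ᶠ v in 𝓝 t, ∀ i ∈ Finset.range n, v ∈ Icc (a i) (b i) → 3 / 4 ≤ |τ i v| := by
      refine (Finset.eventually_all _).2 fun i hi => ?_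
      have hi := Finset.mem_range.1 hi
      by_cases hti : t ∈ Icc (a i) (b i)
      · have habs : |τ i t| = 1 := by
          rcases eq_or_ne t (a i) with rfl | h1
          · exact H.abs_left hi
          rcases eq_or_ne t (b i) with rfl | h2
          · exact H.abs_right hi
          · exact absurd ⟨lt_of_le_of_ne hti.1 h1.symm, lt_of_le_of_ne hti.2 h2⟩ (ht i hi)
        have h2 := ((H.continuousOn i hi) t hti).abs.eventually (lt_mem_nhds
          (show (3 / 4 : ℝ) < |τ i t| by rw [habs]; norm_num))
        rw [eventually_nhdsWithin_iff] at h2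
        exact h2.mono fun v hv hvi => (hv hvi).le
      · filter_upwards [isClosed_Icc.isOpen_compl.mem_nhds hti] with v hv hvi
        exact absurd hvi hv
    filter_upwards [h1] with v hv
    by_cases hvo : ∀ i < n, v ∉ Icc (a i) (b i)
    · exact (hout v hvo).1
    · push Not at hvo
      obtain ⟨i, hi, hvi⟩ := hvo
      obtain ⟨h2, h3⟩ := H.strand i hi v hvi
      obtain ⟨h4, h5⟩ := H'.strand i hi v hvi
      rw [hc i hi _ (hv i (Finset.mem_range.2 hi) hvi), ← h3] at h5
      exact e.injOn h4 h2 h5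
  under_iff t ht := by
    by_cases hto : ∀ i < n, t ∉ Icc (a i) (b i)
    · exact (hout t hto).2
    · push Not at hto
      obtain ⟨i, hi, hti⟩ := hto
      have habs : |τ i t| = 1 := by
        rcases eq_or_ne t (a i) with rfl | h1
        · exact H.abs_left hi
        rcases eq_or_ne t (b i) with rfl | h2
        · exact H.abs_right hi
        · exact absurd ⟨lt_of_le_of_ne hti.1 h1.symm, lt_of_le_of_ne hti.2 h2⟩ (ht i hi)
      exact iff_of_false (notMem_under_of_forall (H'.end_eq C' hi hti habs))
        (notMem_under_of_forall (H.end_eq C hi hti habs))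
  index_eq i hi p hp := by
    obtain ⟨h1, h2⟩ := frontier_openDisk_subset H.square_subset hp
    filter_upwards [(e.continuousAt h1).eventually (hw i hi _ h2)] with q hq
    rw [hq]

/-- The base point for the region colors is the midpoint `(0, -1)` of the lower edge of the square,
which the strands avoid by `CurveIndex.bottom`. -/
theorem nonempty_equiv [HasGroupoid S orientedGroupoid] [T2Space S] {D' : KnotoidDiagram S}
    {c' : ℕ → ℝ → Plane} {w' : ℕ → Plane → ℤ} (H : StrandsInDisk D e n a b τ σ c)
    (H' : StrandsInDisk D' e n a b τ σ c') (C : CurveIndex n c w) (C' : CurveIndex n c' w')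
    (hc : ∀ i < n, ∀ u, 3 / 4 ≤ |u| → c' i u = c i u)
    (hw : ∀ i < n, ∀ z, ‖z‖ = 1 → ∀ᶠ z' in 𝓝 z, w' i z' = w i z')
    (hout : ∀ t, (∀ i < n, t ∉ Icc (a i) (b i)) → D'.curve t = D.curve t ∧
      (t ∈ D'.under ↔ t ∈ D.under))
    (X Y : Type*) [Quandle X] [QuandleSet X Y] :
    Nonempty (Coloring X Y D ≃ Coloring X Y D') := by
  have hnorm : ‖((0, -1) : Plane)‖ = 1 := by simp [Prod.norm_def]
  have htgt : ((0, -1) : Plane) ∈ e.target := H.square_subset (mem_square_iff.2 hnorm.le)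
  refine (H.diskModel C).nonempty_equiv (H'.diskModel C') (H.agreeOutside H' C C' hc hw hout)
    (p₀ := e.symm (0, -1)) ?_ ?_ ?_
  · have h1 : Tendsto (fun y : ℝ => e.symm (0, y)) (𝓝[>] (-1)) (𝓝 (e.symm (0, -1))) := by
      have h2 : Continuous (fun y : ℝ => ((0, y) : Plane)) := by fun_prop
      exact (e.continuousAt_symm htgt).tendsto.comp ((h2.tendsto (-1)).mono_left nhdsWithin_le_nhds)
    refine mem_closure_of_tendsto h1 ?_
    filter_upwards [Ioo_mem_nhdsGT (show (-1 : ℝ) < 1 by norm_num)] with y hy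
    have hy1 : ‖((0, y) : Plane)‖ < 1 := by
      simpa [Prod.norm_def] using abs_lt.2 hy
    have hyt : ((0, y) : Plane) ∈ e.target := H.square_subset (mem_square_iff.2 hy1.le)
    exact mem_openDisk.2 ⟨e.map_target hyt, by rwa [e.right_inv hyt]⟩
  · rw [mem_openDisk, e.right_inv htgt, hnorm]
    exact fun h => lt_irrefl _ h.2
  · rintro ⟨t, ht⟩
    have hs : D.curve t ∈ e.source := ht ▸ e.map_target htgt
    have hv : e (D.curve t) = (0, -1) := by rw [ht, e.right_inv htgt]
    obtain ⟨i, hi, hti⟩ := H.exists_mem_Icc hs (by rw [hv, hnorm])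
    exact C.bottom i hi _ (H.abs_le_one hi hti) ((H.strand i hi t hti).2 ▸ hv)

end StrandsInDisk

end Diagrams

/-! ### Index functions of the curves in the Reidemeister moves -/

/-- A continuous map on a compact set is closed onto its image, hence a quotient map. In this way
the continuity of the plane curves is deduced from that of the diagrams. -/
theorem continuousOn_image_of_comp {A B C : Type*} [TopologicalSpace A] [TopologicalSpace B]
    [TopologicalSpace C] [T2Space A] [T2Space B] {J : Set A} (hJ : IsCompact J) {τ : A → B}
    (hτ : ContinuousOn τ J) {h : B → C} (hh : ContinuousOn (h ∘ τ) J) :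
    ContinuousOn h (τ '' J) := by
  rw [continuousOn_iff_isClosed]
  intro t ht
  have h1 : IsClosed (J ∩ h ∘ τ ⁻¹' t) := hh.preimage_isClosed_of_isClosed hJ.isClosed ht
  refine ⟨τ '' (J ∩ h ∘ τ ⁻¹' t), ((hJ.of_isClosed_subset h1 inter_subset_left).image_of_continuousOn
    (hτ.mono inter_subset_left)).isClosed, ?_⟩
  ext x
  constructor
  · rintro ⟨hx, y, hy, rfl⟩
    exact ⟨⟨y, ⟨hy, hx⟩, rfl⟩, y, hy, rfl⟩
  · rintro ⟨⟨y, ⟨hy, hx⟩, rfl⟩, h2⟩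
    exact ⟨hx, h2⟩

theorem curveIndex_graph {n : ℕ} {f : ℕ → ℝ → ℝ} {c : ℕ → ℝ → Plane}
    (hc : ∀ i < n, ∀ u, |u| ≤ 1 → c i u = (u, f i u)) (hf : ∀ i < n, Continuous (f i))
    (hlt : ∀ i < n, ∀ u, |u| ≤ 1 → |f i u| < 1)
    (hends : ∀ i < n, ∀ j < n, ∀ u, |u| = 1 → f i u = f j u → i = j) :
    CurveIndex n c (fun i => graphIndex (f i)) where
  inside i hi u hu := by
    rw [hc i hi u hu.le, Prod.norm_def]
    exact max_lt hu (hlt i hi u hu.le)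
  ends i hi u hu := by
    rw [hc i hi u hu.le, Prod.norm_def]
    exact (max_eq_left ((hlt i hi u hu.le).le.trans hu.ge)).trans hu
  ends_inj i hi j hj u v hu hv h := by
    rw [hc i hi u hu.le, hc j hj v hv, Prod.mk.injEq] at h
    obtain ⟨rfl, h⟩ := h
    exact ⟨hends i hi j hj u hu h, rfl⟩
  self_crossing i hi u v _ _ hu hv _ _ huv h := by
    rw [hc i hi u hu.le, hc i hi v hv.le, Prod.mk.injEq] at h
    exact absurd h.1 huv
  index_eq i hi z hz h := by
    refine eventually_graphIndex_eq (hf i hi) fun hz2 => ?_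
    have h1 : |z.1| ≤ 1 := (norm_fst_le z).trans hz
    exact h _ h1 (by rw [hc i hi _ h1, ← hz2])
  jump i hi := hasJump_graphIndex (hc i hi)
  bottom i hi u hu h := by
    rw [hc i hi u hu, Prod.mk.injEq] at h
    have := hlt i hi u hu
    rw [h.2] at this
    norm_num at this

/-- Near the vertical edges of the square the two functions are equal. On the horizontal edges both
graphs are at a distance, and both indices are 1 on the upper and 0 on the lower edge. -/
theorem eventually_graphIndex_eq_of_norm_eq_one {f g : ℝ → ℝ} (hf : Continuous f)
    (hg : Continuous g) (hf1 : ∀ u, |f u| < 1) (hg1 : ∀ u, |g u| < 1)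
    (hfg : ∀ u, 3 / 4 ≤ |u| → g u = f u) {z : Plane} (hz : ‖z‖ = 1) :
    ∀ᶠ z' in 𝓝 z, graphIndex g z' = graphIndex f z' := by
  rw [Prod.norm_def, Real.norm_eq_abs, Real.norm_eq_abs] at hz
  rcases max_choice |z.1| |z.2| with h | h <;> rw [h] at hz
  · have h1 : Continuous fun z : Plane => |z.1| := continuous_fst.abs
    filter_upwards [continuousAt_const.eventually_lt h1.continuousAt
      (by rw [hz]; norm_num : (3 / 4 : ℝ) < |z.1|)] with z' hz'
    rw [graphIndex, graphIndex, hfg _ hz'.le]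
  · have hne : ∀ v : ℝ, |v| < 1 → z.2 ≠ v := by
      rintro v hv rfl
      exact hv.ne hz
    filter_upwards [eventually_graphIndex_eq hf (hne _ (hf1 _)),
      eventually_graphIndex_eq hg (hne _ (hg1 _))] with z' h1 h2
    rw [h1, h2, graphIndex, graphIndex]
    have h3 := abs_lt.1 (hf1 z.1)
    have h4 := abs_lt.1 (hg1 z.1)
    rcases (abs_eq zero_le_one).1 hz with h | h <;> rw [h]
    · rw [if_pos h3.2, if_pos h4.2]
    · rw [if_neg h3.1.not_gt, if_neg h4.1.not_gt]

/-- The square root of a negative number is 0 by convention, so the width vanishes here; `≤` in one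
indicator and `<` in the other make exactly one of them equal to 1, also on the line `x = 0`. -/
theorem loopIndex_of_pos {k : ℝ → ℝ} {z : Plane} (hz : 0 < z.2) : loopIndex k z = 1 := by
  have h : loopWidth k z.2 = 0 := by
    rw [loopWidth, Real.sqrt_eq_zero_of_nonpos (by linarith), zero_mul]
  rw [loopIndex, h, neg_zero]
  rcases le_or_gt 0 z.1 with h1 | h1
  · rw [if_pos h1, if_neg h1.not_gt]; rfl
  · rw [if_neg h1.not_ge, if_pos h1]; rfl

theorem curveIndex_loop {k : ℝ → ℝ} (hk : ∀ u, k (-u) = k u) (hk1 : ∀ u, 3 / 4 ≤ |u| → k u = 1)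
    (hlt : ∀ u, |u| < 1 → |u * k u| < 1) (hk0 : ∀ u, |u| < 1 → k u = 0 → |u| = 1 / 2)
    (hcont : Continuous (loopWidth k)) :
    CurveIndex 1 (fun _ u => (u * k u, -u ^ 2 / 2)) (fun _ => loopIndex k) where
  inside _ _ u hu := by
    rw [Prod.norm_def]
    refine max_lt (hlt u hu) ?_
    rw [Real.norm_eq_abs, abs_lt]
    have := (sq_lt_one_iff_abs_lt_one u).2 hu
    constructor <;> nlinarith [sq_nonneg u]
  ends _ _ u hu := by
    have h : u ^ 2 = 1 := by rw [← sq_abs, hu, one_pow]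
    rw [Prod.norm_def, h, hk1 u (by rw [hu]; norm_num), mul_one, Real.norm_eq_abs, hu]
    norm_num
  ends_inj i hi j hj u v hu _ h := by
    rw [Prod.mk.injEq] at h
    have h2 : u ^ 2 = v ^ 2 := by linarith [h.2]
    have hv : |v| = 1 := by rw [← hu]; exact ((sq_eq_sq_iff_abs_eq_abs u v).1 h2).symm
    refine ⟨by omega, ?_⟩
    have h1 := h.1
    rwa [hk1 u (by rw [hu]; norm_num), hk1 v (by rw [hv]; norm_num), mul_one, mul_one] at h1
  self_crossing _ _ u v u' v' hu _ hu' _ huv h huv' h' := by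
    have key : ∀ {u v : ℝ}, |u| < 1 → u ≠ v →
        ((u * k u, -u ^ 2 / 2) : Plane) = (v * k v, -v ^ 2 / 2) → v = -u ∧ |u| = 1 / 2 := by
      intro u v hu huv h
      rw [Prod.mk.injEq] at h
      have h2 : u ^ 2 = v ^ 2 := by linarith [h.2]
      have h3 : v = -u := by
        rcases sq_eq_sq_iff_eq_or_eq_neg.1 h2 with h | h
        · exact absurd h huv
        · rw [h, neg_neg]
      refine ⟨h3, hk0 u hu ?_⟩
      have h1 := h.1
      rw [h3, hk] at h1
      have h4 : u * k u = 0 := by linarith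
      refine (mul_eq_zero.1 h4).resolve_left ?_
      rintro rfl
      exact huv (by rw [h3, neg_zero])
    obtain ⟨-, h1⟩ := key hu huv h
    obtain ⟨rfl, h2⟩ := key hu' huv' h'
    exact abs_eq_abs.1 (h1.trans h2.symm)
  index_eq _ _ z hz h := by
    rcases lt_or_ge 0 z.2 with hy | hy
    · filter_upwards [continuousAt_const.eventually_lt continuous_snd.continuousAt hy] with z' hz'
      rw [loopIndex_of_pos hz', loopIndex_of_pos hy]
    · set s := √(-2 * z.2) with hs
      have hs0 : 0 ≤ s := Real.sqrt_nonneg _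
      have hss : -s ^ 2 / 2 = z.2 := by
        rw [hs, Real.sq_sqrt (by linarith)]
        ring
      have hw : loopWidth k z.2 = s * k s := rfl
      have h1 : |z.1| ≤ 1 := (norm_fst_le z).trans hz
      have habs : |s| = s := abs_of_nonneg hs0
      rcases le_or_gt s 1 with hs1 | hs1
      · refine eventually_loopIndex_eq hcont ?_ ?_ <;> rw [hw] <;> intro hz1
        · exact h s (by rwa [habs]) (Prod.ext hz1 hss.symm)
        · refine h (-s) (by rwa [abs_neg, habs]) (Prod.ext ?_ ?_)
          · rw [hz1, hk]
            ring
          · rw [← hss]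
            ring
      -- At heights below the ends of the curve the width is `s > 1`, so both branches are outside
      -- the square.
      · rw [hk1 s (by rw [habs]; linarith), mul_one] at hw
        have h2 := abs_le.1 h1
        refine eventually_loopIndex_eq hcont ?_ ?_ <;> rw [hw] <;> intro hz1 <;> linarith
  jump _ _ := hasJump_loopIndex hk hk0 hcont
  bottom _ _ u hu h := by
    rw [Prod.mk.injEq] at h
    have := (sq_le_one_iff_abs_le_one u).2 hu
    linarith [h.2]

theorem abs_loopWidth_lt_one {k : ℝ → ℝ} (hlt : ∀ u, |u| < 1 → |u * k u| < 1) {y : ℝ}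
    (hy : √(-2 * y) < 1) : |loopWidth k y| < 1 :=
  hlt _ (by rwa [abs_of_nonneg (Real.sqrt_nonneg _)])

theorem loopIndex_of_abs_lt_one {k : ℝ → ℝ} {z : Plane} (hz : |z.1| = 1)
    (hw : |loopWidth k z.2| < 1) : loopIndex k z = 1 := by
  have h := abs_lt.1 hw
  rw [loopIndex]
  rcases (abs_eq zero_le_one).1 hz with h1 | h1 <;> rw [h1]
  · rw [if_pos h.2.le, if_neg (by linarith)]; rfl
  · rw [if_neg (by linarith), if_pos (by linarith)]; rfl

/-- At low heights the widths agree, and at positive heights both indices are 1. At the remaining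
boundary points the height is too close to 0 for the lower edge, so `|x| = 1`, beyond both widths,
and again both indices are 1. -/
theorem eventually_loopIndex_eq_of_norm_eq_one {k l : ℝ → ℝ} (hk : Continuous (loopWidth k))
    (hl : Continuous (loopWidth l)) (hk1 : ∀ u, |u| < 1 → |u * k u| < 1)
    (hl1 : ∀ u, |u| < 1 → |u * l u| < 1) (hkl : ∀ u, 3 / 4 ≤ |u| → l u = k u) {z : Plane}
    (hz : ‖z‖ = 1) : ∀ᶠ z' in 𝓝 z, loopIndex l z' = loopIndex k z' := by
  have hsc : Continuous fun z : Plane => √(-2 * z.2) := by fun_prop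
  rcases lt_or_ge (3 / 4) √(-2 * z.2) with hs | hs
  · filter_upwards [continuousAt_const.eventually_lt hsc.continuousAt hs] with z' hz'
    have h : loopWidth l z'.2 = loopWidth k z'.2 := by
      rw [loopWidth, loopWidth, hkl _ (hz'.le.trans (le_abs_self _))]
    simp only [loopIndex, h]
  rcases lt_or_ge 0 z.2 with hy | hy
  · filter_upwards [continuousAt_const.eventually_lt continuous_snd.continuousAt hy] with z' hz'
    rw [loopIndex_of_pos hz', loopIndex_of_pos hz']
  have hz1 : |z.1| = 1 := by
    rw [Prod.norm_def, Real.norm_eq_abs, Real.norm_eq_abs] at hz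
    rcases max_choice |z.1| |z.2| with h | h <;> rw [h] at hz
    · exact hz
    · rw [abs_of_nonpos hy] at hz
      have h1 := (Real.sqrt_le_left (by norm_num : (0 : ℝ) ≤ 3 / 4)).1 hs
      nlinarith
  have hwk := abs_loopWidth_lt_one hk1 (hs.trans_lt (by norm_num))
  have hwl := abs_loopWidth_lt_one hl1 (hs.trans_lt (by norm_num))
  have hne : ∀ v : ℝ, |v| < 1 → z.1 ≠ v ∧ z.1 ≠ -v := by
    intro v hv
    constructor
    · rintro h
      rw [← h] at hv
      exact hv.ne hz1
    · rintro h
      rw [← abs_neg, ← h] at hv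
      exact hv.ne hz1
  filter_upwards [eventually_loopIndex_eq hk (hne _ hwk).1 (hne _ hwk).2,
    eventually_loopIndex_eq hl (hne _ hwl).1 (hne _ hwl).2] with z' h1 h2
  rw [h1, h2, loopIndex_of_abs_lt_one hz1 hwk, loopIndex_of_abs_lt_one hz1 hwl]

/-! ### Invariance under the Reidemeister moves. -/

section Moves

variable {S : Type*} [TopologicalSpace S] [ChartedSpace Plane S] {D D' : KnotoidDiagram S}

/-- Since the first coordinate of `c i u` is `u`, the parameter `τ i` is a coordinate of the diagram
and hence continuous; this gives continuity of all the plane curves on the square. -/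
theorem ReplacedInDisk.exists_strands {n : ℕ} [NeZero n] {c c' : Fin n → ℝ → Plane}
    (h : ReplacedInDisk c c' D D') (hfst : ∀ i u, (c i u).1 = u) :
    (∀ i, ContinuousOn (c i) (Icc (-1) 1) ∧ ContinuousOn (c' i) (Icc (-1) 1)) ∧
    ∃ (e : OpenPartialHomeomorph S Plane) (a b : ℕ → unitInterval)
      (τ : ℕ → unitInterval → ℝ) (σ : ℕ → ℤ) (κ : ℕ → Fin n),
      (∀ i < n, ∀ j < n, κ i = κ j → i = j) ∧
      StrandsInDisk D e n a b τ σ (fun i => c (κ i)) ∧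
      StrandsInDisk D' e n a b τ σ (fun i => c' (κ i)) ∧
      ∀ t, (∀ i < n, t ∉ Icc (a i) (b i)) → D'.curve t = D.curve t ∧
        (t ∈ D'.under ↔ t ∈ D.under) := by
  obtain ⟨e, a, b, τ, height, he, hsq, hab, hdisj, hτ, hstrand, hout, hinj, hheight⟩ := h
  have hτc : ∀ i, ContinuousOn (τ i) (Icc (a i) (b i)) := by
    intro i
    have h1 : ContinuousOn (fun t => (e (D.curve t)).1) (Icc (a i) (b i)) :=
      continuous_fst.comp_continuousOn (e.continuousOn.comp D.curve.continuous.continuousOn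
        fun t ht => (hstrand i t ht).1.1)
    refine h1.congr fun t ht => ?_
    exact (hfst i _).symm.trans (congrArg Prod.fst (hstrand i t ht).1.2.symm)
  have hsurj : ∀ i, Icc (-1) 1 ⊆ τ i '' Icc (a i) (b i) := by
    intro i
    have hle := (hab i).2.1.le
    rcases hτ i with ⟨-, h1, h2⟩ | ⟨-, h1, h2⟩
    · have h3 : (Icc (a i) (b i)).OrdConnected := ordConnected_Icc
      have := ((isPreconnected_of_ordConnected h3).image _ (hτc i)).ordConnected.out
        (mem_image_of_mem _ (left_mem_Icc.2 hle)) (mem_image_of_mem _ (right_mem_Icc.2 hle))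
      rwa [h1, h2] at this
    · have h3 : (Icc (a i) (b i)).OrdConnected := ordConnected_Icc
      have := ((isPreconnected_of_ordConnected h3).image _ (hτc i)).ordConnected.out
        (mem_image_of_mem _ (right_mem_Icc.2 hle)) (mem_image_of_mem _ (left_mem_Icc.2 hle))
      rwa [h1, h2] at this
  constructor
  · intro i
    constructor
    · refine (continuousOn_image_of_comp isCompact_Icc (hτc i) ?_).mono (hsurj i)
      exact (e.continuousOn.comp D.curve.continuous.continuousOn
        fun t ht => (hstrand i t ht).1.1).congr fun t ht => (hstrand i t ht).1.2.symm
    · refine (continuousOn_image_of_comp isCompact_Icc (hτc i) ?_).mono (hsurj i)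
      exact (e.continuousOn.comp D'.curve.continuous.continuousOn
        fun t ht => (hstrand i t ht).2.1).congr fun t ht => (hstrand i t ht).2.2.symm
  have hσ : ∀ i, ∃ σ : ℤ, (σ = 1 ∨ σ = -1) ∧
      StrictMonoOn (fun t => (σ : ℝ) * τ i t) (Icc (a i) (b i)) ∧ τ i (a i) = -σ ∧
      τ i (b i) = σ := by
    intro i
    rcases hτ i with ⟨h1, h2, h3⟩ | ⟨h1, h2, h3⟩
    · exact ⟨1, Or.inl rfl, by simpa using h1, by simpa using h2, by simpa using h3⟩
    · refine ⟨-1, Or.inr rfl, ?_, by simpa using h2, by simpa using h3⟩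
      simpa using h1.neg
  choose σ hσ1 hσm hσa hσb using hσ
  -- Sort the strands by decreasing height: the top strand gets index 0, and each strand passes
  -- under those of smaller index, as the triangular recursion for the colors needs.
  set κ : ℕ → Fin n := fun i => Tuple.sort (fun j => OrderDual.toDual (height j)) (Fin.ofNat n i)
    with hκ
  have hκi : ∀ i < n, ∀ j < n, κ i = κ j → i = j := by
    intro i hi j hj hij
    have h1 := congrArg Fin.val ((Equiv.injective _) hij)
    simpa [Fin.ofNat, Nat.mod_eq_of_lt hi, Nat.mod_eq_of_lt hj] using h1
  have hκs : ∀ j, ∃ i < n, κ i = j := by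
    intro j
    refine ⟨((Tuple.sort (fun j => OrderDual.toDual (height j))).symm j : Fin n), Fin.is_lt _, ?_⟩
    simp [hκ, Fin.ofNat, Nat.mod_eq_of_lt]
  have hlt : ∀ i < n, ∀ j < n, i < j → height (κ j) < height (κ i) := by
    intro i hi j hj hij
    have h1 : Fin.ofNat n i ≤ Fin.ofNat n j := by
      rw [Fin.le_def]
      simpa [Fin.ofNat, Nat.mod_eq_of_lt hi, Nat.mod_eq_of_lt hj] using hij.le
    have h2 := Tuple.monotone_sort (fun j => OrderDual.toDual (height j)) h1
    refine lt_of_le_of_ne h2 fun h3 => ?_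
    exact hij.ne' (hκi j hj i hi (hinj h3))
  have hiff : ∀ i < n, ∀ j < n, i ≠ j → (height (κ i) < height (κ j) ↔ j < i) := by
    intro i hi j hj hij
    rcases hij.lt_or_gt with h | h
    · exact iff_of_false (hlt i hi j hj h).not_gt h.not_gt
    · exact iff_of_true (hlt j hj i hi h) h
  have hforall : ∀ t, (∀ i < n, t ∉ Icc (if i < n then a (κ i) else 0) (b (κ i))) →
      ∀ i, t ∉ Icc (a i) (b i) := by
    intro t ht i
    obtain ⟨j, hj, rfl⟩ := hκs i
    simpa only [if_pos hj] using ht j hj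
  have hne : ∀ {i j}, i < n → j < n → i ≠ j → κ i ≠ κ j := fun hi hj hij h =>
    hij (hκi _ hi _ hj h)
  -- For `i ≥ n` the left end is given the value 0, an endpoint of the diagram: it is not a double
  -- point and lies outside the disk, like the true left ends.
  refine ⟨e, fun i => if i < n then a (κ i) else 0, fun i => b (κ i), fun i => τ (κ i),
    fun i => σ (κ i), κ, hκi, ?_, ?_, fun t ht => ?_⟩
  · exact
    { chart := he
      square_subset := hsq
      bounds := fun i hi => by simpa only [if_pos hi] using hab (κ i)
      default := fun i hi => if_neg hi.not_gt
      disjoint := fun i hi j hj hij => by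
        simpa only [if_pos hi, if_pos hj] using hdisj _ _ (hne hi hj hij)
      sign := fun i _ => hσ1 (κ i)
      mono := fun i hi => by simpa only [if_pos hi] using hσm (κ i)
      left := fun i hi => by simpa only [if_pos hi] using hσa (κ i)
      right := fun i _ => hσb (κ i)
      continuousOn := fun i hi => by simpa only [if_pos hi] using hτc (κ i)
      strand := fun i hi t ht => (hstrand (κ i) t (by simpa only [if_pos hi] using ht)).1
      outside := fun t ht h => (hout t (hforall t ht)).2.2 ⟨h.1, mem_square_iff.2 h.2⟩
      under := fun i hi j hj hij s hs t ht hst => by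
        simp only [if_pos hi] at hs
        simp only [if_pos hj] at ht
        exact ((hheight _ _ (hne hi hj hij) s hs t ht).1 hst).trans (hiff i hi j hj hij) }
  · exact
    { chart := he
      square_subset := hsq
      bounds := fun i hi => by simpa only [if_pos hi] using hab (κ i)
      default := fun i hi => if_neg hi.not_gt
      disjoint := fun i hi j hj hij => by
        simpa only [if_pos hi, if_pos hj] using hdisj _ _ (hne hi hj hij)
      sign := fun i _ => hσ1 (κ i)
      mono := fun i hi => by simpa only [if_pos hi] using hσm (κ i)
      left := fun i hi => by simpa only [if_pos hi] using hσa (κ i)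
      right := fun i _ => hσb (κ i)
      continuousOn := fun i hi => by simpa only [if_pos hi] using hτc (κ i)
      strand := fun i hi t ht => (hstrand (κ i) t (by simpa only [if_pos hi] using ht)).2
      outside := fun t ht h => by
        have h1 := hout t (hforall t ht)
        rw [h1.1] at h
        exact h1.2.2 ⟨h.1, mem_square_iff.2 h.2⟩
      under := fun i hi j hj hij s hs t ht hst => by
        simp only [if_pos hi] at hs
        simp only [if_pos hj] at ht
        exact ((hheight _ _ (hne hi hj hij) s hs t ht).2 hst).trans (hiff i hi j hj hij) }
  · have h1 := hout t (hforall t ht)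
    exact ⟨h1.1, h1.2.1⟩

variable [T2Space S] [HasGroupoid S orientedGroupoid] (X Y : Type*) [Quandle X] [QuandleSet X Y]

/-- One statement for the second and third moves: in any family of graphs with distinct ends, the
graphs may be changed away from their ends. -/
theorem ReplacedInDisk.nonempty_equiv_of_graphs {n : ℕ} [NeZero n] {f f' : Fin n → ℝ → ℝ}
    (h : ReplacedInDisk (fun i u => (u, f i u)) (fun i u => (u, f' i u)) D D')
    (hlt : ∀ i u, |u| ≤ 1 → |f i u| < 1) (hlt' : ∀ i u, |u| ≤ 1 → |f' i u| < 1)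
    (heq : ∀ i u, 3 / 4 ≤ |u| → f' i u = f i u)
    (hends : ∀ i j u, |u| = 1 → f i u = f j u → i = j) :
    Nonempty (Coloring X Y D ≃ Coloring X Y D') := by
  obtain ⟨hc, e, a, b, τ, σ, κ, hκ, H, H', hout⟩ := h.exists_strands fun _ _ => rfl
  -- The functions are known to be continuous only on `[-1, 1]`; composition with the retraction `r`
  -- extends them continuously to the line.
  set r : ℝ → ℝ := fun x => (projIcc (-1 : ℝ) 1 (by norm_num) x : Icc (-1 : ℝ) 1) with hr
  have hr1 : ∀ x, |r x| ≤ 1 := fun x => abs_le.2 (projIcc _ _ _ x).2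
  have hrx : ∀ x, |x| ≤ 1 → r x = x := fun x hx => by
    simp only [hr, projIcc_of_mem _ (show x ∈ Icc (-1 : ℝ) 1 from abs_le.1 hx)]
  have hrc : Continuous r := continuous_subtype_val.comp continuous_projIcc
  have hr34 : ∀ x, 3 / 4 ≤ |x| → 3 / 4 ≤ |r x| := by
    intro x hx
    rcases le_or_gt |x| 1 with h | h
    · rwa [hrx x h]
    · rcases lt_abs.1 h with h | h
      · simp only [hr, projIcc_of_right_le _ h.le]
        norm_num
      · simp only [hr, projIcc_of_le_left _ (show x ≤ -1 by linarith)]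
        norm_num
  have hfc : ∀ i, Continuous (fun x => f i (r x)) := fun i =>
    (continuous_snd.comp_continuousOn (hc i).1).comp_continuous hrc fun x => abs_le.1 (hr1 x)
  have hfc' : ∀ i, Continuous (fun x => f' i (r x)) := fun i =>
    (continuous_snd.comp_continuousOn (hc i).2).comp_continuous hrc fun x => abs_le.1 (hr1 x)
  have hends' : ∀ i j u, |u| = 1 → f' i u = f' j u → i = j := by
    intro i j u hu hij
    rw [heq i u (by rw [hu]; norm_num), heq j u (by rw [hu]; norm_num)] at hij
    exact hends i j u hu hij
  refine H.nonempty_equiv H' (w := fun i => graphIndex fun x => f (κ i) (r x))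
    (w' := fun i => graphIndex fun x => f' (κ i) (r x)) ?_ ?_ ?_ ?_ hout X Y
  · refine curveIndex_graph (fun i _ u hu => by rw [hrx u hu]) (fun i _ => hfc _)
      (fun i _ u _ => hlt _ _ (hr1 u)) fun i hi j hj u hu hij => ?_
    rw [hrx u hu.le] at hij
    exact hκ i hi j hj (hends _ _ u hu hij)
  · refine curveIndex_graph (fun i _ u hu => by rw [hrx u hu]) (fun i _ => hfc' _)
      (fun i _ u _ => hlt' _ _ (hr1 u)) fun i hi j hj u hu hij => ?_
    rw [hrx u hu.le] at hij
    exact hκ i hi j hj (hends' _ _ u hu hij)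
  · intro i _ u hu
    simp only [heq _ u hu]
  · intro i _ z hz
    exact eventually_graphIndex_eq_of_norm_eq_one (hfc _) (hfc' _) (fun u => hlt _ _ (hr1 u))
      (fun u => hlt' _ _ (hr1 u)) (fun u hu => heq _ _ (hr34 u hu)) hz

theorem ReidemeisterOne.nonempty_equiv (h : ReidemeisterOne D D') :
    Nonempty (Coloring X Y D ≃ Coloring X Y D') := by
  obtain ⟨k, hk, hk1, hlt, hneg, hpos, h⟩ := h
  obtain ⟨hc, e, a, b, τ, σ, κ, hκ, H, H', hout⟩ := h.exists_strands fun i u => by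
    rw [Subsingleton.elim i 0]
    rfl
  have hκ0 : ∀ i, κ i = 0 := fun i => Subsingleton.elim _ _
  simp only [hκ0, Matrix.cons_val_zero] at H H'
  -- For `|u| < 1` continuity comes from the strand of `D'`; farther out the function is `u` itself.
  have hXc : Continuous (fun u => u * k u) := by
    rw [continuous_iff_continuousAt]
    intro u
    rcases lt_or_ge |u| 1 with hu | hu
    · have hu' := abs_lt.1 hu
      exact (continuous_fst.comp_continuousOn (hc 0).2).continuousAt
        (Icc_mem_nhds hu'.1 hu'.2)
    · refine continuousAt_id.congr ?_
      filter_upwards [continuousAt_const.eventually_lt continuous_abs.continuousAt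
        (show (3 / 4 : ℝ) < |u| by linarith)] with v hv
      rw [hk1 v hv.le, mul_one, id]
  have hwc : Continuous (loopWidth k) :=
    hXc.comp (by fun_prop : Continuous fun y : ℝ => √(-2 * y))
  have hwc1 : Continuous (loopWidth fun _ => 1) := by
    unfold loopWidth
    fun_prop
  have hk0 : ∀ u, |u| < 1 → k u = 0 → |u| = 1 / 2 := by
    intro u _ hu
    rcases lt_trichotomy |u| (1 / 2) with h1 | h1 | h1
    · exact absurd hu (hneg u h1).ne
    · exact h1
    · exact absurd hu (hpos u h1).ne'
  have hlt1 : ∀ u : ℝ, |u| < 1 → |u * 1| < 1 := fun u hu => by rwa [mul_one]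
  -- The strand without a kink is the case `k = 1` of the same family of curves.
  have C := curveIndex_loop (k := fun _ => 1) (fun _ => rfl) (fun _ _ => rfl) hlt1
    (fun _ _ h => absurd h one_ne_zero) hwc1
  simp only [mul_one] at C
  refine H.nonempty_equiv H' C (curveIndex_loop hk hk1 hlt hk0 hwc) ?_ ?_ hout X Y
  · intro i _ u hu
    rw [hk1 u hu, mul_one]
  · intro i _ z hz
    exact eventually_loopIndex_eq_of_norm_eq_one hwc1 hwc hlt1 hlt hk1 hz

theorem ReidemeisterTwo.nonempty_equiv (h : ReidemeisterTwo D D') :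
    Nonempty (Coloring X Y D ≃ Coloring X Y D') := by
  obtain ⟨f, f', hlt, heq, hneg, -, -, h⟩ := h
  refine ReplacedInDisk.nonempty_equiv_of_graphs (n := 2) X Y (f := ![f, fun _ => 0])
    (f' := ![f', fun _ => 0]) ?_ ?_ ?_ ?_ ?_
  · convert h using 2 <;> (rename_i i; fin_cases i <;> rfl)
  · simpa [Fin.forall_fin_two] using fun u hu => (hlt u hu).1
  · simpa [Fin.forall_fin_two] using fun u hu => (hlt u hu).2
  · simpa [Fin.forall_fin_two] using heq
  · intro i j u hu
    have := hneg u hu.le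
    fin_cases i <;> fin_cases j <;> simp [this.ne, this.ne']

theorem ReidemeisterThree.nonempty_equiv (h : ReidemeisterThree D D') :
    Nonempty (Coloring X Y D ≃ Coloring X Y D') := by
  obtain ⟨f, f', hlt, heq, hf, -, h⟩ := h
  have hhalf : ∀ u : ℝ, |u| ≤ 1 → |u / 2| < 1 ∧ |-u / 2| < 1 := by
    intro u hu
    have := abs_le.1 hu
    constructor <;> rw [abs_lt] <;> constructor <;> linarith
  refine ReplacedInDisk.nonempty_equiv_of_graphs (n := 3) X Y
    (f := ![f, fun u => u / 2, fun u => -u / 2])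
    (f' := ![f', fun u => u / 2, fun u => -u / 2]) ?_ ?_ ?_ ?_ ?_
  · convert h using 2 <;> (rename_i i; fin_cases i <;> rfl)
  · intro i u hu
    fin_cases i
    exacts [(hlt u hu).1, (hhalf u hu).1, (hhalf u hu).2]
  · intro i u hu
    fin_cases i
    exacts [(hlt u hu).2, (hhalf u hu).1, (hhalf u hu).2]
  · intro i u hu
    fin_cases i
    exacts [heq u hu, rfl, rfl]
  · intro i j u hu
    obtain ⟨h1, h2, h3, h4⟩ := hf u hu.le
    have h12 : f u ≠ u / 2 ∧ f u ≠ -u / 2 ∧ u / 2 ≠ -u / 2 := by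
      rcases (abs_eq zero_le_one).1 hu with rfl | rfl
      · exact ⟨(h2 (by norm_num)).ne, (h4 (by norm_num)).ne', by norm_num⟩
      · exact ⟨(h1 (by norm_num)).ne', (h3 (by norm_num)).ne, by norm_num⟩
    obtain ⟨h5, h6, h7⟩ := h12
    fin_cases i <;> fin_cases j <;> intro hij <;>
      first | rfl | exact absurd hij h5 | exact absurd hij h6 | exact absurd hij h7 |
        exact absurd hij.symm h5 | exact absurd hij.symm h6 | exact absurd hij.symm h7

theorem Move.nonempty_equiv (h : Move D D') : Nonempty (Coloring X Y D ≃ Coloring X Y D') := by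
  cases h with
  | isotopy h => exact h.nonempty_equiv X Y
  | one h => exact h.nonempty_equiv X Y
  | two h => exact h.nonempty_equiv X Y
  | three h => exact h.nonempty_equiv X Y

theorem Equivalent.nonempty_equiv (h : Equivalent D D') :
    Nonempty (Coloring X Y D ≃ Coloring X Y D') := by
  induction h with
  | rel _ _ h => exact h.nonempty_equiv X Y
  | refl _ => exact ⟨Equiv.refl _⟩
  | symm _ _ _ ih => exact ih.map Equiv.symm
  | trans _ _ _ _ _ ih₁ ih₂ => exact ⟨ih₁.some.trans ih₂.some⟩

end Moves

end Knotoids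

theorem proposition3p2 {S : Type*} [TopologicalSpace S] [T2Space S] [SecondCountableTopology S]
    [ChartedSpace Knotoids.Plane S] [HasGroupoid S Knotoids.orientedGroupoid]
    (X Y : Type*) [Quandle X] [Knotoids.QuandleSet X Y] :
    (∀ D D' : Knotoids.KnotoidDiagram S, Knotoids.Equivalent D D' →
      Nonempty (Knotoids.Coloring X Y D ≃ Knotoids.Coloring X Y D')) ∧
    ∃ invariant : Knotoids.Knotoid S → Cardinal,
      ∀ D : Knotoids.KnotoidDiagram S,
        invariant D.toKnotoid = Knotoids.coloringNumber X Y D := by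
  refine ⟨fun D D' h => h.nonempty_equiv X Y, Quotient.lift (Knotoids.coloringNumber X Y) ?_,
    fun D => rfl⟩
  intro D D' h
  exact Cardinal.eq.2 (Knotoids.Equivalent.nonempty_equiv X Y h)
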